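/- All chains are finite, irreducible, discrete-time, lazy ($P(x,x)\ge 1/2$) and reversible with respect to their stationary law $\pi$. Let $d(t)=\max_x\|P^t(x,\cdot)-\pi\|_{\mathrm{TV}}$, $d_{\mathrm{sep}}(t)=1-\min_{x,y}P^t(x,y)/\pi(y)$, $t_{\mathrm{mix}}(\varepsilon)=\inf\{t: d(t)\le\varepsilon\}$, $t_{\mathrm{sep}}(\varepsilon)=\inf\{t: d_{\mathrm{sep}}(t)\le\varepsilon\}$. A sequence of chains has total-variation (TV) cutoff if $\lim_n t^{(n)}_{\mathrm{mix}}(\varepsilon)/t^{(n)}_{\mathrm{mix}}(1-\varepsilon)=1$ for all $\varepsilon\in(0,1/2]$; its TV pre-cutoff ratio is $\rho_{\mathrm{TV}}=\sup_{0<\varepsilon<1/2}\limsup_n t^{(n)}_{\mathrm{mix}}(\varepsilon)/t^{(n)}_{\mathrm{mix}}(1-\varepsilon)\in[0,\infty]$, and it has TV pre-cutoff if $\rho_{\mathrm{TV}}<\infty$. Separation cutoff, $\rho_{\mathrm{sep}}$ and separation pre-cutoff are defined in the same way with $t_{\mathrm{sep}}$ in place of $t_{\mathrm{mix}}$. For $n\ge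 2$ consider the network with vertices $a_n,\dots,a_1,z,b_1,\dots,b_n$ (write $a_0=b_0=z$) and conductances $2^{-k}$ on $\{a_k,a_{k-1}\}$ and on $\{b_k,b_{k-1}\}$ for $1\le k\le n$, together with additional edges $\{z,b_k\}$ of conductance $3\cdot 2^{-(k+1)}/(n-1)$ for $1\le k<n$ and $2^{-n}/(n-1)$ for $k=n$ (the two parallel edges $\{z,b_1\}$ add up). Let the $n$-th chain be the random walk on it with holding probability $1/2$ at each vertex. (1) These are irreducible lazy reversible chains, $t^{(n)}_{\mathrm{mix}}(1/4)\to\infty$, and the sequence has TV cutoff. It has no separation cutoff, but it has separation pre-cutoff with ratio exactly $\rho_{\mathrm{sep}}=2$. Moreover $$\lim_{n\to\infty}d^{(n)}_{\mathrm{sep}}(\lfloor sn\rfloor)=\begin{cases}1,&0\le s\le 6,\\ e^{-(s-6)/2},&6\le s<12,\\ 0,&s>12.\end{cases}$$ (2) There is a sequence of irreducible lazy reversible chains with $t^{(n)}_{\mathrm{mix}}(1/4)\to\infty$ that has separation cutoff and no TV cutoff, but has TV pre-cutoff with ratio exactly $\rho_{\mathrm{TV}}=2$. (3) Consequently the factor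 $2$ in the comparisons $\rho_{\mathrm{sep}}\le 2\rho_{\mathrm{TV}}$ and $\rho_{\mathrm{TV}}\le 2\rho_{\mathrm{sep}}$ is sharp: if $c\in[0,\infty]$ is such that $\rho_{\mathrm{sep}}\le c\,\rho_{\mathrm{TV}}$ for every sequence of irreducible lazy reversible chains with $t^{(n)}_{\mathrm{mix}}(1/4)\to\infty$, then $c\ge 2$; and likewise if $\rho_{\mathrm{TV}}\le c\,\rho_{\mathrm{sep}}$ for every such sequence, then $c\ge 2$. -/

import Mathlib

open Filter Topology
open scoped ENNReal

noncomputable section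

/-- The data of a finite Markov chain: a finite state space, a transition matrix `P`,
and a weight `stat` on the states. The laws are in `FiniteChain.IsLazyReversible`. -/
structure FiniteChain where
  State : Type
  instFintype : Fintype State
  instDecidableEq : DecidableEq State
  P : Matrix State State ℝ
  stat : State → ℝ

attribute [instance] FiniteChain.instFintype FiniteChain.instDecidableEq

namespace FiniteChain

/-- `P` is the transition matrix of an irreducible lazy chain which is reversible with respect
to the probability measure `stat` (so that `stat` is its unique stationary distribution). -/
structure IsLazyReversible (X : FiniteChain) : Prop where
  stochastic : X.P ∈ Matrix.rowStochastic ℝ X.State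
  irreducible : X.P.IsIrreducible
  lazy : ∀ x, 1 / 2 ≤ X.P x x
  stat_nonneg : ∀ x, 0 ≤ X.stat x
  stat_sum : ∑ x, X.stat x = 1
  detailed_balance : ∀ x y, X.stat x * X.P x y = X.stat y * X.P y x

/-- Worst-case total-variation distance to stationarity at time `t`. -/
def tvDist (X : FiniteChain) (t : ℕ) : ℝ :=
  ⨆ x, (1 / 2) * ∑ y, |(X.P ^ t) x y - X.stat y|

/-- Worst-case separation distance to stationarity at time `t`. -/
def sepDist (X : FiniteChain) (t : ℕ) : ℝ :=
  1 - ⨅ x, ⨅ y, (X.P ^ t) x y / X.stat y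

/-- The total-variation `ε`-mixing time. -/
def tMix (X : FiniteChain) (ε : ℝ) : ℕ := sInf {t : ℕ | X.tvDist t ≤ ε}

/-- The `ε`-separation time. -/
def tSep (X : FiniteChain) (ε : ℝ) : ℕ := sInf {t : ℕ | X.sepDist t ≤ ε}

end FiniteChain

/-- Abrupt transition for a sequence of times `T n ε`: the ratio `T n ε / T n (1 - ε)` tends to
`1` for every `ε ∈ (0, 1/2]`. -/
def CutoffOf (T : ℕ → ℝ → ℕ) : Prop :=
  ∀ ε : ℝ, 0 < ε → ε ≤ 1 / 2 →
    Tendsto (fun n => (T n ε : ℝ≥0∞) / (T n (1 - ε) : ℝ≥0∞)) atTop (𝓝 1)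

/-- The supremum over `ε ∈ (0, 1/2)` of the upper limit of `T n ε / T n (1 - ε)`. -/
def precutoffRatioOf (T : ℕ → ℝ → ℕ) : ℝ≥0∞ :=
  ⨆ ε ∈ Set.Ioo (0 : ℝ) (1 / 2),
    limsup (fun n => (T n ε : ℝ≥0∞) / (T n (1 - ε) : ℝ≥0∞)) atTop

/-- Total-variation cutoff of a sequence of chains. -/
def TVCutoff (X : ℕ → FiniteChain) : Prop := CutoffOf fun n => (X n).tMix

/-- Separation cutoff of a sequence of chains. -/
def SepCutoff (X : ℕ → FiniteChain) : Prop := CutoffOf fun n => (X n).tSep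

/-- The pre-cutoff ratio in total variation (`∞` is allowed). -/
def tvRatio (X : ℕ → FiniteChain) : ℝ≥0∞ := precutoffRatioOf fun n => (X n).tMix

/-- The pre-cutoff ratio in separation (`∞` is allowed). -/
def sepRatio (X : ℕ → FiniteChain) : ℝ≥0∞ := precutoffRatioOf fun n => (X n).tSep

/-- Pre-cutoff in total variation. -/
def TVPrecutoff (X : ℕ → FiniteChain) : Prop := tvRatio X < ∞

/-- Pre-cutoff in separation. -/
def SepPrecutoff (X : ℕ → FiniteChain) : Prop := sepRatio X < ∞

/-- The (`1/4`-)mixing times tend to infinity. -/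
def TMixTendsToInfinity (X : ℕ → FiniteChain) : Prop :=
  Tendsto (fun n => (X n).tMix (1 / 4)) atTop atTop

namespace KilledSegment

/-! The states are the integers in `[-n, n]`: the centre `z` is `0`, the state `a_k` is `-k` and
the state `b_k` is `k`, for `1 ≤ k ≤ n`. -/

/-- The state space `{a_n, …, a_1, z, b_1, …, b_n}`. -/
abbrev Pos (n : ℕ) : Type := Finset.Icc (-(n : ℤ)) (n : ℤ)

/-- Conductances of the nearest-neighbour edges: the edge between the positions `±(k-1)` and `±k`
(same side) has conductance `2 ^ (-k)`. -/
def shortWeight (i j : ℤ) : ℝ :=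
  if |i - j| = 1 then (1 / 2 : ℝ) ^ (max i.natAbs j.natAbs) else 0

/-- Conductance of the additional (long) edge between `z` and `b_k`, for `1 ≤ k ≤ n`. -/
def longWeight (n k : ℕ) : ℝ :=
  if k < n then ((1 / 2 : ℝ) ^ k + (1 / 2 : ℝ) ^ (k + 1)) / ((n : ℝ) - 1)
  else (1 / 2 : ℝ) ^ n / ((n : ℝ) - 1)

/-- Total conductance between two positions (the two parallel edges between `z` and `b_1` add
up). -/
def weight (n : ℕ) (i j : ℤ) : ℝ :=
  shortWeight i j +
    (if i = 0 ∧ 0 < j then longWeight n j.natAbs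
     else if j = 0 ∧ 0 < i then longWeight n i.natAbs else 0)

/-- Total conductance at a position. -/
def totalWeight (n : ℕ) (x : Pos n) : ℝ := ∑ y : Pos n, weight n x y

/-- The `1/2`-lazy random walk on this network, with its stationary distribution. It is meant
for `n ≥ 2`. -/
def chain (n : ℕ) : FiniteChain where
  State := Pos n
  instFintype := inferInstance
  instDecidableEq := inferInstance
  P := fun x y => if x = y then 1 / 2 else weight n x y / (2 * totalWeight n x)
  stat := fun x => totalWeight n x / ∑ y : Pos n, totalWeight n y

end KilledSegment

end

/-! Let h_t(x,y) = P^t(x,y)/π(y) (`density`). Reversibility makes h symmetric, and laziness makes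
the return density h_t(z,z) nonincreasing in t, so that it is at least 1 at all times. For fixed y
the defect 1 - h_t(x,y) solves the heat equation in (t,x) and is at most 0 at x = y. Comparison with
a supersolution then bounds 1 - h_t(x,z) by the probability that the walk from x has not met z by
time t. By symmetry this is also a boundary value at z for any target y, and a second comparison
gives 1 - h_t(x,y) ≤ P(T_x + T_y > t), with T_x and T_y independent hitting times of z from x and y.
Hitting times themselves are never formalized: explicit exponentials (1+x)^(distance) l^t and
(1+x)^(-distance) m^t replace their tails (`one_sub_density_root_le`, `one_sub_density_pair_le`,
`segmentProfile`), and they give the exact speed as x tends to 0. In both examples π concentrates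
near a root z, so total variation sees only T_x, while separation sees the worst pair.

First chain. Each side drifts to the centre at speed 1/6, so an end needs about 6n steps, and total
variation has cutoff at 6n. On the b-side there is in addition a chance 1/(2n) per step of jumping
to the centre. For the two ends a_n and b_n, the first hitting time is about 6n and the second is
roughly an exponential time of mean 2n truncated at 6n, so the defect at time sn is about P(T_b >
(s-6)n) = e^(-(s-6)/2) up to s = 12. No other pair is worse. With a target on the b-side,
`one_sub_density_right_le` gives the bound e^3 (1-1/(2n))^t in the limit; for two states on the
a-side the walk from the farther one passes through the nearer one, which serves as its own root, so
about 6n steps suffice (`one_sub_density_left_le`).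

Second chain. The drift is so strong that the walk moves at speed 1/2, its laziness. An arm takes 2N
steps. From the top of the trunk, 2N steps lead to its bottom; then with probability about 1/3 the
walk is at the root, and otherwise it has another arm of 2N steps to go. So the total-variation
distance falls below 1 at 2N but stays bounded away from 0 until 4N. Separation between the two arm
ends takes 2N + 2N steps. A pair involving the upper trunk could look slower, but there the walk
passes through the second state, whose stationary mass is so tiny that a single path already gives
density at least 1 (`one_le_density`). Hence separation has cutoff at 4N.

`cutoffOf_of_tendsto` and `precutoffRatioOf_eq_two` turn these profiles into statements on first
times. A cutoff has ratio 1, so each example forces 2 ≤ c. -/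

set_option linter.unusedSectionVars false

/-! ### Lazy reversible chains: comparison principle, densities, distances. -/

namespace FiniteChain

/-- The comparison principle: a subsolution of the heat equation on a set of states stays below a
supersolution as long as it does so initially and outside of the set. -/
theorem le_of_subsolution {V : Type*} [Fintype V] {P : Matrix V V ℝ} (hP : ∀ x y, 0 ≤ P x y)
    {v W : ℕ → V → ℝ} (A : Set V) (T : ℕ) (h0 : ∀ x, v 0 x ≤ W 0 x)
    (hA : ∀ t, t ≤ T → ∀ x, x ∉ A → v t x ≤ W t x)
    (hv : ∀ t, t < T → ∀ x, x ∈ A → v (t + 1) x ≤ ∑ y, P x y * v t y)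
    (hW : ∀ t, t < T → ∀ x, x ∈ A → ∑ y, P x y * W t y ≤ W (t + 1) x) :
    ∀ t, t ≤ T → ∀ x, v t x ≤ W t x := by
  intro t
  induction t with
  | zero => intro _ x; exact h0 x
  | succ t ih =>
    intro ht x
    by_cases hx : x ∈ A
    · calc v (t + 1) x ≤ ∑ y, P x y * v t y := hv t ht x hx
        _ ≤ ∑ y, P x y * W t y := Finset.sum_le_sum fun y _ =>
            mul_le_mul_of_nonneg_left (ih (by omega) y) (hP x y)
        _ ≤ W (t + 1) x := hW t ht x hx
    · exact hA (t + 1) ht x hx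

variable {X : FiniteChain}

/-- One step of the chain applied to a function. -/
noncomputable def step (X : FiniteChain) (F : X.State → ℝ) (x : X.State) : ℝ := ∑ y, X.P x y * F y

/-- The density of the law at time `t` with respect to the stationary law. -/
noncomputable def density (X : FiniteChain) (t : ℕ) (x y : X.State) : ℝ :=
  (X.P ^ t) x y / X.stat y

namespace IsLazyReversible

variable (hX : X.IsLazyReversible)
include hX

theorem P_nonneg (x y : X.State) : 0 ≤ X.P x y :=
  Matrix.nonneg_of_mem_rowStochastic hX.stochastic

theorem sum_P (x : X.State) : ∑ y, X.P x y = 1 :=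
  Matrix.sum_row_of_mem_rowStochastic hX.stochastic x

theorem pow_nonneg (t : ℕ) (x y : X.State) : 0 ≤ (X.P ^ t) x y :=
  Matrix.nonneg_of_mem_rowStochastic (pow_mem hX.stochastic t)

theorem sum_pow (t : ℕ) (x : X.State) : ∑ y, (X.P ^ t) x y = 1 :=
  Matrix.sum_row_of_mem_rowStochastic (pow_mem hX.stochastic t) x

theorem pow_le_one (t : ℕ) (x y : X.State) : (X.P ^ t) x y ≤ 1 :=
  Matrix.le_one_of_mem_rowStochastic (pow_mem hX.stochastic t)

theorem nonempty : Nonempty X.State := by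
  by_contra h
  rw [not_nonempty_iff] at h
  simpa using hX.stat_sum

theorem pow_reversible (t : ℕ) (x y : X.State) :
    X.stat x * (X.P ^ t) x y = X.stat y * (X.P ^ t) y x := by
  induction t generalizing x y with
  | zero =>
    by_cases h : x = y
    · subst h; rfl
    · simp [h, Ne.symm h]
  | succ t ih =>
    rw [pow_succ, Matrix.mul_apply, ← pow_succ, pow_succ', Matrix.mul_apply, Finset.mul_sum,
      Finset.mul_sum]
    refine Finset.sum_congr rfl fun k _ => ?_
    rw [← mul_assoc, ih, ← mul_assoc, hX.detailed_balance y k]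
    ring

/-- Some state has positive mass; irreducibility connects it to x, and reversibility of the
corresponding power of P transfers the positivity. -/
theorem stat_pos (x : X.State) : 0 < X.stat x := by
  obtain ⟨y, hy⟩ : ∃ y, 0 < X.stat y := by
    by_contra! h
    have := Finset.sum_nonpos fun y (_ : y ∈ Finset.univ) => h y
    rw [hX.stat_sum] at this
    linarith
  obtain ⟨k, -, hk⟩ :=
    (Matrix.isIrreducible_iff_exists_pow_pos hX.P_nonneg).1 hX.irreducible y x
  have h := hX.pow_reversible k y x
  rcases (hX.stat_nonneg x).eq_or_lt with h0 | h0
  · rw [← h0, zero_mul] at h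
    have := mul_pos hy hk
    linarith
  · exact h0

theorem density_nonneg (t : ℕ) (x y : X.State) : 0 ≤ X.density t x y :=
  div_nonneg (hX.pow_nonneg t x y) (hX.stat_nonneg y)

theorem density_le_inv (t : ℕ) (x y : X.State) : X.density t x y ≤ (X.stat y)⁻¹ := by
  rw [density, div_eq_mul_inv]
  exact mul_le_of_le_one_left (inv_nonneg.2 (hX.stat_nonneg y)) (hX.pow_le_one t x y)

theorem density_symm (t : ℕ) (x y : X.State) : X.density t x y = X.density t y x := by
  have := hX.pow_reversible t x y
  rw [density, density, div_eq_div_iff (hX.stat_pos y).ne' (hX.stat_pos x).ne']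
  linarith

theorem density_zero {x y : X.State} (h : x ≠ y) : X.density 0 x y = 0 := by
  simp [density, h]

theorem density_succ (t : ℕ) (x y : X.State) :
    X.density (t + 1) x y = X.step (fun z => X.density t z y) x := by
  simp only [density, step, pow_succ', Matrix.mul_apply, Finset.sum_div, mul_div_assoc]

theorem pow_eq (t : ℕ) (x y : X.State) : (X.P ^ t) x y = X.stat y * X.density t x y := by
  rw [density, mul_div_cancel₀ _ (hX.stat_pos y).ne']

theorem sum_stat_mul_density (t : ℕ) (x : X.State) : ∑ y, X.stat y * X.density t x y = 1 := by
  simp only [← hX.pow_eq, hX.sum_pow]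

theorem step_const (c : ℝ) (x : X.State) : X.step (fun _ => c) x = c := by
  rw [step, ← Finset.sum_mul, hX.sum_P, one_mul]

theorem step_one_sub (F : X.State → ℝ) (x : X.State) :
    X.step (fun y => 1 - F y) x = 1 - X.step F x := by
  simp only [step, mul_sub, mul_one, Finset.sum_sub_distrib, hX.sum_P]

theorem sum_stat_mul_step (F : X.State → ℝ) : ∑ x, X.stat x * X.step F x = ∑ x, X.stat x * F x := by
  simp only [step, Finset.mul_sum]
  rw [Finset.sum_comm]
  refine Finset.sum_congr rfl fun y _ => ?_
  have : ∀ x, X.stat x * (X.P x y * F y) = X.stat y * F y * X.P y x := fun x => by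
    rw [← mul_assoc, hX.detailed_balance]; ring
  simp only [this, ← Finset.mul_sum, hX.sum_P, mul_one]

/-- Chapman-Kolmogorov for densities. -/
theorem density_add (s t : ℕ) (x y : X.State) :
    X.density (s + t) x y = ∑ w, X.stat w * X.density s x w * X.density t w y := by
  rw [density, pow_add, Matrix.mul_apply, Finset.sum_div]
  refine Finset.sum_congr rfl fun w _ => ?_
  rw [← hX.pow_eq, density, mul_div_assoc]

/-- By symmetry and Chapman-Kolmogorov the return density at time 2t is the second moment under π of
a density of mean 1, so subtracting 1 leaves a variance. -/
theorem one_le_density_even (t : ℕ) (z : X.State) : 1 ≤ X.density (t + t) z z := by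
  have h : 0 ≤ ∑ w, X.stat w * (X.density t z w - 1) ^ 2 :=
    Finset.sum_nonneg fun w _ => mul_nonneg (hX.stat_nonneg w) (sq_nonneg _)
  have e : ∑ w, X.stat w * (X.density t z w - 1) ^ 2 = X.density (t + t) z z - 1 := by
    have : ∀ w, X.stat w * (X.density t z w - 1) ^ 2 =
        X.stat w * X.density t z w * X.density t w z - 2 * (X.stat w * X.density t z w)
          + X.stat w := fun w => by
      rw [hX.density_symm t w z]; ring
    simp only [this, Finset.sum_add_distrib, Finset.sum_sub_distrib, ← Finset.mul_sum,
      hX.sum_stat_mul_density, hX.stat_sum, ← hX.density_add]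
    ring
  linarith

/-- The Dirichlet form of a reversible stochastic matrix is nonnegative. -/
theorem dirichlet_nonneg {K : Matrix X.State X.State ℝ} (hK : ∀ x y, 0 ≤ K x y)
    (hK1 : ∀ x, ∑ y, K x y = 1) (hrev : ∀ x y, X.stat x * K x y = X.stat y * K y x)
    (F : X.State → ℝ) : ∑ x, X.stat x * F x * ∑ y, K x y * F y ≤ ∑ x, X.stat x * F x ^ 2 := by
  have h : 0 ≤ ∑ x, ∑ y, X.stat x * K x y * (F x - F y) ^ 2 :=
    Finset.sum_nonneg fun x _ => Finset.sum_nonneg fun y _ =>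
      mul_nonneg (mul_nonneg (hX.stat_nonneg x) (hK x y)) (sq_nonneg _)
  have e1 : ∑ x, ∑ y, X.stat x * K x y * F x ^ 2 = ∑ x, X.stat x * F x ^ 2 := by
    refine Finset.sum_congr rfl fun x _ => ?_
    rw [← Finset.sum_mul, ← Finset.mul_sum, hK1, mul_one]
  have e2 : ∑ x, ∑ y, X.stat x * K x y * F y ^ 2 = ∑ x, X.stat x * F x ^ 2 := by
    rw [Finset.sum_comm, ← e1]
    exact Finset.sum_congr rfl fun y _ => Finset.sum_congr rfl fun x _ => by rw [hrev]
  have e3 : ∑ x, ∑ y, X.stat x * K x y * (F x * F y) = ∑ x, X.stat x * F x * ∑ y, K x y * F y := by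
    refine Finset.sum_congr rfl fun x _ => ?_
    rw [Finset.mul_sum]
    exact Finset.sum_congr rfl fun y _ => by ring
  have e : ∑ x, ∑ y, X.stat x * K x y * (F x - F y) ^ 2 =
      ∑ x, ∑ y, X.stat x * K x y * F x ^ 2 + ∑ x, ∑ y, X.stat x * K x y * F y ^ 2
        - 2 * ∑ x, ∑ y, X.stat x * K x y * (F x * F y) := by
    simp only [Finset.mul_sum, ← Finset.sum_add_distrib, ← Finset.sum_sub_distrib]
    exact Finset.sum_congr rfl fun x _ => Finset.sum_congr rfl fun y _ => by ring
  rw [e, e1, e2, e3] at h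
  linarith

/-- With g = h_u(·,z), the values at times 2u, 2u+1, 2u+2 are ⟨g,g⟩, ⟨g,Pg⟩, ⟨Pg,Pg⟩. The first
inequality is positivity of the Dirichlet form of P; the second is where laziness enters. -/
theorem density_diag_antitone (z : X.State) : Antitone fun t => X.density t z z := by
  refine antitone_nat_of_succ_le fun t => ?_
  have key : ∀ u : ℕ, ∀ K : Matrix X.State X.State ℝ,
      ∑ w, X.stat w * X.density u z w * ∑ y, K w y * X.density u y z =
      ∑ w, X.stat w * X.density u w z * ∑ y, K w y * X.density u y z := fun u K =>
    Finset.sum_congr rfl fun w _ => by rw [hX.density_symm u z w]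
  have sq : ∀ u : ℕ, X.density (u + u) z z = ∑ w, X.stat w * X.density u w z ^ 2 := fun u => by
    rw [hX.density_add]
    refine Finset.sum_congr rfl fun w _ => ?_
    rw [hX.density_symm u z w]; ring
  rcases Nat.even_or_odd' t with ⟨u, rfl | rfl⟩
  · have := hX.dirichlet_nonneg hX.P_nonneg hX.sum_P hX.detailed_balance
      (fun w => X.density u w z)
    rw [two_mul, sq, add_assoc, hX.density_add]
    simp only [hX.density_succ, step]
    rw [key]
    exact this
  -- Laziness makes R = 2P - 1 stochastic. The Dirichlet inequality for R² reads ⟨Rg,Rg⟩ ≤ ⟨g,g⟩,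
  -- and expanding the square gives ⟨Pg,Pg⟩ ≤ ⟨g,Pg⟩.
  · let R : Matrix X.State X.State ℝ := fun x y => 2 * X.P x y - if x = y then 1 else 0
    have hR : ∀ F : X.State → ℝ, ∀ x, ∑ y, R x y * F y = 2 * X.step F x - F x := fun F x => by
      simp [R, step, sub_mul, Finset.sum_sub_distrib, Finset.mul_sum, mul_assoc]
    have hR0 : ∀ x y, 0 ≤ R x y := fun x y => by
      by_cases h : x = y
      · subst h; have := hX.lazy x; simp [R]; linarith
      · simp [R, h, hX.P_nonneg]
    have hRrev : ∀ x y, X.stat x * R x y = X.stat y * R y x := fun x y => by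
      by_cases h : x = y
      · subst h; rfl
      · have := hX.detailed_balance x y
        simp [R, h, Ne.symm h]; linarith
    have hR1 : ∀ x, ∑ y, R x y = 1 := fun x => by
      simp [R, Finset.sum_sub_distrib, ← Finset.mul_sum, hX.sum_P]; norm_num
    let G : X.State → ℝ := fun w => X.density u w z
    let H : X.State → ℝ := fun w => 2 * X.step G w - G w
    have hH : ∀ x, ∑ y, R x y * G y = H x := hR G
    have h := hX.dirichlet_nonneg (K := R * R) (fun x y => Finset.sum_nonneg fun w _ =>
        mul_nonneg (hR0 _ _) (hR0 _ _))
      (fun x => by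
        simp only [Matrix.mul_apply]
        rw [Finset.sum_comm]
        simp only [← Finset.mul_sum, hR1, mul_one])
      (fun x y => by
        simp only [Matrix.mul_apply, Finset.mul_sum]
        refine Finset.sum_congr rfl fun w _ => ?_
        rw [← mul_assoc, hRrev, mul_right_comm, hRrev]; ring) G
    have e1 : ∑ x, X.stat x * G x * ∑ y, (R * R) x y * G y = ∑ x, X.stat x * H x ^ 2 := by
      have a : ∀ x, ∑ y, (R * R) x y * G y = ∑ w, R x w * H w := fun x => by
        simp only [Matrix.mul_apply, Finset.sum_mul, ← hH, Finset.mul_sum]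
        rw [Finset.sum_comm]
        simp only [mul_assoc]
      simp only [a, Finset.mul_sum]
      rw [Finset.sum_comm]
      refine Finset.sum_congr rfl fun w _ => ?_
      have b : ∀ x, X.stat x * G x * (R x w * H w) = X.stat w * H w * (R w x * G x) := fun x => by
        have := hRrev x w
        calc _ = X.stat x * R x w * (G x * H w) := by ring
          _ = _ := by rw [this]; ring
      simp only [b, ← Finset.mul_sum, hH]
      ring
    rw [e1] at h
    have d1 : X.density (2 * u + 1) z z = ∑ x, X.stat x * G x * X.step G x := by
      rw [two_mul, add_assoc, hX.density_add]
      simp only [hX.density_succ, step]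
      rw [key]
    have d2 : X.density (2 * u + 1 + 1) z z = ∑ x, X.stat x * X.step G x ^ 2 := by
      rw [show 2 * u + 1 + 1 = (u + 1) + (u + 1) by ring, sq]
      simp only [hX.density_succ]
      rfl
    have e : ∑ x, X.stat x * H x ^ 2 = 4 * ∑ x, X.stat x * X.step G x ^ 2
        - 4 * ∑ x, X.stat x * G x * X.step G x + ∑ x, X.stat x * G x ^ 2 := by
      simp only [Finset.mul_sum, ← Finset.sum_add_distrib, ← Finset.sum_sub_distrib, H]
      exact Finset.sum_congr rfl fun x _ => by ring
    rw [d1, d2]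
    linarith

theorem one_le_density_diag (t : ℕ) (z : X.State) : 1 ≤ X.density t z z :=
  (hX.one_le_density_even t z).trans (hX.density_diag_antitone z (by omega))

theorem one_sub_density_le_one (t : ℕ) (x y : X.State) : 1 - X.density t x y ≤ 1 := by
  linarith [hX.density_nonneg t x y]

theorem bddAbove_tv (t : ℕ) :
    BddAbove (Set.range fun x => (1 / 2) * ∑ y, |(X.P ^ t) x y - X.stat y|) :=
  Set.finite_range _ |>.bddAbove

/-- The differences sum to zero, so half of the absolute sum is the positive part; in this form
pointwise upper bounds on the defect can be averaged under π. -/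
theorem tv_eq (t : ℕ) (x : X.State) :
    (1 / 2) * ∑ y, |(X.P ^ t) x y - X.stat y| =
      ∑ y, X.stat y * max (1 - X.density t x y) 0 := by
  have h : ∀ y, X.stat y * max (1 - X.density t x y) 0 =
      (1 / 2) * |(X.P ^ t) x y - X.stat y| + (1 / 2) * (X.stat y - (X.P ^ t) x y) := fun y => by
    rw [hX.pow_eq]
    have := hX.stat_pos y
    have e : X.stat y * X.density t x y - X.stat y = X.stat y * (X.density t x y - 1) := by ring
    rw [e, abs_mul, abs_of_pos this]
    rcases le_total (X.density t x y) 1 with h | h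
    · rw [max_eq_left (by linarith), abs_of_nonpos (by linarith)]; ring
    · rw [max_eq_right (by linarith), abs_of_nonneg (by linarith)]; ring
  simp only [h, Finset.sum_add_distrib, ← Finset.mul_sum, Finset.sum_sub_distrib, hX.stat_sum,
    hX.sum_pow]
  ring

theorem tvDist_le {t : ℕ} {c : ℝ} (W : X.State → X.State → ℝ) (hW0 : ∀ x y, 0 ≤ W x y)
    (hW : ∀ x y, 1 - X.density t x y ≤ W x y) (hc : ∀ x, ∑ y, X.stat y * W x y ≤ c) :
    X.tvDist t ≤ c := by
  have := hX.nonempty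
  refine ciSup_le fun x => ?_
  rw [hX.tv_eq]
  exact (Finset.sum_le_sum fun y _ => mul_le_mul_of_nonneg_left (max_le (hW x y) (hW0 x y))
    (hX.stat_nonneg y)).trans (hc x)

theorem tvDist_le_one (t : ℕ) : X.tvDist t ≤ 1 :=
  hX.tvDist_le (fun _ _ => 1) (fun _ _ => zero_le_one) (fun x y => hX.one_sub_density_le_one t x y)
    (fun x => by simp [hX.stat_sum])

theorem le_tvDist (t : ℕ) (x : X.State) (B : Finset X.State) :
    ∑ y ∈ B, X.stat y - ∑ y ∈ B, (X.P ^ t) x y ≤ X.tvDist t := by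
  refine le_trans ?_ (le_ciSup (hX.bddAbove_tv t) x)
  rw [hX.tv_eq, ← Finset.sum_sub_distrib]
  calc ∑ y ∈ B, (X.stat y - (X.P ^ t) x y)
      ≤ ∑ y ∈ B, X.stat y * max (1 - X.density t x y) 0 := Finset.sum_le_sum fun y _ => by
        have := mul_le_mul_of_nonneg_left (le_max_left (1 - X.density t x y) 0) (hX.stat_nonneg y)
        rw [hX.pow_eq]
        linarith
    _ ≤ _ := Finset.sum_le_sum_of_subset_of_nonneg (Finset.subset_univ _) fun y _ _ =>
        mul_nonneg (hX.stat_nonneg y) (le_max_right _ _)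

theorem tvDist_antitone : Antitone X.tvDist := by
  refine antitone_nat_of_succ_le fun t => ?_
  have := hX.nonempty
  refine ciSup_le fun x => ?_
  have h1 : ∀ y, |(X.P ^ (t + 1)) x y - X.stat y| ≤ ∑ w, X.P x w * |(X.P ^ t) w y - X.stat y| :=
    fun y => by
      have : (X.P ^ (t + 1)) x y - X.stat y = ∑ w, X.P x w * ((X.P ^ t) w y - X.stat y) := by
        simp only [pow_succ', Matrix.mul_apply, mul_sub, Finset.sum_sub_distrib, ← Finset.sum_mul,
          hX.sum_P, one_mul]
      rw [this]
      refine (Finset.abs_sum_le_sum_abs _ _).trans (le_of_eq ?_)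
      exact Finset.sum_congr rfl fun w _ => by rw [abs_mul, abs_of_nonneg (hX.P_nonneg x w)]
  calc (1 / 2) * ∑ y, |(X.P ^ (t + 1)) x y - X.stat y|
      ≤ (1 / 2) * ∑ y, ∑ w, X.P x w * |(X.P ^ t) w y - X.stat y| := by
        gcongr with y; exact h1 y
    _ = ∑ w, X.P x w * ((1 / 2) * ∑ y, |(X.P ^ t) w y - X.stat y|) := by
        rw [Finset.sum_comm, Finset.mul_sum]
        refine Finset.sum_congr rfl fun w _ => ?_
        rw [← Finset.mul_sum]; ring
    _ ≤ ∑ w, X.P x w * X.tvDist t := by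
        gcongr with w
        · exact hX.P_nonneg x w
        · exact le_ciSup (hX.bddAbove_tv t) w
    _ = X.tvDist t := by rw [← Finset.sum_mul, hX.sum_P, one_mul]

theorem one_sub_density_le_sepDist (t : ℕ) (x y : X.State) :
    1 - X.density t x y ≤ X.sepDist t := by
  have h1 : (⨅ x, ⨅ y, (X.P ^ t) x y / X.stat y) ≤ ⨅ y, (X.P ^ t) x y / X.stat y :=
    ciInf_le (Set.finite_range _).bddBelow x
  have h2 : (⨅ y, (X.P ^ t) x y / X.stat y) ≤ X.density t x y :=
    ciInf_le (Set.finite_range _).bddBelow y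
  rw [sepDist]
  linarith

theorem sepDist_le {t : ℕ} {c : ℝ} (h : ∀ x y, 1 - X.density t x y ≤ c) : X.sepDist t ≤ c := by
  have := hX.nonempty
  have : 1 - c ≤ ⨅ x, ⨅ y, (X.P ^ t) x y / X.stat y :=
    le_ciInf fun x => le_ciInf fun y => by
      have := h x y
      rw [density] at this
      linarith
  rw [sepDist]
  linarith

theorem sepDist_le_one (t : ℕ) : X.sepDist t ≤ 1 :=
  hX.sepDist_le fun x y => hX.one_sub_density_le_one t x y

theorem sepDist_antitone : Antitone X.sepDist := by
  refine antitone_nat_of_succ_le fun t => hX.sepDist_le fun x y => ?_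
  rw [hX.density_succ, ← hX.step_one_sub, ← hX.step_const (X.sepDist t) x]
  exact Finset.sum_le_sum fun w _ =>
    mul_le_mul_of_nonneg_left (hX.one_sub_density_le_sepDist t w y) (hX.P_nonneg x w)

theorem tvDist_le_sepDist (t : ℕ) : X.tvDist t ≤ X.sepDist t := by
  have h0 : 0 ≤ X.sepDist t := by
    obtain ⟨x⟩ := hX.nonempty
    by_contra! h
    have : ∑ y, X.stat y * 1 < ∑ y, X.stat y * X.density t x y :=
      Finset.sum_lt_sum_of_nonempty ⟨x, Finset.mem_univ x⟩ fun y _ =>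
        mul_lt_mul_of_pos_left (by linarith [hX.one_sub_density_le_sepDist t x y]) (hX.stat_pos y)
    rw [hX.sum_stat_mul_density] at this
    simp [hX.stat_sum] at this
  refine hX.tvDist_le (fun _ _ => X.sepDist t) (fun _ _ => h0)
    (fun x y => hX.one_sub_density_le_sepDist t x y) (fun x => ?_)
  rw [← Finset.sum_mul, hX.stat_sum, one_mul]

/-- A supersolution bounds the defect of the density at a fixed target. -/
theorem one_sub_density_le (y : X.State) (W : ℕ → X.State → ℝ) (A : Set X.State)
    (h0 : ∀ x ∈ A, 1 ≤ W 0 x) (hA : ∀ t x, x ∉ A → 1 - X.density t x y ≤ W t x)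
    (hW : ∀ t, ∀ x ∈ A, X.step (W t) x ≤ W (t + 1) x) (t : ℕ) (x : X.State) :
    1 - X.density t x y ≤ W t x := by
  refine le_of_subsolution hX.P_nonneg (v := fun t x => 1 - X.density t x y) A t (fun x => ?_)
    (fun t _ x hx => hA t x hx) (fun t _ x _ => ?_) (fun t _ x hx => hW t x hx) t le_rfl x
  · by_cases hx : x ∈ A
    · exact (hX.one_sub_density_le_one 0 x y).trans (h0 x hx)
    · exact hA 0 x hx
  · simp only [hX.density_succ]
    rw [← hX.step_one_sub]
    rfl

theorem step_mul_const (F : X.State → ℝ) (c : ℝ) (x : X.State) :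
    X.step (fun y => F y * c) x = X.step F x * c := by
  simp only [step, Finset.sum_mul, mul_assoc]

/-! ### Lyapunov functions with respect to a root. -/

variable {z : X.State} {φ : X.State → ℝ} {l : ℝ}

/-- A Lyapunov function controls the defect of the density at the root. -/
theorem one_sub_density_root_le (hl : 0 ≤ l) (hφ : ∀ x, 1 ≤ φ x)
    (hstep : ∀ x, x ≠ z → X.step φ x ≤ l * φ x) (t : ℕ) (x : X.State) :
    1 - X.density t x z ≤ φ x * l ^ t := by
  refine hX.one_sub_density_le z (fun t x => φ x * l ^ t) {z}ᶜ (fun x _ => by simpa using hφ x)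
    (fun t x hx => ?_) (fun t x hx => ?_) t x
  · have : x = z := by simpa using hx
    subst this
    have h1 := hX.one_le_density_diag t x
    have h2 : 0 ≤ φ x * l ^ t := mul_nonneg (by linarith [hφ x]) (_root_.pow_nonneg hl t)
    linarith
  · rw [hX.step_mul_const, pow_succ, mul_comm (l ^ t) l, ← mul_assoc, mul_comm (φ x)]
    exact mul_le_mul_of_nonneg_right (hstep x hx) (_root_.pow_nonneg hl t)

/-- A Lyapunov function controls the separation of a pair of states. -/
theorem one_sub_density_pair_le (hl : 0 ≤ l) (hφ : ∀ x, 1 ≤ φ x)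
    (hstep : ∀ x, x ≠ z → X.step φ x ≤ l * φ x) (t : ℕ) (x y : X.State) :
    1 - X.density t x y ≤ φ x * (φ y * l ^ t) := by
  have hp : ∀ x t, 0 ≤ φ x * l ^ t := fun x t =>
    mul_nonneg (by linarith [hφ x]) (_root_.pow_nonneg hl t)
  refine hX.one_sub_density_le y (fun t x => φ x * (φ y * l ^ t)) {z}ᶜ (fun x _ => ?_)
    (fun t x hx => ?_) (fun t x hx => ?_) t x
  · have := hφ y
    have := hφ x
    simp only [pow_zero, mul_one]
    nlinarith
  -- At the root the boundary value is the previous bound with its two states exchanged by symmetry;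
  -- this is what turns one hitting time into a sum of two.
  · have : x = z := by simpa using hx
    subst this
    have h1 := hX.one_sub_density_root_le hl hφ hstep t y
    rw [hX.density_symm] at h1
    have := le_mul_of_one_le_left (hp y t) (hφ x)
    linarith
  · rw [hX.step_mul_const, pow_succ]
    calc _ ≤ l * φ x * (φ y * l ^ t) := mul_le_mul_of_nonneg_right (hstep x hx) (hp y t)
      _ = _ := by ring

/-- The stationary mean of a Lyapunov function. -/
theorem sum_stat_mul_le {M : ℝ} (hstep : ∀ x, x ≠ z → X.step φ x ≤ l * φ x)
    (hl : 0 ≤ l) (hφ : ∀ x, 1 ≤ φ x) (hz : X.step φ z ≤ M) :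
    (1 - l) * ∑ x, X.stat x * φ x ≤ M * X.stat z := by
  have h : ∑ x, X.stat x * X.step φ x ≤
      ∑ x, (X.stat x * (l * φ x) + if x = z then M * X.stat z else 0) := by
    refine Finset.sum_le_sum fun x _ => ?_
    by_cases hx : x = z
    · subst hx
      have h1 := mul_le_mul_of_nonneg_left hz (hX.stat_nonneg x)
      have h2 : 0 ≤ X.stat x * (l * φ x) :=
        mul_nonneg (hX.stat_nonneg x) (mul_nonneg hl (by linarith [hφ x]))
      simp only [if_true]
      linarith
    · simpa [hx] using mul_le_mul_of_nonneg_left (hstep x hx) (hX.stat_nonneg x)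
  rw [hX.sum_stat_mul_step, Finset.sum_add_distrib] at h
  have e : ∑ x, X.stat x * (l * φ x) = l * ∑ x, X.stat x * φ x := by
    rw [Finset.mul_sum]; exact Finset.sum_congr rfl fun x _ => by ring
  rw [e] at h
  simp only [Finset.sum_ite_eq', Finset.mem_univ, if_true] at h
  linarith

/-- The return density at the root converges to `1` at a rate given by a Lyapunov function. -/
theorem density_root_le (hl : 0 ≤ l) (hφ : ∀ x, 1 ≤ φ x)
    (hstep : ∀ x, x ≠ z → X.step φ x ≤ l * φ x) (u : ℕ) :
    X.density u z z ≤ 1 + X.density u z z * ((∑ x, X.stat x * φ x) * l ^ u) := by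
  have hh : 0 ≤ X.density u z z := hX.density_nonneg u z z
  have key : ∀ x, X.density u z z - X.density u x z ≤ X.density u z z * (φ x * l ^ u) := by
    intro x
    have hp : ∀ x t, 0 ≤ φ x * l ^ t := fun x t =>
      mul_nonneg (by linarith [hφ x]) (_root_.pow_nonneg hl t)
    refine le_of_subsolution hX.P_nonneg (v := fun t x => X.density u z z - X.density t x z)
      (W := fun t x => X.density u z z * (φ x * l ^ t)) {z}ᶜ u (fun x => ?_) (fun t ht x hx => ?_)
      (fun t _ x _ => ?_) (fun t _ x hx => ?_) u le_rfl x
    · have h1 := hX.density_nonneg 0 x z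
      have h2 := le_mul_of_one_le_right hh (hφ x)
      simp only [pow_zero, mul_one]
      linarith
    -- For t ≤ u the return density is still at least its value at time u, so the function compared
    -- is nonpositive at the root. The resulting bound at time u is then averaged over x under π.
    · have : x = z := by simpa using hx
      subst this
      have := hX.density_diag_antitone x ht
      have h2 := mul_nonneg hh (hp x t)
      simp only at this ⊢
      linarith
    · simp only [hX.density_succ, step, mul_sub, Finset.sum_sub_distrib, ← Finset.sum_mul,
        hX.sum_P, one_mul]
      exact le_rfl
    · have h1 : ∑ y, X.P x y * (X.density u z z * (φ y * l ^ t)) =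
          X.density u z z * l ^ t * X.step φ x := by
        rw [step, Finset.mul_sum]
        exact Finset.sum_congr rfl fun y _ => by ring
      rw [h1, pow_succ]
      calc _ ≤ X.density u z z * l ^ t * (l * φ x) :=
            mul_le_mul_of_nonneg_left (hstep x hx) (mul_nonneg hh (_root_.pow_nonneg hl t))
        _ = _ := by ring
  have h := Finset.sum_le_sum fun x (_ : x ∈ Finset.univ) =>
    mul_le_mul_of_nonneg_left (key x) (hX.stat_nonneg x)
  have e1 : ∑ x, X.stat x * (X.density u z z - X.density u x z) = X.density u z z - 1 := by
    simp only [mul_sub, Finset.sum_sub_distrib, ← Finset.sum_mul, hX.stat_sum, one_mul,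
      hX.density_symm u _ z, hX.sum_stat_mul_density]
  have e2 : ∑ x, X.stat x * (X.density u z z * (φ x * l ^ u)) =
      X.density u z z * ((∑ x, X.stat x * φ x) * l ^ u) := by
    rw [Finset.sum_mul, Finset.mul_sum]
    exact Finset.sum_congr rfl fun y _ => by ring
  rw [e1, e2] at h
  linarith

end IsLazyReversible

end FiniteChain

/-! ### From distance profiles at times sn to first times, cutoff and pre-cutoff ratios. -/

section FirstTimes

variable {D : ℕ → ℕ → ℝ}

/-- The witness t' is needed because the infimum of the empty set of naturals is 0. -/
theorem lt_sInf_of_antitone {f : ℕ → ℝ} (hf : Antitone f) {ε : ℝ} {t t' : ℕ} (h : ε < f t)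
    (h' : f t' ≤ ε) : t < sInf {t : ℕ | f t ≤ ε} := by
  by_contra! hle
  have hmem : sInf {t : ℕ | f t ≤ ε} ∈ {t : ℕ | f t ≤ ε} := Nat.sInf_mem ⟨t', h'⟩
  have : f t ≤ f (sInf {t : ℕ | f t ≤ ε}) := hf hle
  exact absurd (this.trans hmem) (not_le.2 h)

theorem eventually_lt_sInf (hD : ∀ᶠ n in atTop, Antitone (D n)) {ε s s' : ℝ}
    (h : ∀ᶠ n : ℕ in atTop, ε < D n ⌊s * n⌋₊) (h' : ∀ᶠ n : ℕ in atTop, D n ⌊s' * n⌋₊ ≤ ε) :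
    ∀ᶠ n : ℕ in atTop, s * n < (sInf {t : ℕ | D n t ≤ ε} : ℕ) := by
  filter_upwards [hD, h, h'] with n h1 h2 h3
  exact Nat.lt_of_floor_lt (lt_sInf_of_antitone h1 h2 h3)

theorem eventually_sInf_le {ε s : ℝ} (hs : 0 ≤ s) (h : ∀ᶠ n : ℕ in atTop, D n ⌊s * n⌋₊ ≤ ε) :
    ∀ᶠ n : ℕ in atTop, ((sInf {t : ℕ | D n t ≤ ε} : ℕ) : ℝ) ≤ s * n := by
  filter_upwards [h] with n h1
  have h2 : sInf {t : ℕ | D n t ≤ ε} ≤ ⌊s * n⌋₊ := Nat.sInf_le h1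
  exact (Nat.cast_le.2 h2).trans (Nat.floor_le (by positivity))

theorem natCast_div_natCast_ennreal (a : ℕ) {b : ℕ} (hb : 0 < b) :
    (a : ℝ≥0∞) / (b : ℝ≥0∞) = ENNReal.ofReal ((a : ℝ) / b) := by
  rw [ENNReal.ofReal_div_of_pos (by exact_mod_cast hb), ENNReal.ofReal_natCast,
    ENNReal.ofReal_natCast]

theorem cutoffOf_of_tendsto {c : ℝ} (hc : 0 < c) (hD : ∀ᶠ n in atTop, Antitone (D n))
    (h1 : ∀ s : ℝ, 0 ≤ s → s < c → Tendsto (fun n : ℕ => D n ⌊s * n⌋₊) atTop (𝓝 1))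
    (h0 : ∀ s : ℝ, c < s → Tendsto (fun n : ℕ => D n ⌊s * n⌋₊) atTop (𝓝 0)) :
    CutoffOf fun n ε => sInf {t : ℕ | D n t ≤ ε} := by
  have key : ∀ ε : ℝ, 0 < ε → ε < 1 →
      Tendsto (fun n : ℕ => ((sInf {t : ℕ | D n t ≤ ε} : ℕ) : ℝ) / n) atTop (𝓝 c) := by
    intro ε hε0 hε1
    have up : ∀ s : ℝ, c < s → ∀ᶠ n : ℕ in atTop, D n ⌊s * n⌋₊ ≤ ε := fun s hs =>
      (h0 s hs).eventually (eventually_le_nhds hε0)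
    refine tendsto_order.2 ⟨fun a ha => ?_, fun a ha => ?_⟩
    · have hm : max a 0 < c := max_lt ha hc
      filter_upwards [eventually_lt_sInf hD ((h1 _ (le_max_right a 0) hm).eventually
        (eventually_gt_nhds hε1)) (up (c + 1) (by linarith)), eventually_gt_atTop 0] with n hn hn0
      have hn0' : (0 : ℝ) < n := by exact_mod_cast hn0
      exact (le_max_left a 0).trans_lt ((lt_div_iff₀ hn0').2 hn)
    · filter_upwards [eventually_sInf_le (by linarith) (up ((c + a) / 2) (by linarith)),
        eventually_gt_atTop 0] with n hn hn0
      have hn0' : (0 : ℝ) < n := by exact_mod_cast hn0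
      exact ((div_le_iff₀ hn0').2 hn).trans_lt (by linarith)
  intro ε hε0 hε
  have t1 := key ε hε0 (by linarith)
  have t2 := key (1 - ε) (by linarith) (by linarith)
  have t3 := ENNReal.tendsto_ofReal (t1.div t2 hc.ne')
  rw [div_self hc.ne', ENNReal.ofReal_one] at t3
  refine t3.congr' ?_
  filter_upwards [eventually_gt_atTop 0, t2.eventually (eventually_gt_nhds hc)] with n hn hT
  have hn' : (0 : ℝ) < n := by exact_mod_cast hn
  have hT' : 0 < sInf {t : ℕ | D n t ≤ 1 - ε} := by
    rcases Nat.eq_zero_or_pos (sInf {t : ℕ | D n t ≤ 1 - ε}) with h | h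
    · rw [h] at hT; simp at hT
    · exact h
  rw [natCast_div_natCast_ennreal _ hT']
  congr 1
  simp only [Pi.div_apply]
  field_simp

theorem precutoffRatioOf_eq_one {T : ℕ → ℝ → ℕ} (h : CutoffOf T) : precutoffRatioOf T = 1 := by
  have : ∀ ε ∈ Set.Ioo (0 : ℝ) (1 / 2),
      limsup (fun n => (T n ε : ℝ≥0∞) / (T n (1 - ε) : ℝ≥0∞)) atTop = 1 := fun ε hε =>
    (h ε hε.1 hε.2.le).limsup_eq
  rw [precutoffRatioOf, biSup_congr this]
  exact biSup_const (Set.nonempty_Ioo.2 (by norm_num))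

/-- Allows the first terms of a sequence, where the network is degenerate, to be dropped. -/
theorem precutoffRatioOf_shift (T : ℕ → ℝ → ℕ) (k : ℕ) :
    precutoffRatioOf (fun n => T (n + k)) = precutoffRatioOf T := by
  simp only [precutoffRatioOf]
  refine biSup_congr fun ε _ => ?_
  exact limsup_nat_add (fun n => (T n ε : ℝ≥0∞) / (T n (1 - ε) : ℝ≥0∞)) k

/-- A profile which is close to `1` before `c`, close to `0` after `2 * c`, and strictly between
in the meantime, has pre-cutoff with ratio `2` and no cutoff. -/
theorem precutoffRatioOf_eq_two {c : ℝ} (hc : 0 < c) (hD : ∀ᶠ n in atTop, Antitone (D n))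
    (h1 : ∀ s : ℝ, 0 ≤ s → s < c → Tendsto (fun n : ℕ => D n ⌊s * n⌋₊) atTop (𝓝 1))
    (h0 : ∀ s : ℝ, 2 * c < s → Tendsto (fun n : ℕ => D n ⌊s * n⌋₊) atTop (𝓝 0))
    (hpos : ∀ s : ℝ, c < s → s < 2 * c → ∃ a : ℝ, 0 < a ∧ ∀ᶠ n : ℕ in atTop, a < D n ⌊s * n⌋₊)
    (hlt : ∀ s : ℝ, c < s → s < 2 * c → ∃ b : ℝ, b < 1 ∧ ∀ᶠ n : ℕ in atTop, D n ⌊s * n⌋₊ ≤ b) :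
    precutoffRatioOf (fun n ε => sInf {t : ℕ | D n t ≤ ε}) = 2 ∧
      ¬ CutoffOf fun n ε => sInf {t : ℕ | D n t ≤ ε} := by
  have zero_ev : ∀ ε : ℝ, 0 < ε → ∀ s : ℝ, 2 * c < s → ∀ᶠ n : ℕ in atTop, D n ⌊s * n⌋₊ ≤ ε :=
    fun ε hε s hs => (h0 s hs).eventually (eventually_le_nhds hε)
  have one_ev : ∀ ε : ℝ, ε < 1 → ∀ s : ℝ, 0 ≤ s → s < c → ∀ᶠ n : ℕ in atTop, ε < D n ⌊s * n⌋₊ :=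
    fun ε hε s hs hs' => (h1 s hs hs').eventually (eventually_gt_nhds hε)
  -- upper bound on the ratio
  have upper : ∀ ε : ℝ, 0 < ε → ε < 1 / 2 → ∀ s s' : ℝ, 2 * c < s → 0 < s' → s' < c →
      ∀ᶠ n : ℕ in atTop, ((sInf {t : ℕ | D n t ≤ ε} : ℕ) : ℝ≥0∞) /
        ((sInf {t : ℕ | D n t ≤ 1 - ε} : ℕ) : ℝ≥0∞) ≤ ENNReal.ofReal (s / s') := by
    intro ε hε hε' s s' hs hs0 hs'
    filter_upwards [eventually_sInf_le (by linarith) (zero_ev ε hε s hs),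
      eventually_lt_sInf hD (one_ev (1 - ε) (by linarith) s' hs0.le hs')
        (zero_ev (1 - ε) (by linarith) s hs), eventually_gt_atTop 0] with n hn hn' hn0
    have hn0' : (0 : ℝ) < n := by exact_mod_cast hn0
    have hp : (0 : ℝ) < s' * n := by positivity
    have hT : 0 < sInf {t : ℕ | D n t ≤ 1 - ε} := by exact_mod_cast hp.trans hn'
    rw [natCast_div_natCast_ennreal _ hT]
    refine ENNReal.ofReal_le_ofReal ?_
    calc _ ≤ (s * n) / (s' * n) := by
          apply div_le_div₀ (by nlinarith) hn hp hn'.le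
      _ = s / s' := by field_simp
  have lower : ∀ s s' : ℝ, c < s → s < 2 * c → c < s' → s' < 2 * c → ∃ ε ∈ Set.Ioo (0 : ℝ) (1 / 2),
      ∀ᶠ n : ℕ in atTop, ENNReal.ofReal (s / s') ≤ ((sInf {t : ℕ | D n t ≤ ε} : ℕ) : ℝ≥0∞) /
        ((sInf {t : ℕ | D n t ≤ 1 - ε} : ℕ) : ℝ≥0∞) := by
    intro s s' hs hs2 hs' hs2'
    obtain ⟨a, ha, hae⟩ := hpos s hs hs2
    obtain ⟨b, hb, hbe⟩ := hlt s' hs' hs2'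
    -- One ε serves both ends: the profile is above ε at speed s and at most 1 - ε at speed s'.
    obtain ⟨ε, hε0, hεa, hεb, hε4⟩ : ∃ ε : ℝ, 0 < ε ∧ ε ≤ a ∧ ε ≤ 1 - b ∧ ε ≤ 1 / 4 :=
      ⟨min a (min (1 - b) (1 / 4)), lt_min ha (lt_min (by linarith) (by norm_num)),
        min_le_left _ _, (min_le_right _ _).trans (min_le_left _ _),
        (min_le_right _ _).trans (min_le_right _ _)⟩
    refine ⟨ε, ⟨hε0, by linarith⟩, ?_⟩
    have e1 : ∀ᶠ n : ℕ in atTop, ε < D n ⌊s * n⌋₊ := hae.mono fun n hn => hεa.trans_lt hn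
    have e2 : ∀ᶠ n : ℕ in atTop, D n ⌊s' * n⌋₊ ≤ 1 - ε := hbe.mono fun n hn => by linarith
    -- The bound at speed c/2 only ensures that the denominator is not zero.
    filter_upwards [eventually_lt_sInf hD e1 (zero_ev ε hε0 (2 * c + 1) (by linarith)),
      eventually_sInf_le (by linarith) e2,
      eventually_lt_sInf hD (one_ev (1 - ε) (by linarith) (c / 2) (by linarith) (by linarith)) e2,
      eventually_gt_atTop 0] with n hn hn' hn'' hn0
    have hn0' : (0 : ℝ) < n := by exact_mod_cast hn0
    have hp : (0 : ℝ) < c / 2 * n := by positivity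
    have hTr := hp.trans hn''
    have hT : 0 < sInf {t : ℕ | D n t ≤ 1 - ε} := by exact_mod_cast hTr
    rw [natCast_div_natCast_ennreal _ hT]
    refine ENNReal.ofReal_le_ofReal ?_
    calc s / s' = (s * n) / (s' * n) := by
          have : s' ≠ 0 := by linarith
          field_simp
      _ ≤ _ := div_le_div₀ (by positivity) hn.le hTr hn'
  -- With σ = 1 the speeds lie just outside [c, 2c] and bound the ratio from above; with σ = -1 they
  -- lie just inside and bound it from below. The shift by 3 keeps the perturbation below 1/2.
  have hu : ∀ σ : ℝ,
      Tendsto (fun k : ℕ => ENNReal.ofReal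
        ((2 * c * (1 + σ / ((k : ℝ) + 3))) / (c * (1 - σ / ((k : ℝ) + 3))))) atTop (𝓝 2) := by
    intro σ
    have h3 : Tendsto (fun k : ℕ => σ / ((k : ℝ) + 3)) atTop (𝓝 0) :=
      tendsto_const_nhds.div_atTop
        (tendsto_atTop_add_const_right _ _ tendsto_natCast_atTop_atTop)
    have h4 : Tendsto (fun k : ℕ => (2 * c * (1 + σ / ((k : ℝ) + 3))) /
        (c * (1 - σ / ((k : ℝ) + 3)))) atTop (𝓝 ((2 * c * (1 + 0)) / (c * (1 - 0)))) :=
      ((h3.const_add 1).const_mul _).div ((h3.const_sub 1).const_mul _) (by simpa using hc.ne')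
    have e : (2 * c * (1 + 0)) / (c * (1 - 0)) = 2 := by field_simp; norm_num
    rw [e] at h4
    simpa using ENNReal.tendsto_ofReal h4
  have hfrac : ∀ k : ℕ, 0 < (1 : ℝ) / ((k : ℝ) + 3) ∧ (1 : ℝ) / ((k : ℝ) + 3) < 1 / 2 := fun k => by
    constructor
    · positivity
    · apply one_div_lt_one_div_of_lt (by norm_num)
      have : (0 : ℝ) ≤ k := by positivity
      linarith
  refine ⟨le_antisymm ?_ ?_, fun hcut => ?_⟩
  · refine iSup₂_le fun ε hε => ?_
    refine ge_of_tendsto' (hu 1) fun k => ?_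
    have := hfrac k
    exact limsup_le_of_le (by isBoundedDefault)
      (upper ε hε.1 hε.2 _ _ (by nlinarith) (by nlinarith) (by nlinarith))
  · refine le_of_tendsto' (hu (-1)) fun k => ?_
    have := hfrac k
    have e : (-1 : ℝ) / ((k : ℝ) + 3) = -(1 / ((k : ℝ) + 3)) := by ring
    rw [e]
    obtain ⟨ε, hε, hev⟩ := lower (2 * c * (1 + -(1 / ((k : ℝ) + 3))))
      (c * (1 - -(1 / ((k : ℝ) + 3)))) (by nlinarith) (by nlinarith) (by nlinarith) (by nlinarith)
    refine le_trans ?_ (le_iSup₂ (f := fun ε (_ : ε ∈ Set.Ioo (0 : ℝ) (1 / 2)) =>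
      limsup (fun n => ((sInf {t : ℕ | D n t ≤ ε} : ℕ) : ℝ≥0∞) /
        ((sInf {t : ℕ | D n t ≤ 1 - ε} : ℕ) : ℝ≥0∞)) atTop) ε hε)
    exact (le_liminf_of_le (by isBoundedDefault) hev).trans liminf_le_limsup
  · obtain ⟨ε, hε, hev⟩ := lower (7 / 4 * c) (5 / 4 * c) (by linarith) (by linarith) (by linarith)
      (by linarith)
    have h := ge_of_tendsto (hcut ε hε.1 hε.2.le) hev
    have h5 : (7 / 4 * c) / (5 / 4 * c) = 7 / 5 := by field_simp
    rw [h5, ← ENNReal.ofReal_one, ENNReal.ofReal_le_ofReal_iff zero_le_one] at h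
    norm_num at h

theorem tendsto_sInf_atTop {c : ℝ} (hc : 0 < c) (hD : ∀ᶠ n in atTop, Antitone (D n))
    (h1 : ∀ s : ℝ, 0 ≤ s → s < c → Tendsto (fun n : ℕ => D n ⌊s * n⌋₊) atTop (𝓝 1)) {s : ℝ}
    (h0 : Tendsto (fun n : ℕ => D n ⌊s * n⌋₊) atTop (𝓝 0)) {ε : ℝ} (hε0 : 0 < ε) (hε : ε < 1) :
    Tendsto (fun n => sInf {t : ℕ | D n t ≤ ε}) atTop atTop := by
  have h := eventually_lt_sInf hD ((h1 (c / 2) (by linarith) (by linarith)).eventually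
    (eventually_gt_nhds hε)) (h0.eventually (eventually_le_nhds hε0))
  have ht : Tendsto (fun n : ℕ => ((sInf {t : ℕ | D n t ≤ ε} : ℕ) : ℝ)) atTop atTop :=
    tendsto_atTop_mono' _ (h.mono fun n hn => hn.le)
      (tendsto_natCast_atTop_atTop.const_mul_atTop (by linarith))
  exact tendsto_natCast_atTop_iff.1 ht

end FirstTimes

/-! ### Exponential rates on either side of the critical speed. -/

section Rates

theorem tendsto_pow_mul_pow_floor_of_le_one {a b s : ℝ} (ha : 0 ≤ a) (hb : 0 < b) (hb1 : b ≤ 1)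
    (h : a * b ^ s < 1) :
    Tendsto (fun n : ℕ => a ^ n * b ^ ⌊s * n⌋₊) atTop (𝓝 0) := by
  have hlim := (tendsto_pow_atTop_nhds_zero_of_lt_one
    (mul_nonneg ha (Real.rpow_nonneg hb.le s)) h).mul_const b⁻¹
  rw [zero_mul] at hlim
  refine squeeze_zero (fun n => by positivity) (fun n => ?_) hlim
  have h1 : b ^ ⌊s * n⌋₊ ≤ (b ^ s) ^ n * b⁻¹ := by
    rw [← Real.rpow_natCast (b ^ s) n, ← Real.rpow_mul hb.le, ← Real.rpow_natCast b,
      ← Real.rpow_neg_one b, ← Real.rpow_add hb]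
    exact Real.rpow_le_rpow_of_exponent_ge hb hb1 (by linarith [Nat.lt_floor_add_one (s * n)])
  calc a ^ n * b ^ ⌊s * n⌋₊ ≤ a ^ n * ((b ^ s) ^ n * b⁻¹) :=
        mul_le_mul_of_nonneg_left h1 (by positivity)
    _ = _ := by rw [mul_pow]; ring

theorem tendsto_pow_mul_pow_floor_of_one_le {a b s : ℝ} (ha : 0 ≤ a) (hb1 : 1 ≤ b)
    (hs : 0 ≤ s) (h : a * b ^ s < 1) :
    Tendsto (fun n : ℕ => a ^ n * b ^ ⌊s * n⌋₊) atTop (𝓝 0) := by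
  have hb : 0 < b := by linarith
  have hlim := tendsto_pow_atTop_nhds_zero_of_lt_one
    (mul_nonneg ha (Real.rpow_nonneg hb.le s)) h
  refine squeeze_zero (fun n => by positivity) (fun n => ?_) hlim
  have h1 : b ^ ⌊s * n⌋₊ ≤ (b ^ s) ^ n := by
    rw [← Real.rpow_natCast (b ^ s) n, ← Real.rpow_mul hb.le, ← Real.rpow_natCast b]
    exact Real.rpow_le_rpow_of_exponent_le hb1 (Nat.floor_le (by positivity))
  calc a ^ n * b ^ ⌊s * n⌋₊ ≤ a ^ n * (b ^ s) ^ n :=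
        mul_le_mul_of_nonneg_left h1 (by positivity)
    _ = _ := by rw [mul_pow]

/-- The upper-tail rate beats the growth of the Lyapunov function above the critical speed. -/
theorem exists_upper_rate {c s : ℝ} (hc : 2 ≤ c) (hs : c < s) :
    ∃ x : ℝ, 0 < x ∧ x ≤ 1 / 4 ∧ 0 < 1 - x * (1 - 2 * x) / c ∧ 1 - x * (1 - 2 * x) / c < 1 ∧
      Tendsto (fun n : ℕ => (1 + x) ^ n * (1 - x * (1 - 2 * x) / c) ^ ⌊s * n⌋₊) atTop (𝓝 0) := by
  -- Bounding 1 + y by exp y reduces the claim to x - s x(1-2x)/c < 0, which is this condition; it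
  -- holds for small x since c < s.
  obtain ⟨x, hx0, hx4, hx⟩ : ∃ x : ℝ, 0 < x ∧ x ≤ 1 / 4 ∧ c < s * (1 - 2 * x) := by
    have hs0 : 0 < s := by linarith
    refine ⟨min (1 / 4) ((s - c) / (4 * s)), lt_min (by norm_num)
      (div_pos (by linarith) (by linarith)), min_le_left _ _, ?_⟩
    have h := min_le_right (1 / 4) ((s - c) / (4 * s))
    have h' : s * ((s - c) / (4 * s)) = (s - c) / 4 := by field_simp
    nlinarith [mul_le_mul_of_nonneg_left h hs0.le]
  have hcp : 0 < c := by linarith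
  have e1 : 0 < x * (1 - 2 * x) / c := div_pos (mul_pos hx0 (by linarith)) hcp
  have e2 : x * (1 - 2 * x) / c < 1 := by
    rw [div_lt_one hcp]
    nlinarith
  refine ⟨x, hx0, hx4, by linarith, by linarith, ?_⟩
  refine tendsto_pow_mul_pow_floor_of_le_one (by linarith) (by linarith) (by linarith) ?_
  have h1 : 1 + x ≤ Real.exp x := by linarith [Real.add_one_le_exp x]
  have h2 : (1 - x * (1 - 2 * x) / c) ^ s ≤ Real.exp (-(x * (1 - 2 * x) / c) * s) := by
    rw [Real.exp_mul]
    exact Real.rpow_le_rpow (by linarith)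
      (by linarith [Real.add_one_le_exp (-(x * (1 - 2 * x) / c))]) (by linarith)
  calc (1 + x) * (1 - x * (1 - 2 * x) / c) ^ s
      ≤ Real.exp x * Real.exp (-(x * (1 - 2 * x) / c) * s) :=
        mul_le_mul h1 h2 (Real.rpow_nonneg (by linarith) _) (Real.exp_pos _).le
    _ = Real.exp (x / c * (c - s * (1 - 2 * x))) := by
        rw [← Real.exp_add]; congr 1; field_simp; ring
    _ < 1 := by
        rw [Real.exp_lt_one_iff]
        exact mul_neg_of_pos_of_neg (div_pos hx0 hcp) (by linarith)

/-- The lower-tail rate is beaten by the decay of the profile below the critical speed. -/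
theorem exists_lower_rate {c s : ℝ} (hc : 2 ≤ c) (hs0 : 0 ≤ s) (hs : s < c) :
    ∃ x : ℝ, 0 < x ∧ x ≤ 1 / 4 ∧
      Tendsto (fun n : ℕ => ((1 + x)⁻¹) ^ n * (1 + x * (1 + x) / c) ^ ⌊s * n⌋₊) atTop (𝓝 0) := by
  have hcp : 0 < c := by linarith
  -- Here the exponent to be made negative is -x/(1+x) + s x(1+x)/c.
  obtain ⟨x, hx0, hx4, hx⟩ : ∃ x : ℝ, 0 < x ∧ x ≤ 1 / 4 ∧ s * (1 + x) ^ 2 < c := by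
    refine ⟨min (1 / 4) ((c - s) / (4 * c)), lt_min (by norm_num)
      (div_pos (by linarith) (by linarith)), min_le_left _ _, ?_⟩
    have h := min_le_right (1 / 4) ((c - s) / (4 * c))
    have h4 := min_le_left (1 / 4) ((c - s) / (4 * c))
    have h0 : 0 < min (1 / 4) ((c - s) / (4 * c)) :=
      lt_min (by norm_num) (div_pos (by linarith) (by linarith))
    set y := min (1 / 4) ((c - s) / (4 * c))
    have h' : c * ((c - s) / (4 * c)) = (c - s) / 4 := by field_simp
    have h6 := mul_le_mul_of_nonneg_left h hcp.le
    rw [h'] at h6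
    have h5 : (1 + y) ^ 2 ≤ 1 + 3 * y := by nlinarith
    have h7 : s * y ≤ c * y := mul_le_mul_of_nonneg_right hs.le h0.le
    nlinarith [mul_le_mul_of_nonneg_left h5 hs0]
  have hm : 0 < x * (1 + x) / c := div_pos (mul_pos hx0 (by linarith)) hcp
  refine ⟨x, hx0, hx4, tendsto_pow_mul_pow_floor_of_one_le (by positivity) (by linarith) hs0 ?_⟩
  have h1 : (1 + x)⁻¹ ≤ Real.exp (-(x / (1 + x))) := by
    have := Real.add_one_le_exp (-(x / (1 + x)))
    have e : -(x / (1 + x)) + 1 = (1 + x)⁻¹ := by field_simp; ring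
    rwa [e] at this
  have h2 : (1 + x * (1 + x) / c) ^ s ≤ Real.exp (x * (1 + x) / c * s) := by
    rw [Real.exp_mul]
    exact Real.rpow_le_rpow (by linarith) (by linarith [Real.add_one_le_exp (x * (1 + x) / c)]) hs0
  calc (1 + x)⁻¹ * (1 + x * (1 + x) / c) ^ s
      ≤ Real.exp (-(x / (1 + x))) * Real.exp (x * (1 + x) / c * s) :=
        mul_le_mul h1 h2 (Real.rpow_nonneg (by linarith) _) (Real.exp_pos _).le
    _ = Real.exp (x / (c * (1 + x)) * (s * (1 + x) ^ 2 - c)) := by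
        rw [← Real.exp_add]; congr 1; field_simp; ring
    _ < 1 := by
        rw [Real.exp_lt_one_iff]
        exact mul_neg_of_pos_of_neg (div_pos hx0 (by positivity)) (by linarith)

end Rates

/-! ### Lazy random walks on networks. -/

namespace FiniteChain

/-- The transition matrix of the `1/2`-lazy random walk on a network with conductances `w`. -/
noncomputable def lazyWalk {V : Type} [Fintype V] [DecidableEq V] (w : V → V → ℝ) :
    Matrix V V ℝ :=
  fun x y => if x = y then 1 / 2 else w x y / (2 * ∑ y, w x y)

/-- The `1/2`-lazy random walk on a network with conductances `w`. -/
noncomputable def network (V : Type) [Fintype V] [DecidableEq V] (w : V → V → ℝ) : FiniteChain where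
  State := V
  instFintype := inferInstance
  instDecidableEq := inferInstance
  P := lazyWalk w
  stat := fun x => (∑ y, w x y) / ∑ x, ∑ y, w x y

section Network

variable {V : Type} [Fintype V] [DecidableEq V] {w : V → V → ℝ}

theorem network_step (hdiag : ∀ x, w x x = 0) (F : V → ℝ) (x : V) :
    (network V w).step F x = 1 / 2 * F x + (∑ y, w x y * F y) / (2 * ∑ y, w x y) := by
  have h : ∀ y, (if x = y then 1 / 2 else w x y / (2 * ∑ y, w x y)) * F y =
      (if x = y then 1 / 2 * F y else 0) + w x y * F y / (2 * ∑ y, w x y) := fun y => by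
    by_cases h : x = y
    · subst h; simp [hdiag]
    · simp [h]; ring
  calc (network V w).step F x
      = ∑ y, (if x = y then 1 / 2 else w x y / (2 * ∑ y, w x y)) * F y := rfl
    _ = _ := by
      simp only [h, Finset.sum_add_distrib, ← Finset.sum_div]
      simp

/-- Connectivity is certified by a height r that can be lowered along an edge from every state other
than z: induction on it joins each state to z in both directions, and paths are composed through z.
-/
theorem network_isLazyReversible (hsymm : ∀ x y, w x y = w y x) (hnonneg : ∀ x y, 0 ≤ w x y)
    (hdiag : ∀ x, w x x = 0) (z : V) (hz : ∃ y, 0 < w z y) (r : V → ℕ)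
    (hr : ∀ x, x ≠ z → ∃ y, r y < r x ∧ 0 < w x y) : (network V w).IsLazyReversible := by
  have tot_pos : ∀ x, 0 < ∑ y, w x y := fun x => by
    obtain ⟨y, hy⟩ : ∃ y, 0 < w x y := by
      by_cases h : x = z
      · exact h ▸ hz
      · obtain ⟨y, -, hy⟩ := hr x h
        exact ⟨y, hy⟩
    exact Finset.sum_pos' (fun y _ => hnonneg x y) ⟨y, Finset.mem_univ y, hy⟩
  have all_pos : 0 < ∑ x, ∑ y, w x y :=
    Finset.sum_pos (fun x _ => tot_pos x) ⟨z, Finset.mem_univ z⟩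
  have P_eq : ∀ x y, lazyWalk w x y = if x = y then 1 / 2 else w x y / (2 * ∑ y, w x y) :=
    fun x y => rfl
  have P_nonneg : ∀ x y, 0 ≤ lazyWalk w x y := fun x y => by
    rw [P_eq]
    split_ifs
    · norm_num
    · exact div_nonneg (hnonneg x y) (by linarith [tot_pos x])
  have P_sum : ∀ x, ∑ y, lazyWalk w x y = 1 := fun x => by
    have h := network_step hdiag (fun _ => 1) x
    simp only [step, mul_one] at h
    change ∑ y, lazyWalk w x y = _ at h
    refine h.trans ?_
    have := (tot_pos x).ne'
    field_simp
    norm_num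
  have stoch : lazyWalk w ∈ Matrix.rowStochastic ℝ V :=
    Matrix.mem_rowStochastic_iff_sum.2 ⟨P_nonneg, P_sum⟩
  have balance : ∀ x y, ((∑ y, w x y) / ∑ x, ∑ y, w x y) * lazyWalk w x y =
      ((∑ x, w y x) / ∑ x, ∑ y, w x y) * lazyWalk w y x := fun x y => by
    by_cases h : x = y
    · subst h; rfl
    · have hx := (tot_pos x).ne'
      have hy := (tot_pos y).ne'
      have ha := all_pos.ne'
      rw [P_eq, P_eq, if_neg h, if_neg (Ne.symm h), hsymm y x]
      field_simp
  have pow_nonneg : ∀ (t : ℕ) (x y : V), 0 ≤ (lazyWalk w ^ t) x y := fun t x y =>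
    Matrix.nonneg_of_mem_rowStochastic (pow_mem stoch t)
  have lazy : ∀ x, lazyWalk w x x = 1 / 2 := fun x => by rw [P_eq, if_pos rfl]
  have mul_pos_pow : ∀ (s t : ℕ) (x y u : V), 0 < (lazyWalk w ^ s) x y →
      0 < (lazyWalk w ^ t) y u → 0 < (lazyWalk w ^ (s + t)) x u := by
    intro s t x y u h1 h2
    rw [pow_add, Matrix.mul_apply]
    exact Finset.sum_pos' (fun i _ => mul_nonneg (pow_nonneg s x i) (pow_nonneg t i u))
      ⟨y, Finset.mem_univ y, mul_pos h1 h2⟩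
  have edge : ∀ x y : V, 0 < w x y → 0 < (lazyWalk w ^ 1) x y ∧
      0 < (lazyWalk w ^ 1) y x := fun x y h => by
    rw [pow_one, P_eq, P_eq]
    constructor
    · split_ifs
      · norm_num
      · exact div_pos h (by linarith [tot_pos x])
    · split_ifs
      · norm_num
      · exact div_pos (hsymm x y ▸ h) (by linarith [tot_pos y])
  have root : ∀ k : ℕ, ∀ x : V, r x ≤ k → (∃ t > 0, 0 < (lazyWalk w ^ t) x z) ∧
      (∃ t > 0, 0 < (lazyWalk w ^ t) z x) := by
    intro k
    induction k with
    | zero =>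
      intro x hx
      have : x = z := by
        by_contra h
        obtain ⟨y, hy, -⟩ := hr x h
        omega
      subst this
      have : 0 < (lazyWalk w ^ 1) x x := by rw [pow_one, lazy]; norm_num
      exact ⟨⟨1, one_pos, this⟩, ⟨1, one_pos, this⟩⟩
    | succ k ih =>
      intro x hx
      by_cases h : x = z
      · subst h
        have : 0 < (lazyWalk w ^ 1) x x := by rw [pow_one, lazy]; norm_num
        exact ⟨⟨1, one_pos, this⟩, ⟨1, one_pos, this⟩⟩
      · obtain ⟨y, hy, hw⟩ := hr x h
        obtain ⟨⟨t, ht, h1⟩, ⟨t', ht', h2⟩⟩ := ih y (by omega)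
        exact ⟨⟨1 + t, by omega, mul_pos_pow 1 t x y z (edge x y hw).1 h1⟩,
          ⟨t' + 1, by omega, mul_pos_pow t' 1 z y x h2 (edge x y hw).2⟩⟩
  exact
    { stochastic := stoch
      irreducible := (Matrix.isIrreducible_iff_exists_pow_pos P_nonneg).2 fun x y => by
        obtain ⟨⟨t, ht, h1⟩, -⟩ := root _ x le_rfl
        obtain ⟨-, ⟨t', ht', h2⟩⟩ := root _ y le_rfl
        exact ⟨t + t', by omega, mul_pos_pow t t' x z y h1 h2⟩
      lazy := fun x => (lazy x).ge
      stat_nonneg := fun x => div_nonneg (tot_pos x).le all_pos.le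
      stat_sum := by
        have : ∑ x, (∑ y, w x y) / ∑ x, ∑ y, w x y = 1 := by
          rw [← Finset.sum_div, div_self all_pos.ne']
        exact this
      detailed_balance := balance }

end Network

/-- Lower bound for the probability of following a path towards `y`. -/
theorem IsLazyReversible.pow_le_pow_apply {X : FiniteChain} (hX : X.IsLazyReversible) {c : ℝ}
    (hc : 0 ≤ c) (hc2 : c ≤ 1 / 2) (y : X.State) (A : Set X.State) (d : X.State → ℕ)
    (hd0 : ∀ x ∈ A, d x = 0 → x = y)
    (hstep : ∀ x ∈ A, d x ≠ 0 → ∃ x' ∈ A, d x' < d x ∧ c ≤ X.P x x') (t : ℕ) :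
    ∀ x ∈ A, d x ≤ t → c ^ t ≤ (X.P ^ t) x y := by
  induction t with
  | zero =>
    intro x hx h
    rw [hd0 x hx (by omega)]
    simp
  | succ t ih =>
    intro x hx h
    obtain ⟨x', hx', hd, hP⟩ : ∃ x' ∈ A, d x' ≤ t ∧ c ≤ X.P x x' := by
      by_cases h0 : d x = 0
      · exact ⟨x, hx, by omega, hc2.trans (hX.lazy x)⟩
      · obtain ⟨x', h1, h2, h3⟩ := hstep x hx h0
        exact ⟨x', h1, by omega, h3⟩
    rw [pow_succ', pow_succ', Matrix.mul_apply]
    calc c * c ^ t ≤ X.P x x' * (X.P ^ t) x' y :=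
          mul_le_mul hP (ih x' hx' hd) (by positivity) (hX.P_nonneg x x')
      _ ≤ _ := Finset.single_le_sum (f := fun k => X.P x k * (X.P ^ t) k y)
          (fun k _ => mul_nonneg (hX.P_nonneg x k) (hX.pow_nonneg t k y)) (Finset.mem_univ x')

end FiniteChain

/-! ### Probabilities of reaching a set, and Markov's inequality. -/

namespace FiniteChain.IsLazyReversible

variable {X : FiniteChain} (hX : X.IsLazyReversible)
include hX

/-- A supersolution bounds the probability of being in a given set. -/
theorem sum_pow_le (B : Finset X.State) (W : ℕ → X.State → ℝ) (A : Set X.State)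
    (h0 : ∀ x ∈ A, x ∉ B ∧ 0 ≤ W 0 x) (hA : ∀ t x, x ∉ A → 1 ≤ W t x)
    (hW : ∀ t, ∀ x ∈ A, X.step (W t) x ≤ W (t + 1) x) (t : ℕ) (x : X.State) :
    ∑ y ∈ B, (X.P ^ t) x y ≤ W t x := by
  have hle : ∀ t x, ∑ y ∈ B, (X.P ^ t) x y ≤ 1 := fun t x => by
    rw [← hX.sum_pow t x]
    exact Finset.sum_le_sum_of_subset_of_nonneg (Finset.subset_univ _)
      fun y _ _ => hX.pow_nonneg t x y
  refine le_of_subsolution hX.P_nonneg (v := fun t x => ∑ y ∈ B, (X.P ^ t) x y) A t (fun x => ?_)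
    (fun t _ x hx => (hle t x).trans (hA t x hx)) (fun t _ x _ => ?_)
    (fun t _ x hx => hW t x hx) t le_rfl x
  · by_cases hx : x ∈ A
    · obtain ⟨h1, h2⟩ := h0 x hx
      have : ∑ y ∈ B, (X.P ^ 0) x y = 0 := Finset.sum_eq_zero fun y hy => by
        have : x ≠ y := fun h => h1 (h ▸ hy)
        simp [this]
      simp only [this]
      exact h2
    · exact (hle 0 x).trans (hA 0 x hx)
  · simp only [pow_succ', Matrix.mul_apply]
    rw [Finset.sum_comm]
    simp only [Finset.mul_sum]
    exact le_rfl

/-- Markov's inequality for the stationary law. -/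
theorem one_sub_le_sum_stat (B : Finset X.State) {φ : X.State → ℝ} {C M : ℝ} (hM : 0 < M)
    (h0 : ∀ x, 0 ≤ φ x) (hφ : ∀ x, x ∉ B → M ≤ φ x) (hC : ∑ x, X.stat x * φ x ≤ C) :
    1 - C / M ≤ ∑ x ∈ B, X.stat x := by
  have h1 : ∑ x ∈ B, X.stat x + ∑ x ∈ Bᶜ, X.stat x = 1 := by
    rw [Finset.sum_add_sum_compl, hX.stat_sum]
  have h2 : M * ∑ x ∈ Bᶜ, X.stat x ≤ C := by
    refine le_trans ?_ hC
    rw [Finset.mul_sum]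
    refine le_trans (Finset.sum_le_sum fun x hx => ?_)
      (Finset.sum_le_sum_of_subset_of_nonneg (Finset.subset_univ Bᶜ)
        fun x _ _ => mul_nonneg (hX.stat_nonneg x) (h0 x))
    rw [mul_comm]
    exact mul_le_mul_of_nonneg_left (hφ x (Finset.mem_compl.1 hx)) (hX.stat_nonneg x)
  have h3 : ∑ x ∈ Bᶜ, X.stat x ≤ C / M := by
    rw [le_div_iff₀ hM]; linarith
  linarith

end FiniteChain.IsLazyReversible

/-! ### The first network: one-step formulas and the Lyapunov function. -/

namespace KilledSegment

open FiniteChain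

/-- The position of a state. -/
def pos {n : ℕ} (x : (chain n).State) : ℤ := Subtype.val (p := fun i => i ∈ Finset.Icc (-(n : ℤ)) n) x

/-- The state at a given position. -/
def mk (n : ℕ) (i : ℤ) (h : -(n : ℤ) ≤ i ∧ i ≤ n) : (chain n).State :=
  (⟨i, Finset.mem_Icc.2 h⟩ : Pos n)

theorem pos_mk (n : ℕ) (i : ℤ) (h : -(n : ℤ) ≤ i ∧ i ≤ n) : pos (mk n i h) = i := rfl

theorem pos_mem {n : ℕ} (x : (chain n).State) : -(n : ℤ) ≤ pos x ∧ pos x ≤ n :=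
  Finset.mem_Icc.1 (Subtype.property (p := fun i => i ∈ Finset.Icc (-(n : ℤ)) n) x)

theorem pos_injective {n : ℕ} {x y : (chain n).State} (h : pos x = pos y) : x = y :=
  Subtype.ext h

theorem natAbs_pos_le {n : ℕ} (x : (chain n).State) : (pos x).natAbs ≤ n := by
  have := pos_mem x
  omega

/-- The centre of the network. -/
def centre (n : ℕ) : (chain n).State := mk n 0 (by omega)

theorem pos_centre (n : ℕ) : pos (centre n) = 0 := rfl

theorem pos_ne_zero {n : ℕ} {x : (chain n).State} (h : x ≠ centre n) : pos x ≠ 0 :=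
  fun h0 => h (pos_injective h0)

theorem chain_eq_network (n : ℕ) : chain n = network (Pos n) (fun x y => weight n x y) := rfl

theorem sum_pos (n : ℕ) (f : ℤ → ℝ) : ∑ y : Pos n, f y = ∑ j ∈ Finset.Icc (-(n : ℤ)) n, f j :=
  Finset.sum_coe_sort (Finset.Icc (-(n : ℤ)) n) f

theorem sum_shortWeight (n : ℕ) (i : ℤ) (F : ℤ → ℝ) :
    ∑ y : Pos n, shortWeight i y * F y =
      (if -(n : ℤ) ≤ i - 1 ∧ i - 1 ≤ n then shortWeight i (i - 1) * F (i - 1) else 0) +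
      (if -(n : ℤ) ≤ i + 1 ∧ i + 1 ≤ n then shortWeight i (i + 1) * F (i + 1) else 0) := by
  rw [sum_pos n (fun j => shortWeight i j * F j)]
  have h : ∀ j, shortWeight i j * F j = (if j = i - 1 then shortWeight i j * F j else 0) +
      (if j = i + 1 then shortWeight i j * F j else 0) := fun j => by
    by_cases h1 : j = i - 1
    · simp [h1]; intro h; omega
    · by_cases h2 : j = i + 1
      · simp [h2]; intro h; omega
      · have : ¬ |i - j| = 1 := by
          intro h
          rcases (abs_eq (zero_le_one' ℤ)).1 h with h | h <;> omega
        simp [shortWeight, h1, h2, this]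
  rw [Finset.sum_congr rfl fun j _ => h j, Finset.sum_add_distrib]
  simp only [Finset.sum_ite_eq', Finset.mem_Icc]

/-- The part of the conductance which comes from the long edges. -/
noncomputable def extraWeight (n : ℕ) (i j : ℤ) : ℝ :=
  if i = 0 ∧ 0 < j then longWeight n j.natAbs
    else if j = 0 ∧ 0 < i then longWeight n i.natAbs else 0

/-- The part of the conductance-weighted sum which comes from the long edges. -/
noncomputable def extraSum (n : ℕ) (i : ℤ) (F : ℤ → ℝ) : ℝ := ∑ y : Pos n, extraWeight n i y * F y

theorem extraSum_neg (n : ℕ) {i : ℤ} (hi : i < 0) (F : ℤ → ℝ) :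
    extraSum n i F = 0 :=
  Finset.sum_eq_zero fun y _ => by
    rw [extraWeight, if_neg (by omega), if_neg (by omega), zero_mul]

theorem extraSum_pos (n : ℕ) {i : ℤ} (hi : 0 < i) (F : ℤ → ℝ) :
    extraSum n i F = longWeight n i.natAbs * F 0 := by
  rw [extraSum, sum_pos n (fun j => extraWeight n i j * F j)]
  have h : ∀ j, extraWeight n i j * F j = if j = 0 then longWeight n i.natAbs * F 0 else 0 :=
    fun j => by
      rw [extraWeight, if_neg (by omega)]
      by_cases h : j = 0
      · simp [h, hi]
      · simp [h]
  rw [Finset.sum_congr rfl fun j _ => h j, Finset.sum_ite_eq', if_pos]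
  rw [Finset.mem_Icc]; omega

/-- The conductance-weighted sum of a function over the neighbours of a position. -/
noncomputable def netSum (n : ℕ) (i : ℤ) (F : ℤ → ℝ) : ℝ := ∑ y : Pos n, weight n i y * F y

theorem netSum_eq (n : ℕ) (i : ℤ) (F : ℤ → ℝ) : netSum n i F =
    (if -(n : ℤ) ≤ i - 1 ∧ i - 1 ≤ n then shortWeight i (i - 1) * F (i - 1) else 0) +
      (if -(n : ℤ) ≤ i + 1 ∧ i + 1 ≤ n then shortWeight i (i + 1) * F (i + 1) else 0) +
      extraSum n i F := by
  rw [extraSum, ← sum_shortWeight, ← Finset.sum_add_distrib]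
  exact Finset.sum_congr rfl fun y _ => by rw [weight, extraWeight, add_mul]

theorem longWeight_nonneg {n : ℕ} (hn : 2 ≤ n) (k : ℕ) : 0 ≤ longWeight n k := by
  have : (2 : ℝ) ≤ n := by exact_mod_cast hn
  have h1 : (0 : ℝ) < n - 1 := by linarith
  rw [longWeight]
  split_ifs <;> positivity

theorem shortWeight_nonneg (i j : ℤ) : 0 ≤ shortWeight i j := by
  rw [shortWeight]; split_ifs <;> positivity

theorem extraWeight_nonneg {n : ℕ} (hn : 2 ≤ n) (i j : ℤ) : 0 ≤ extraWeight n i j := by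
  rw [extraWeight]
  split_ifs
  · exact longWeight_nonneg hn _
  · exact longWeight_nonneg hn _
  · exact le_rfl

theorem weight_diag (n : ℕ) (i : ℤ) : weight n i i = 0 := by
  have h1 : ¬ (i = 0 ∧ 0 < i) := by omega
  simp [weight, shortWeight, h1]

theorem shortWeight_pred {i : ℤ} (k : ℕ) (h : max i.natAbs (i - 1).natAbs = k) :
    shortWeight i (i - 1) = (1 / 2) ^ k := by
  rw [shortWeight, if_pos (by simp), h]

theorem shortWeight_succ {i : ℤ} (k : ℕ) (h : max i.natAbs (i + 1).natAbs = k) :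
    shortWeight i (i + 1) = (1 / 2) ^ k := by
  rw [shortWeight, if_pos (by simp), h]

theorem isLazyReversible {n : ℕ} (hn : 2 ≤ n) : (chain n).IsLazyReversible := by
  rw [chain_eq_network]
  refine network_isLazyReversible (fun x y => ?_) (fun x y => ?_) (fun x => weight_diag n x)
    (⟨0, by simp⟩ : Pos n) ⟨⟨1, by simp; omega⟩, ?_⟩ (fun x => (x : ℤ).natAbs) (fun x hx => ?_)
  · have h1 : shortWeight (x : ℤ) y = shortWeight (y : ℤ) x := by
      rw [shortWeight, shortWeight, abs_sub_comm, max_comm]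
    simp only [weight, h1]
    congr 1
    split_ifs <;> first | rfl | omega
  · exact add_nonneg (shortWeight_nonneg _ _) (extraWeight_nonneg hn _ _)
  · refine add_pos_of_pos_of_nonneg ?_ (extraWeight_nonneg hn _ _)
    simp [shortWeight]
  · obtain ⟨i, hi⟩ := x
    have hi' := Finset.mem_Icc.1 hi
    have h0 : i ≠ 0 := fun h => hx (Subtype.ext h)
    rcases lt_or_gt_of_ne h0 with h | h
    · refine ⟨⟨i + 1, Finset.mem_Icc.2 (by omega)⟩, by simp only; omega, ?_⟩
      refine add_pos_of_pos_of_nonneg ?_ (extraWeight_nonneg hn _ _)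
      rw [shortWeight_succ _ rfl]
      positivity
    · refine ⟨⟨i - 1, Finset.mem_Icc.2 (by omega)⟩, by simp only; omega, ?_⟩
      refine add_pos_of_pos_of_nonneg ?_ (extraWeight_nonneg hn _ _)
      rw [shortWeight_pred _ rfl]
      positivity

theorem step_eq {n : ℕ} (F : ℤ → ℝ) (x : (chain n).State) :
    (chain n).step (fun y => F (pos y)) x = 1 / 2 * F (pos x) +
      netSum n (pos x) F / (2 * netSum n (pos x) fun _ => 1) := by
  simp only [netSum, mul_one]
  exact network_step (V := Pos n) (w := fun x y => weight n x y) (fun x => weight_diag n x)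
    (fun y => F y) x

theorem step_neg {n : ℕ} {k : ℕ} (hk1 : 1 ≤ k) (hk : k < n) {x : (chain n).State}
    (hx : pos x = -(k : ℤ)) (F : ℤ → ℝ) : (chain n).step (fun y => F (pos y)) x =
      1 / 2 * F (pos x) + (1 / 3 * F (pos x + 1) + 1 / 6 * F (pos x - 1)) := by
  rw [step_eq, netSum_eq, netSum_eq, extraSum_neg n (by omega),
    extraSum_neg n (by omega), if_pos (by omega),
    if_pos (by omega), if_pos (by omega), if_pos (by omega),
    shortWeight_pred (k + 1) (by omega), shortWeight_succ k (by omega)]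
  have : (1 / 2 : ℝ) ^ k ≠ 0 := by positivity
  rw [pow_succ]
  field_simp
  ring

theorem step_neg_end {n : ℕ} (hn : 2 ≤ n) {x : (chain n).State} (hx : pos x = -(n : ℤ))
    (F : ℤ → ℝ) : (chain n).step (fun y => F (pos y)) x =
      1 / 2 * F (pos x) + 1 / 2 * F (pos x + 1) := by
  rw [step_eq, netSum_eq, netSum_eq, extraSum_neg n (by omega),
    extraSum_neg n (by omega), if_neg (by omega),
    if_pos (by omega), if_neg (by omega), if_pos (by omega), shortWeight_succ n (by omega)]
  have : (1 / 2 : ℝ) ^ n ≠ 0 := by positivity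
  field_simp
  ring

/-- The long edges are normalized by n - 1 exactly so that, from every state of this side, the jump
to the centre takes the fraction 1/n of the moves, whatever k is. -/
theorem step_pos {n : ℕ} {k : ℕ} (hk1 : 1 ≤ k) (hk : k < n) {x : (chain n).State}
    (hx : pos x = k) (F : ℤ → ℝ) : (chain n).step (fun y => F (pos y)) x =
      1 / 2 * F (pos x) + (1 - 1 / (n : ℝ)) * (1 / 3 * F (pos x - 1) + 1 / 6 * F (pos x + 1)) +
        1 / (2 * (n : ℝ)) * F 0 := by
  have hn : (1 : ℝ) < n := by exact_mod_cast (by omega : 1 < n)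
  rw [step_eq, netSum_eq, netSum_eq, extraSum_pos n (by omega),
    extraSum_pos n (by omega), if_pos (by omega),
    if_pos (by omega), if_pos (by omega), if_pos (by omega),
    shortWeight_pred k (by omega), shortWeight_succ (k + 1) (by omega), longWeight,
    if_pos (by omega), show (pos x).natAbs = k by omega]
  have : (1 / 2 : ℝ) ^ k ≠ 0 := by positivity
  have h1 : (n : ℝ) - 1 ≠ 0 := by linarith
  have h2 : (n : ℝ) ≠ 0 := by linarith
  rw [pow_succ]
  generalize (1 / 2 : ℝ) ^ k = a at *
  have e : a * 1 + a * (1 / 2) * 1 + (a + a * (1 / 2)) / ((n : ℝ) - 1) * 1 =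
      3 / 2 * a * n / (n - 1) := by field_simp; ring
  rw [e]
  field_simp
  ring

theorem step_pos_end {n : ℕ} (hn : 2 ≤ n) {x : (chain n).State} (hx : pos x = n) (F : ℤ → ℝ) :
    (chain n).step (fun y => F (pos y)) x =
      1 / 2 * F (pos x) + (1 - 1 / (n : ℝ)) * (1 / 2 * F (pos x - 1)) +
        1 / (2 * (n : ℝ)) * F 0 := by
  have hn' : (1 : ℝ) < n := by exact_mod_cast (by omega : 1 < n)
  rw [step_eq, netSum_eq, netSum_eq, extraSum_pos n (by omega),
    extraSum_pos n (by omega), if_pos (by omega),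
    if_neg (by omega), if_pos (by omega), if_neg (by omega),
    shortWeight_pred n (by omega), longWeight, if_neg (by omega)]
  have : (1 / 2 : ℝ) ^ n ≠ 0 := by positivity
  have h1 : (n : ℝ) - 1 ≠ 0 := by linarith
  have h2 : (n : ℝ) ≠ 0 := by linarith
  generalize (1 / 2 : ℝ) ^ n = a at *
  have e : a * 1 + 0 + a / ((n : ℝ) - 1) * 1 = a * n / (n - 1) := by field_simp; ring
  rw [e]
  field_simp
  ring

/-- To bound one step from any noncentral state it is enough to treat the two sides. -/
theorem step_cases {n : ℕ} {x : (chain n).State} (hx : pos x ≠ 0) :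
    (∃ k : ℕ, 1 ≤ k ∧ k < n ∧ pos x = -(k : ℤ)) ∨ pos x = -(n : ℤ) ∨
      (∃ k : ℕ, 1 ≤ k ∧ k < n ∧ pos x = k) ∨ pos x = n := by
  have h := pos_mem x
  rcases lt_or_gt_of_ne hx with h0 | h0
  · by_cases h1 : pos x = -(n : ℤ)
    · exact Or.inr (Or.inl h1)
    · exact Or.inl ⟨(pos x).natAbs, by omega, by omega, by omega⟩
  · by_cases h1 : pos x = n
    · exact Or.inr (Or.inr (Or.inr h1))
    · exact Or.inr (Or.inr (Or.inl ⟨(pos x).natAbs, by omega, by omega, by omega⟩))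

/-- The decay 2^(-k) of the long conductances absorbs θ^k, so each long edge contributes at most
(3/2)/(n-1); there are n of them, and n/(n-1) ≤ 2. -/
theorem step_centre_le {n : ℕ} (hn : 2 ≤ n) {θ : ℝ} (h1 : 1 ≤ θ) (h2 : θ ≤ 2) :
    (chain n).step (fun y => θ ^ (pos y).natAbs) (centre n) ≤ 4 := by
  have hn' : (2 : ℝ) ≤ n := by exact_mod_cast hn
  rw [step_eq (fun j => θ ^ j.natAbs), pos_centre, netSum_eq, netSum_eq,
    if_pos (by omega), if_pos (by omega), if_pos (by omega), if_pos (by omega), shortWeight_pred 1 (by simp),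
    shortWeight_succ 1 (by simp)]
  have e0 : 0 ≤ extraSum n 0 fun _ => 1 :=
    Finset.sum_nonneg fun y _ => mul_nonneg (extraWeight_nonneg hn _ _) zero_le_one
  have e1 : extraSum n 0 (fun j => θ ^ j.natAbs) ≤ 3 := by
    rw [extraSum, sum_pos n (fun j => extraWeight n 0 j * θ ^ j.natAbs)]
    have hsub : Finset.Ioc (0 : ℤ) n ⊆ Finset.Icc (-(n : ℤ)) n := fun j hj => by
      rw [Finset.mem_Ioc] at hj
      rw [Finset.mem_Icc]; omega
    rw [← Finset.sum_subset hsub fun j hj hj' => by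
      rw [Finset.mem_Icc] at hj
      rw [Finset.mem_Ioc] at hj'
      rw [extraWeight, if_neg (by omega), if_neg (by omega), zero_mul]]
    have hterm : ∀ j ∈ Finset.Ioc (0 : ℤ) n,
        extraWeight n 0 j * θ ^ j.natAbs ≤ 3 / 2 / ((n : ℝ) - 1) := fun j hj => by
      rw [Finset.mem_Ioc] at hj
      rw [extraWeight, if_pos (by omega)]
      have hl : longWeight n j.natAbs ≤ (1 / 2 : ℝ) ^ j.natAbs * (3 / 2) / ((n : ℝ) - 1) := by
        rw [longWeight]
        split_ifs with h
        · rw [pow_succ]; apply le_of_eq; ring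
        · have : j.natAbs = n := by omega
          rw [this]
          have : (0 : ℝ) < (1 / 2) ^ n := by positivity
          apply div_le_div_of_nonneg_right _ (by linarith)
          linarith
      have hp : (1 / 2 : ℝ) ^ j.natAbs * θ ^ j.natAbs ≤ 1 := by
        rw [← mul_pow]
        exact pow_le_one₀ (by linarith) (by linarith)
      have hd : (0 : ℝ) ≤ 3 / 2 / ((n : ℝ) - 1) := div_nonneg (by norm_num) (by linarith)
      calc _ ≤ (1 / 2 : ℝ) ^ j.natAbs * (3 / 2) / ((n : ℝ) - 1) * θ ^ j.natAbs :=
            mul_le_mul_of_nonneg_right hl (by positivity)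
        _ = ((1 / 2 : ℝ) ^ j.natAbs * θ ^ j.natAbs) * (3 / 2 / ((n : ℝ) - 1)) := by ring
        _ ≤ _ := mul_le_of_le_one_left hd hp
    refine (Finset.sum_le_card_nsmul _ _ _ hterm).trans ?_
    rw [Int.card_Ioc, nsmul_eq_mul]
    have : ((n : ℤ) - 0).toNat = n := by omega
    rw [this, ← mul_div_assoc, div_le_iff₀ (by linarith)]
    linarith
  simp only [Int.natAbs_zero, pow_zero, zero_sub, zero_add, Int.natAbs_neg, Int.natAbs_one, pow_one]
  have e2 : (1 / 2 * θ + 1 / 2 * θ + extraSum n 0 fun j => θ ^ j.natAbs) /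
      (2 * (1 / 2 * 1 + 1 / 2 * 1 + extraSum n 0 fun _ => 1)) ≤ 7 / 2 := by
    rw [div_le_iff₀ (by linarith)]
    linarith
  linarith

/-- The exponential of the distance to the centre is a Lyapunov function. -/
theorem step_pow_le {n : ℕ} (hn : 2 ≤ n) {θ l : ℝ} (h1 : 1 ≤ θ)
    (hl : 1 / 2 + 1 / (3 * θ) + θ / 6 ≤ l) {x : (chain n).State} (hx : pos x ≠ 0) :
    (chain n).step (fun y => θ ^ (pos y).natAbs) x ≤ l * θ ^ (pos x).natAbs := by
  have hn' : (2 : ℝ) ≤ n := by exact_mod_cast hn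
  have hθ : 0 < θ := by linarith
  have hn1 : 1 / (n : ℝ) ≤ 1 := by
    rw [div_le_one (by linarith)]; linarith
  have hn0 : 0 ≤ 1 / (n : ℝ) := by positivity
  have hmid : ∀ k : ℕ, 1 ≤ k →
      1 / 2 * θ ^ k + (1 / 3 * θ ^ (k - 1) + 1 / 6 * θ ^ (k + 1)) ≤ l * θ ^ k := fun k hk => by
    obtain ⟨k, rfl⟩ : ∃ j, k = j + 1 := ⟨k - 1, by omega⟩
    rw [show k + 1 - 1 = k by omega]
    have e : 1 / 2 * θ ^ (k + 1) + (1 / 3 * θ ^ k + 1 / 6 * θ ^ (k + 1 + 1)) =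
        (1 / 2 + 1 / (3 * θ) + θ / 6) * θ ^ (k + 1) := by
      rw [pow_succ, pow_succ]; field_simp; ring
    rw [e]
    exact mul_le_mul_of_nonneg_right hl (by positivity)
  have hend : ∀ k : ℕ, 1 ≤ k → 1 / 2 * θ ^ (k - 1) ≤
      1 / 3 * θ ^ (k - 1) + 1 / 6 * θ ^ (k + 1) := fun k hk => by
    have : θ ^ (k - 1) ≤ θ ^ (k + 1) := pow_le_pow_right₀ h1 (by omega)
    linarith
  have hone : ∀ k : ℕ, 1 ≤ θ ^ k := fun k => one_le_pow₀ h1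
  -- Killing only helps: it moves mass to the centre, where the Lyapunov function takes its minimum
  -- 1.
  have hb : ∀ a : ℝ, 1 / 2 ≤ a → (1 - 1 / (n : ℝ)) * a + 1 / (2 * (n : ℝ)) * 1 ≤ a := fun a ha => by
    have e : (1 - 1 / (n : ℝ)) * a + 1 / (2 * (n : ℝ)) * 1 = a - 1 / (n : ℝ) * (a - 1 / 2) := by
      field_simp; ring
    rw [e]
    nlinarith [mul_nonneg hn0 (sub_nonneg.2 ha)]
  rcases step_cases hx with ⟨k, hk1, hk, h⟩ | h | ⟨k, hk1, hk, h⟩ | h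
  · rw [step_neg hk1 hk h (fun j => θ ^ j.natAbs), show (pos x).natAbs = k by omega,
      show (pos x + 1).natAbs = k - 1 by omega, show (pos x - 1).natAbs = k + 1 by omega]
    exact hmid k hk1
  · rw [step_neg_end hn h (fun j => θ ^ j.natAbs), show (pos x).natAbs = n by omega,
      show (pos x + 1).natAbs = n - 1 by omega]
    linarith [hmid n (by omega), hend n (by omega)]
  · rw [step_pos hk1 hk h (fun j => θ ^ j.natAbs), show (pos x).natAbs = k by omega,
      show (pos x - 1).natAbs = k - 1 by omega, show (pos x + 1).natAbs = k + 1 by omega,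
      Int.natAbs_zero, pow_zero]
    linarith [hmid k hk1, hb (1 / 3 * θ ^ (k - 1) + 1 / 6 * θ ^ (k + 1))
      (by linarith [hone (k - 1), hone (k + 1)])]
  · rw [step_pos_end hn h (fun j => θ ^ j.natAbs), show (pos x).natAbs = n by omega,
      show (pos x - 1).natAbs = n - 1 by omega, Int.natAbs_zero, pow_zero]
    linarith [hmid n (by omega), hend n (by omega), hb (1 / 2 * θ ^ (n - 1))
      (by linarith [hone (n - 1)])]

end KilledSegment

/-! ### The profile for lower tails on a segment. -/

/-- The exponential profile used for lower tails on a segment of length `n` with drift towards `0`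
and a reflecting end. -/
noncomputable def segmentProfile (n : ℕ) (x : ℝ) (k : ℕ) : ℝ :=
  ((1 + x)⁻¹) ^ k + 3 * x * ((1 + x)⁻¹) ^ n * ((2 / 3) ^ n * (3 / 2) ^ k)

section Profile

variable {x : ℝ} (hx : 0 ≤ x)
include hx

theorem segmentProfile_nonneg (n k : ℕ) : 0 ≤ segmentProfile n x k := by
  rw [segmentProfile]; positivity

theorem inv_pow_le_segmentProfile (n k : ℕ) : ((1 + x)⁻¹) ^ k ≤ segmentProfile n x k := by
  have : 0 ≤ 3 * x * ((1 + x)⁻¹) ^ n * ((2 / 3) ^ n * (3 / 2) ^ k) := by positivity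
  rw [segmentProfile]; linarith

theorem one_le_segmentProfile_zero (n : ℕ) : 1 ≤ segmentProfile n x 0 := by
  simpa using inv_pow_le_segmentProfile hx n 0

theorem segmentProfile_end_le (n : ℕ) (hx4 : x ≤ 1 / 4) :
    segmentProfile n x n ≤ 2 * ((1 + x)⁻¹) ^ n := by
  have h : (2 / 3 : ℝ) ^ n * (3 / 2) ^ n = 1 := by rw [← mul_pow]; norm_num
  rw [segmentProfile, h]
  have : (0 : ℝ) ≤ ((1 + x)⁻¹) ^ n := by positivity
  nlinarith

/-- The first term grows by at most the stated factor because 1/(1+x) ≤ 1 - x + x². The correction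
(3/2)^k is contracted in the interior: 3/4 + 1/3 + 3/8 < 3/2. -/
theorem segmentProfile_step (n k : ℕ) :
    1 / 2 * segmentProfile n x (k + 1) +
      (1 / 3 * segmentProfile n x k + 1 / 6 * segmentProfile n x (k + 2)) ≤
      (1 + x * (1 + x) / 6) * segmentProfile n x (k + 1) := by
  simp only [segmentProfile, pow_succ (3 / 2 : ℝ)]
  have h1 : 0 ≤ 3 * x * ((1 + x)⁻¹) ^ n * ((2 / 3) ^ n * (3 / 2) ^ k) := by positivity
  set b := 3 * x * ((1 + x)⁻¹) ^ n * ((2 / 3) ^ n * (3 / 2) ^ k) with hb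
  have h2 : (0 : ℝ) ≤ ((1 + x)⁻¹) ^ k := by positivity
  simp only [pow_succ]
  set a := ((1 + x)⁻¹) ^ k
  have e1 : ∀ c : ℝ, 3 * x * ((1 + x)⁻¹) ^ n * ((2 / 3) ^ n * ((3 / 2) ^ k * c)) = b * c :=
    fun c => by rw [hb]; ring
  have e2 : 3 * x * ((1 + x)⁻¹) ^ n * ((2 / 3) ^ n * ((3 / 2) ^ k * (3 / 2) * (3 / 2))) =
      b * (9 / 4) := by rw [hb]; ring
  rw [e1, e2]
  set η := (1 + x)⁻¹ with hη
  have hη1 : η * (1 + x) = 1 := by rw [hη]; field_simp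
  have hη0 : 0 ≤ η := by positivity
  have hηle : η ≤ 1 - x + x ^ 2 := by
    have : (1 - x + x ^ 2) * (1 + x) = 1 + x ^ 3 := by ring
    have h3 : 0 ≤ x ^ 3 := by positivity
    by_contra! hc
    nlinarith
  have key : 1 / 2 * η + (1 / 3 + 1 / 6 * (η * η)) ≤ (1 + x * (1 + x) / 6) * η := by
    have e : (1 : ℝ) / 3 = 1 / 3 * (η * (1 + x)) := by rw [hη1, mul_one]
    rw [e]
    nlinarith [mul_le_mul_of_nonneg_left hηle hη0]
  have hxx : 0 ≤ x * (1 + x) / 6 := by positivity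
  nlinarith [mul_le_mul_of_nonneg_left key h2, mul_nonneg hxx h1]

/-- At the reflecting end (1+x)^(-k) alone grows by the factor 1 + x/2, which is too much. One step
multiplies (3/2)^k there by 5/6, and the coefficient 3x makes the loss 3x/6 cancel x/2 exactly. -/
theorem segmentProfile_step_end {n : ℕ} (hn : 1 ≤ n) :
    1 / 2 * segmentProfile n x n + 1 / 2 * segmentProfile n x (n - 1) ≤
      (1 + x * (1 + x) / 6) * segmentProfile n x n := by
  obtain ⟨k, rfl⟩ : ∃ k, n = k + 1 := ⟨n - 1, by omega⟩
  have h : (2 / 3 : ℝ) ^ (k + 1) * (3 / 2) ^ (k + 1) = 1 := by rw [← mul_pow]; norm_num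
  have h' : (2 / 3 : ℝ) ^ (k + 1) * (3 / 2) ^ k = 2 / 3 := by
    rw [pow_succ, mul_right_comm, ← mul_pow]; norm_num
  simp only [segmentProfile, Nat.add_sub_cancel, h, h']
  have e : ((1 + x)⁻¹) ^ k = (1 + x) * ((1 + x)⁻¹) ^ (k + 1) := by
    rw [pow_succ]; field_simp
  rw [e]
  have h0 : (0 : ℝ) ≤ ((1 + x)⁻¹) ^ (k + 1) := by positivity
  set a := ((1 + x)⁻¹) ^ (k + 1)
  have h1 : 0 ≤ x * (1 + x) / 6 * (a + 3 * x * a) := by positivity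
  nlinarith

end Profile

/-! ### The first network: total-variation cutoff and crude separation bounds. -/

namespace KilledSegment

open FiniteChain

theorem lyapunov_rate_le {x : ℝ} (hx : 0 ≤ x) :
    1 / 2 + 1 / (3 * (1 + x)) + (1 + x) / 6 ≤ 1 - x * (1 - 2 * x) / 6 := by
  have h : 1 / (3 * (1 + x)) ≤ (1 - x + x ^ 2) / 3 := by
    rw [div_le_div_iff₀ (by positivity) (by norm_num)]
    nlinarith [pow_nonneg hx 3]
  nlinarith

section Fixed

variable {n : ℕ} (hn : 2 ≤ n)
include hn

omit hn in
theorem one_le_pow_pos {x : ℝ} (hx : 0 ≤ x) (y : (chain n).State) :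
    1 ≤ (1 + x) ^ (pos y).natAbs := one_le_pow₀ (by linarith)

theorem step_lyapunov {x : ℝ} (hx : 0 ≤ x) (y : (chain n).State) (hy : y ≠ centre n) :
    (chain n).step (fun y => (1 + x) ^ (pos y).natAbs) y ≤
      (1 - x * (1 - 2 * x) / 6) * (1 + x) ^ (pos y).natAbs :=
  step_pow_le hn (by linarith) (lyapunov_rate_le hx) (pos_ne_zero hy)

theorem sum_stat_pow_mul_le {x : ℝ} (hx : 0 ≤ x) (hx4 : x ≤ 1 / 4) :
    x * (1 - 2 * x) / 6 * ∑ y, (chain n).stat y * (1 + x) ^ (pos y).natAbs ≤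
      4 * (chain n).stat (centre n) := by
  have h := (isLazyReversible hn).sum_stat_mul_le (step_lyapunov hn hx) (by nlinarith)
    (one_le_pow_pos hx) (step_centre_le hn (by linarith) (by linarith))
  rwa [sub_sub_cancel] at h

theorem stat_le_one (y : (chain n).State) : (chain n).stat y ≤ 1 := by
  rw [← (isLazyReversible hn).stat_sum]
  exact Finset.single_le_sum (fun y _ => (isLazyReversible hn).stat_nonneg y) (Finset.mem_univ y)

/-- At x = 1/4 the Lyapunov gap x(1-2x)/6 is 1/48 and the step from the centre is at most 4, whence
192 = 4 · 48. -/
theorem le_stat_centre : 1 / 192 ≤ (chain n).stat (centre n) := by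
  have hX := isLazyReversible hn
  have h := sum_stat_pow_mul_le hn (x := 1 / 4) (by norm_num) le_rfl
  have h1 : (1 : ℝ) ≤ ∑ y, (chain n).stat y * (1 + 1 / 4) ^ (pos y).natAbs := by
    refine hX.stat_sum.symm.le.trans (Finset.sum_le_sum fun y _ => ?_)
    exact
      le_mul_of_one_le_right (hX.stat_nonneg y) (one_le_pow_pos (x := 1 / 4) (by norm_num) y)
  linarith

theorem sum_stat_pow_le : ∑ y, (chain n).stat y * (1 + 1 / 4) ^ (pos y).natAbs ≤ 192 := by
  have h := sum_stat_pow_mul_le hn (x := 1 / 4) (by norm_num) le_rfl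
  linarith [stat_le_one hn (centre n)]

theorem density_centre_le (t : ℕ) (y : (chain n).State) :
    (chain n).density t y (centre n) ≤ 192 := by
  refine ((isLazyReversible hn).density_le_inv t y _).trans ?_
  have := le_stat_centre hn
  rw [inv_le_comm₀ (by linarith) (by norm_num)]
  linarith

/-- The Lyapunov function at x = 1/4 has rate 47/48; the constant is 192², one factor from the
density and one from the stationary mean. -/
theorem return_le (t : ℕ) :
    (chain n).density t (centre n) (centre n) ≤ 1 + 36864 * (47 / 48) ^ t := by
  have hX := isLazyReversible hn
  have h := hX.density_root_le (z := centre n) (l := 47 / 48) (by norm_num)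
    (one_le_pow_pos (x := 1 / 4) (by norm_num))
    (fun x hx => (step_lyapunov hn (by norm_num) x hx).trans (by norm_num)) t
  have h1 := density_centre_le hn t (centre n)
  have h2 := sum_stat_pow_le hn
  have h0 : 0 ≤ ∑ y, (chain n).stat y * (1 + 1 / 4) ^ (pos y).natAbs :=
    Finset.sum_nonneg fun y _ => mul_nonneg (hX.stat_nonneg y) (by positivity)
  refine h.trans ?_
  have hp : (0 : ℝ) ≤ (47 / 48) ^ t := by positivity
  calc _ ≤ 1 + 192 * (192 * (47 / 48 : ℝ) ^ t) := by gcongr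
    _ = _ := by ring

/-- The universal upper bound on the separation distance. -/
theorem sepDist_le_pow {x : ℝ} (hx : 0 ≤ x) (hx4 : x ≤ 1 / 4) (t : ℕ) :
    (chain n).sepDist t ≤ (1 + x) ^ n * ((1 + x) ^ n * (1 - x * (1 - 2 * x) / 6) ^ t) := by
  have hl : 0 ≤ 1 - x * (1 - 2 * x) / 6 := by nlinarith
  refine (isLazyReversible hn).sepDist_le fun y w => ?_
  refine ((isLazyReversible hn).one_sub_density_pair_le hl (one_le_pow_pos hx)
    (step_lyapunov hn hx) t y w).trans ?_
  have h1 : ∀ y : (chain n).State, (1 + x) ^ (pos y).natAbs ≤ (1 + x) ^ n := fun y =>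
    pow_le_pow_right₀ (by linarith) (natAbs_pos_le y)
  have h2 := pow_nonneg hl t
  exact mul_le_mul (h1 y) (mul_le_mul_of_nonneg_right (h1 w) h2)
    (mul_nonneg (by positivity) h2) (by positivity)

/-- The target is averaged under π, and the Lyapunov function has bounded stationary mean; only the
starting state costs a factor (1+x)^n, against two such factors for separation. -/
theorem tvDist_le_pow {x : ℝ} (hx : 0 < x) (hx4 : x ≤ 1 / 4) (t : ℕ) :
    (chain n).tvDist t ≤
      4 / (x * (1 - 2 * x) / 6) * ((1 + x) ^ n * (1 - x * (1 - 2 * x) / 6) ^ t) := by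
  have hX := isLazyReversible hn
  have hl : 0 ≤ 1 - x * (1 - 2 * x) / 6 := by nlinarith
  have h2 := pow_nonneg hl t
  have hp : ∀ y : (chain n).State, 0 ≤ (1 + x) ^ (pos y).natAbs := fun y => by positivity
  refine hX.tvDist_le _ (fun y w => mul_nonneg (hp y) (mul_nonneg (hp w) h2))
    (hX.one_sub_density_pair_le hl (one_le_pow_pos hx.le) (step_lyapunov hn hx.le) t)
    (fun y => ?_)
  have hpos : 0 < x * (1 - 2 * x) / 6 := div_pos (mul_pos hx (by linarith)) (by norm_num)
  have hs : ∑ w, (chain n).stat w * (1 + x) ^ (pos w).natAbs ≤ 4 / (x * (1 - 2 * x) / 6) := by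
    rw [le_div_iff₀ hpos, mul_comm]
    linarith [sum_stat_pow_mul_le hn hx.le hx4, stat_le_one hn (centre n)]
  have e : ∑ w, (chain n).stat w * ((1 + x) ^ (pos y).natAbs *
      ((1 + x) ^ (pos w).natAbs * (1 - x * (1 - 2 * x) / 6) ^ t)) =
      (∑ w, (chain n).stat w * (1 + x) ^ (pos w).natAbs) *
        ((1 + x) ^ (pos y).natAbs * (1 - x * (1 - 2 * x) / 6) ^ t) := by
    rw [Finset.sum_mul]
    exact Finset.sum_congr rfl fun w _ => by ring
  rw [e]
  have h3 : (1 + x) ^ (pos y).natAbs ≤ (1 + x) ^ n :=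
    pow_le_pow_right₀ (by linarith) (natAbs_pos_le y)
  exact mul_le_mul hs (mul_le_mul_of_nonneg_right h3 h2) (mul_nonneg (hp y) h2) (by positivity)

/-- One step of a function which equals the profile on the left side. -/
theorem step_left_profile {x c : ℝ} (hx : 0 ≤ x) (hc : 0 ≤ c) (F : ℤ → ℝ)
    (hF : ∀ j ≤ 0, F j = c * segmentProfile n x j.natAbs) {y : (chain n).State} (hy : pos y < 0) :
    (chain n).step (fun w => F (pos w)) y ≤ (1 + x * (1 + x) / 6) * F (pos y) := by
  rcases step_cases hy.ne with ⟨k, hk1, hk, h⟩ | h | ⟨k, hk1, hk, h⟩ | h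
  · obtain ⟨j, rfl⟩ : ∃ j, k = j + 1 := ⟨k - 1, by omega⟩
    rw [step_neg hk1 hk h, hF _ (by omega), hF _ (by omega), hF _ (by omega),
      show (pos y).natAbs = j + 1 by omega, show (pos y + 1).natAbs = j by omega,
      show (pos y - 1).natAbs = j + 2 by omega]
    nlinarith [mul_le_mul_of_nonneg_left (segmentProfile_step hx n j) hc]
  · rw [step_neg_end hn h, hF _ (by omega), hF _ (by omega),
      show (pos y).natAbs = n by omega, show (pos y + 1).natAbs = n - 1 by omega]
    nlinarith [mul_le_mul_of_nonneg_left (segmentProfile_step_end hx (by omega : 1 ≤ n)) hc]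
  · omega
  · omega

/-- From the left end the walk is unlikely to have come within distance K of the centre, whereas π
gives almost all of its mass to the positions at least -K. The factor (1+x)^K lifts the profile to 1
up to distance K. -/
theorem le_tvDist_of_profile {x : ℝ} (hx : 0 ≤ x) (hx4 : x ≤ 1 / 4) (K t : ℕ) :
    1 - 192 / (1 + 1 / 4) ^ K - (1 + x) ^ K * (2 * (((1 + x)⁻¹) ^ n *
      (1 + x * (1 + x) / 6) ^ t)) ≤ (chain n).tvDist t := by
  have hX := isLazyReversible hn
  let B : Finset (chain n).State := Finset.univ.filter fun y => -(K : ℤ) ≤ pos y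
  let F : ℤ → ℝ := fun j => (1 + x) ^ K * segmentProfile n x (if j ≤ 0 then j.natAbs else 0)
  have hm : 1 ≤ 1 + x * (1 + x) / 6 := by
    have : 0 ≤ x * (1 + x) / 6 := by positivity
    linarith
  have hF0 : ∀ j, 0 ≤ F j := fun j =>
    mul_nonneg (by positivity) (segmentProfile_nonneg hx n _)
  have h1 := hX.one_sub_le_sum_stat B (φ := fun y => (1 + 1 / 4) ^ (pos y).natAbs)
    (M := (1 + 1 / 4) ^ K) (by positivity) (fun y => by positivity) (fun y hy => by
      have : ¬ -(K : ℤ) ≤ pos y := by simpa [B] using hy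
      exact pow_le_pow_right₀ (by norm_num) (by omega)) (sum_stat_pow_le hn)
  have h2 := hX.sum_pow_le B (fun t y => F (pos y) * (1 + x * (1 + x) / 6) ^ t)
    {y | pos y < -(K : ℤ)} (fun y hy => ⟨by simpa [B] using hy, by simpa using hF0 _⟩)
    (fun t y hy => by
      have hy' : -(K : ℤ) ≤ pos y := by simpa using hy
      refine one_le_mul_of_one_le_of_one_le ?_ (one_le_pow₀ hm)
      obtain ⟨k, hk, hFk⟩ : ∃ k ≤ K, F (pos y) = (1 + x) ^ K * segmentProfile n x k :=
        ⟨_, by split_ifs <;> omega, rfl⟩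
      have e : (1 + x) ^ K * ((1 + x)⁻¹) ^ K = 1 := by
        rw [← mul_pow, mul_inv_cancel₀ (by linarith), one_pow]
      have e2 : ((1 + x)⁻¹) ^ K ≤ ((1 + x)⁻¹) ^ k :=
        pow_le_pow_of_le_one (by positivity) (inv_le_one_of_one_le₀ (by linarith)) hk
      rw [hFk]
      refine e.symm.le.trans ?_
      exact mul_le_mul_of_nonneg_left (e2.trans (inv_pow_le_segmentProfile hx n k))
        (by positivity))
    (fun t y hy => by
      have hy' : pos y < -(K : ℤ) := hy
      have h := step_left_profile hn hx (c := (1 + x) ^ K) (by positivity) F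
        (fun j hj => by simp only [F, if_pos hj]) (y := y) (by omega)
      rw [hX.step_mul_const, pow_succ]
      calc _ ≤ (1 + x * (1 + x) / 6) * F (pos y) * (1 + x * (1 + x) / 6) ^ t :=
            mul_le_mul_of_nonneg_right h (by positivity)
        _ = _ := by ring) t (mk n (-(n : ℤ)) (by omega))
  have h3 := hX.le_tvDist t (mk n (-(n : ℤ)) (by omega)) B
  rw [pos_mk] at h2
  have e : F (-(n : ℤ)) = (1 + x) ^ K * segmentProfile n x n := by
    simp [F]
  rw [e] at h2
  have h4 : (1 + x) ^ K * segmentProfile n x n * (1 + x * (1 + x) / 6) ^ t ≤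
      (1 + x) ^ K * (2 * (((1 + x)⁻¹) ^ n * (1 + x * (1 + x) / 6) ^ t)) := by
    rw [mul_assoc, ← mul_assoc 2]
    exact mul_le_mul_of_nonneg_left (mul_le_mul_of_nonneg_right (segmentProfile_end_le hx n hx4)
      (by positivity)) (by positivity)
  linarith

end Fixed

theorem antitone_sepDist : ∀ᶠ n in atTop, Antitone (chain n).sepDist :=
  (eventually_ge_atTop 2).mono fun _ hn => (isLazyReversible hn).sepDist_antitone

theorem antitone_tvDist : ∀ᶠ n in atTop, Antitone (chain n).tvDist :=
  (eventually_ge_atTop 2).mono fun _ hn => (isLazyReversible hn).tvDist_antitone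

theorem tendsto_sepDist_zero {s : ℝ} (hs : 12 < s) :
    Tendsto (fun n : ℕ => (chain n).sepDist ⌊s * n⌋₊) atTop (𝓝 0) := by
  obtain ⟨x, hx0, hx4, hl0, hl1, hlim⟩ := exists_upper_rate (c := 6) (s := s / 2) (by norm_num)
    (by linarith)
  have h2 := hlim.mul hlim
  rw [mul_zero] at h2
  refine squeeze_zero' ?_ ?_ h2
  · filter_upwards [eventually_ge_atTop 2] with n hn
    have hX := isLazyReversible hn
    exact (show (0 : ℝ) ≤ (chain n).tvDist ⌊s * n⌋₊ from
      Real.iSup_nonneg fun x => by positivity).trans (hX.tvDist_le_sepDist _)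
  · filter_upwards [eventually_ge_atTop 2] with n hn
    refine (sepDist_le_pow hn hx0.le hx4 _).trans ?_
    have hfl : ⌊s / 2 * n⌋₊ + ⌊s / 2 * n⌋₊ ≤ ⌊s * n⌋₊ := by
      apply Nat.le_floor
      have := Nat.floor_le (show 0 ≤ s / 2 * n by positivity)
      push_cast
      linarith
    have hp := pow_le_pow_of_le_one hl0.le hl1.le hfl
    calc _ ≤ (1 + x) ^ n * ((1 + x) ^ n *
          (1 - x * (1 - 2 * x) / 6) ^ (⌊s / 2 * n⌋₊ + ⌊s / 2 * n⌋₊)) := by gcongr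
      _ = _ := by rw [pow_add]; ring

theorem tendsto_tvDist_zero {s : ℝ} (hs : 6 < s) :
    Tendsto (fun n : ℕ => (chain n).tvDist ⌊s * n⌋₊) atTop (𝓝 0) := by
  obtain ⟨x, hx0, hx4, hl0, hl1, hlim⟩ := exists_upper_rate (c := 6) (by norm_num) hs
  have h2 := hlim.const_mul (4 / (x * (1 - 2 * x) / 6))
  rw [mul_zero] at h2
  refine squeeze_zero' (Eventually.of_forall fun n => Real.iSup_nonneg fun x => by positivity) ?_ h2
  filter_upwards [eventually_ge_atTop 2] with n hn
  exact tvDist_le_pow hn hx0 hx4 _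

theorem tendsto_tvDist_one {s : ℝ} (hs0 : 0 ≤ s) (hs : s < 6) :
    Tendsto (fun n : ℕ => (chain n).tvDist ⌊s * n⌋₊) atTop (𝓝 1) := by
  obtain ⟨x, hx0, hx4, hlim⟩ := exists_lower_rate (c := 6) (by norm_num) hs0 hs
  refine tendsto_order.2 ⟨fun a ha => ?_, fun a ha => ?_⟩
  · have hK : Tendsto (fun K : ℕ => (1 : ℝ) - 192 / (1 + 1 / 4) ^ K) atTop (𝓝 (1 - 0)) :=
      (tendsto_const_nhds.div_atTop (tendsto_pow_atTop_atTop_of_one_lt (by norm_num))).const_sub 1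
    rw [sub_zero] at hK
    -- K is fixed before n tends to infinity, so its factor (1+x)^K is harmless.
    obtain ⟨K, hKa⟩ := (hK.eventually (eventually_gt_nhds ha)).exists
    have h := ((hlim.const_mul 2).const_mul ((1 + x) ^ K)).const_sub
      ((1 : ℝ) - 192 / (1 + 1 / 4) ^ K)
    rw [mul_zero, mul_zero, sub_zero] at h
    filter_upwards [h.eventually (eventually_gt_nhds hKa), eventually_ge_atTop 2] with n h1 hn
    exact h1.trans_le (le_tvDist_of_profile hn hx0.le hx4 K _)
  · filter_upwards [eventually_ge_atTop 2] with n hn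
    exact ((isLazyReversible hn).tvDist_le_one _).trans_lt ha

theorem tvCutoff : TVCutoff chain :=
  cutoffOf_of_tendsto (D := fun n => (chain n).tvDist) (by norm_num : (0 : ℝ) < 6) antitone_tvDist
    (fun _ => tendsto_tvDist_one) (fun _ => tendsto_tvDist_zero)

theorem tMixTendsToInfinity : TMixTendsToInfinity chain :=
  tendsto_sInf_atTop (D := fun n => (chain n).tvDist) (by norm_num : (0 : ℝ) < 6) antitone_tvDist
    (fun _ => tendsto_tvDist_one) (tendsto_tvDist_zero (s := 7) (by norm_num)) (by norm_num)
    (by norm_num)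

/-! ### The first network: the separation profile between 6n and 12n. -/

/-- The survival probability per step of the killing on the right side. -/
noncomputable def survival (n : ℕ) : ℝ := 1 - 1 / (2 * (n : ℝ))

theorem step_right {n : ℕ} (hn : 2 ≤ n) {y : (chain n).State} (hy : 0 < pos y) (F : ℤ → ℝ) :
    ∃ G : ℝ, (chain n).step (fun w => F (pos w)) y =
      1 / 2 * F (pos y) + (2 * survival n - 1) * G + (1 - survival n) * F 0 ∧
      ((∃ k : ℕ, 1 ≤ k ∧ k < n ∧ pos y = k ∧
        G = 1 / 3 * F (pos y - 1) + 1 / 6 * F (pos y + 1)) ∨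
        (pos y = n ∧ G = 1 / 2 * F (pos y - 1))) := by
  have hn' : (n : ℝ) ≠ 0 := by positivity
  have e1 : 1 - 1 / (n : ℝ) = 2 * survival n - 1 := by rw [survival]; field_simp; ring
  have e2 : 1 / (2 * (n : ℝ)) = 1 - survival n := by rw [survival]; ring
  rcases step_cases hy.ne' with ⟨k, hk1, hk, h⟩ | h | ⟨k, hk1, hk, h⟩ | h
  · omega
  · omega
  · exact ⟨_, by rw [step_pos hk1 hk h, e1, e2], Or.inl ⟨k, hk1, hk, h, rfl⟩⟩
  · exact ⟨_, by rw [step_pos_end hn h, e1, e2], Or.inr ⟨h, rfl⟩⟩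

theorem survival_bounds {n : ℕ} (hn : 2 ≤ n) : 3 / 4 ≤ survival n ∧ survival n < 1 := by
  have hn' : (2 : ℝ) ≤ n := by exact_mod_cast hn
  rw [survival]
  constructor
  · have : 1 / (2 * (n : ℝ)) ≤ 1 / 4 := one_div_le_one_div_of_le (by norm_num) (by linarith)
    linarith
  · have : 0 < 1 / (2 * (n : ℝ)) := by positivity
    linarith

section Fixed

variable {n : ℕ} (hn : 2 ≤ n)
include hn

/-- From the right side the walk is sent to the centre with probability at least 1 - `survival n` at
each step. The left side is never entered without passing the centre, so the trivial value 1 is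
enough there. -/
theorem one_sub_density_right_centre_le {y : (chain n).State} (hy : 0 ≤ pos y) (t : ℕ) :
    1 - (chain n).density t y (centre n) ≤ survival n ^ t := by
  have hX := isLazyReversible hn
  obtain ⟨hq, hq1⟩ := survival_bounds hn
  let F : ℕ → ℤ → ℝ := fun t j => if j < 0 then 1 else if j = 0 then 0 else survival n ^ t
  have hF0 : ∀ t j, 0 < j → F t j = survival n ^ t := fun t j hj => by
    simp only [F]; rw [if_neg (by omega), if_neg (by omega)]
  have hFz : ∀ t, F t 0 = 0 := fun t => by simp [F]
  have hFle : ∀ t j, 0 ≤ j → F t j ≤ survival n ^ t := fun t j hj => by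
    simp only [F]; rw [if_neg (by omega)]
    split_ifs
    · positivity
    · exact le_rfl
  have h := hX.one_sub_density_le (centre n) (fun t y => F t (pos y)) {y | 0 < pos y}
    (fun x hx => by rw [hF0 _ _ hx]; simp) (fun t x hx => ?_) (fun t x hx => ?_) t y
  · exact h.trans (hFle t _ hy)
  · have hx' : ¬ 0 < pos x := hx
    rcases lt_or_eq_of_le (not_lt.1 hx') with h | h
    · simp only [F, if_pos h]
      exact hX.one_sub_density_le_one t x _
    · have : x = centre n := pos_injective h
      subst this
      rw [pos_centre, hFz]
      linarith [hX.one_le_density_diag t (centre n)]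
  · obtain ⟨G, hG, h⟩ := step_right hn hx (F t)
    have hq0 : 0 ≤ survival n ^ t := by positivity
    have hGle : G ≤ 1 / 2 * survival n ^ t := by
      have hx' : 0 < pos x := hx
      rcases h with ⟨k, hk1, hk, hk2, h⟩ | ⟨h1, h⟩
      · rw [h]
        linarith [hFle t (pos x - 1) (by omega), hFle t (pos x + 1) (by omega)]
      · rw [h]
        linarith [hFle t (pos x - 1) (by omega)]
    rw [hG, hFz, hF0 _ _ hx, hF0 _ _ hx, pow_succ]
    nlinarith

/-- The value at the centre decays like `survival n ^ t`, so the Lyapunov exponent r is tuned to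
have at most this rate. Then (1+r)^n plays the role of the exponential moment of the hitting time of
the centre. -/
theorem one_sub_density_right_le {r : ℝ} (hr : 0 ≤ r)
    (hq : 1 - r * (1 - 2 * r) / 6 ≤ survival n) {y : (chain n).State} (hy : 0 ≤ pos y)
    (t : ℕ) (x : (chain n).State) :
    1 - (chain n).density t x y ≤ (1 + r) ^ n * survival n ^ t := by
  have hX := isLazyReversible hn
  obtain ⟨hq0, hq1⟩ := survival_bounds hn
  have hp : 0 ≤ survival n ^ t := by positivity
  have h := hX.one_sub_density_le y (fun t x => (1 + r) ^ (pos x).natAbs * survival n ^ t)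
    {centre n}ᶜ (fun x _ => by simpa using one_le_pow_pos hr x) (fun t x hx => ?_)
    (fun t x hx => ?_) t x
  · exact h.trans (mul_le_mul_of_nonneg_right
      (pow_le_pow_right₀ (by linarith) (natAbs_pos_le x)) hp)
  · have : x = centre n := by simpa using hx
    subst this
    rw [hX.density_symm, pos_centre]
    simpa using one_sub_density_right_centre_le hn hy t
  · rw [hX.step_mul_const, pow_succ]
    have h1 := (step_lyapunov hn hr x hx).trans (mul_le_mul_of_nonneg_right hq (by positivity))
    calc _ ≤ survival n * (1 + r) ^ (pos x).natAbs * survival n ^ t :=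
          mul_le_mul_of_nonneg_right h1 (by positivity)
      _ = _ := by ring

/-- The left side is a path, so from w the walk must pass through y on the way in. The target y thus
serves as its own root, where the defect is nonpositive, and only one hitting time enters. -/
theorem one_sub_density_left_le {x : ℝ} (hx : 0 ≤ x) (hx4 : x ≤ 1 / 4) {y w : (chain n).State}
    (hy : pos y ≤ 0) (hw : pos w ≤ pos y) (t : ℕ) :
    1 - (chain n).density t w y ≤ (1 + x) ^ n * (1 - x * (1 - 2 * x) / 6) ^ t := by
  have hX := isLazyReversible hn
  have hl : 0 ≤ 1 - x * (1 - 2 * x) / 6 := by nlinarith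
  let F : ℤ → ℝ := fun j => (1 + x) ^ j.natAbs
  let W : ℕ → (chain n).State → ℝ := fun t u =>
    if pos u ≤ pos y then (1 + x) ^ (pos u).natAbs * (1 - x * (1 - 2 * x) / 6) ^ t else 1
  have h := hX.one_sub_density_le y W {u | pos u < pos y} (fun u hu => ?_) (fun t u hu => ?_)
    (fun t u hu => ?_) t w
  · simp only [W, if_pos hw] at h
    exact h.trans (mul_le_mul_of_nonneg_right
      (pow_le_pow_right₀ (by linarith) (natAbs_pos_le w)) (pow_nonneg hl t))
  · have hu' : pos u < pos y := hu
    simp only [W, if_pos hu'.le, pow_zero, mul_one]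
    exact one_le_pow_pos hx u
  · have hu' : ¬ pos u < pos y := hu
    rcases lt_or_eq_of_le (not_lt.1 hu') with h | h
    · simp only [W, if_neg (not_le.2 h)]
      exact hX.one_sub_density_le_one t u y
    · have : y = u := pos_injective h
      subst this
      simp only [W, if_pos le_rfl]
      have h1 := hX.one_le_density_diag t y
      have h2 : 0 ≤ (1 + x) ^ (pos y).natAbs * (1 - x * (1 - 2 * x) / 6) ^ t :=
        mul_nonneg (by positivity) (pow_nonneg hl t)
      linarith
  · have hu' : pos u < pos y := hu
    have e : (chain n).step (W t) u =
        (chain n).step (fun v => (1 + x) ^ (pos v).natAbs * (1 - x * (1 - 2 * x) / 6) ^ t) u := by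
      let F : ℤ → ℝ := fun j => if j ≤ pos y then
        (1 + x) ^ j.natAbs * (1 - x * (1 - 2 * x) / 6) ^ t else 1
      let G : ℤ → ℝ := fun j => (1 + x) ^ j.natAbs * (1 - x * (1 - 2 * x) / 6) ^ t
      have hFG : ∀ j ≤ pos y, F j = G j := fun j hj => by simp only [F, G, if_pos hj]
      change (chain n).step (fun v => F (pos v)) u = (chain n).step (fun v => G (pos v)) u
      rcases step_cases (show pos u ≠ 0 by omega) with ⟨k, hk1, hk, h⟩ | h | ⟨k, hk1, hk, h⟩ | h
      · rw [step_neg hk1 hk h, step_neg hk1 hk h, hFG _ (by omega), hFG _ (by omega),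
          hFG _ (by omega)]
      · rw [step_neg_end hn h, step_neg_end hn h, hFG _ (by omega), hFG _ (by omega)]
      · omega
      · omega
    rw [e, hX.step_mul_const]
    simp only [W, if_pos hu'.le, pow_succ]
    have h1 := step_lyapunov hn hx u (fun h => by rw [h, pos_centre] at hu'; omega)
    calc _ ≤ (1 - x * (1 - 2 * x) / 6) * (1 + x) ^ (pos u).natAbs *
          (1 - x * (1 - 2 * x) / 6) ^ t := mul_le_mul_of_nonneg_right h1 (pow_nonneg hl t)
      _ = _ := by ring

theorem sepDist_le_add {r x : ℝ} (hr : 0 ≤ r) (hq : 1 - r * (1 - 2 * r) / 6 ≤ survival n)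
    (hx : 0 ≤ x) (hx4 : x ≤ 1 / 4) (t : ℕ) : (chain n).sepDist t ≤
      (1 + r) ^ n * survival n ^ t + (1 + x) ^ n * (1 - x * (1 - 2 * x) / 6) ^ t := by
  have hX := isLazyReversible hn
  obtain ⟨hq0, hq1⟩ := survival_bounds hn
  have hl : 0 ≤ 1 - x * (1 - 2 * x) / 6 := by nlinarith
  have h1 : 0 ≤ (1 + r) ^ n * survival n ^ t := by positivity
  have h2 : 0 ≤ (1 + x) ^ n * (1 - x * (1 - 2 * x) / 6) ^ t :=
    mul_nonneg (by positivity) (pow_nonneg hl t)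
  refine hX.sepDist_le fun u v => ?_
  rcases le_or_gt 0 (pos v) with hv | hv
  · linarith [one_sub_density_right_le hn hr hq hv t u]
  rcases le_or_gt 0 (pos u) with hu | hu
  · rw [hX.density_symm]
    linarith [one_sub_density_right_le hn hr hq hu t v]
  rcases le_total (pos u) (pos v) with h | h
  · linarith [one_sub_density_left_le hn hx hx4 hv.le h t]
  · rw [hX.density_symm]
    linarith [one_sub_density_left_le hn hx hx4 hu.le h t]

/-- Upper bound for the density between the right end and the centre. -/
theorem density_right_end_le {x : ℝ} (hx : 0 ≤ x) (hx4 : x ≤ 1 / 4) (t : ℕ) :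
    (chain n).density t (mk n n (by omega)) (centre n) ≤ 1 - survival n ^ t +
      (1 - survival n) * 1769472 +
        73730 * (((1 + x)⁻¹) ^ n * (1 + x * (1 + x) / 6) ^ t) := by
  have hX := isLazyReversible hn
  obtain ⟨hq0, hq1⟩ := survival_bounds hn
  have hm : 1 ≤ 1 + x * (1 + x) / 6 := by
    have : 0 ≤ x * (1 + x) / 6 := by positivity
    linarith
  set q := survival n with hq
  set m := 1 + x * (1 + x) / 6 with hmdef
  -- Accumulated excess of the return density over 1, weighted by the killing rate: a partial
  -- geometric sum, with 1769472 = 36864 · 48.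
  let D : ℕ → ℝ := fun t => (1 - q) * 1769472 * (1 - (47 / 48) ^ t)
  -- Probability of having been killed, the excess just described, and the contribution of walking
  -- to the centre unkilled; 36865 = 1 + 36864 dominates the return density.
  let U : ℕ → ℕ → ℝ := fun t k => 1 - q ^ t + D t + 36865 * segmentProfile n x k * m ^ t
  let F : ℕ → ℤ → ℝ := fun t j => if j < 0 then 192 else
    if j = 0 then 1 + 36864 * (47 / 48) ^ t else U t j.natAbs
  have hqt : ∀ t, q ^ t ≤ 1 := fun t => pow_le_one₀ (by linarith) hq1.le
  have hlt : ∀ t, (47 / 48 : ℝ) ^ t ≤ 1 := fun t => pow_le_one₀ (by norm_num) (by norm_num)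
  have hlt0 : ∀ t, (0 : ℝ) < (47 / 48 : ℝ) ^ t := fun t => by positivity
  have hD : ∀ t, 0 ≤ D t := fun t =>
    mul_nonneg (mul_nonneg (by linarith) (by norm_num)) (by linarith [hlt t])
  have hprof : ∀ t k, 0 ≤ 36865 * segmentProfile n x k * m ^ t := fun t k =>
    mul_nonneg (mul_nonneg (by norm_num) (segmentProfile_nonneg hx n k)) (by positivity)
  have hpos : ∀ t j, 0 < j → F t j = U t j.natAbs := fun t j hj => by
    simp only [F]; rw [if_neg (by omega), if_neg (by omega)]
  have hz : ∀ t, F t 0 = 1 + 36864 * (47 / 48) ^ t := fun t => by simp [F]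
  have hle : ∀ t j, 0 ≤ j → F t j ≤ U t j.natAbs := fun t j hj => by
    rcases hj.lt_or_eq with h | h
    · rw [hpos t j h]
    · subst h
      rw [hz]
      have h1 : 1 ≤ segmentProfile n x 0 * m ^ t :=
        one_le_mul_of_one_le_of_one_le (one_le_segmentProfile_zero hx n) (one_le_pow₀ hm)
      have h2 := hD t
      have h3 := hqt t
      have h4 := hlt t
      simp only [U, Int.natAbs_zero]
      linarith
  have h := le_of_subsolution hX.P_nonneg (v := fun t y => (chain n).density t y (centre n))
    (W := fun t y => F t (pos y)) {y | 0 < pos y} t (fun y => ?_) (fun t _ y hy => ?_)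
    (fun t _ y _ => ?_) (fun t _ y hy => ?_) t le_rfl (mk n n (by omega))
  · simp only [pos_mk] at h
    rw [hpos t _ (by omega), Int.natAbs_natCast] at h
    refine h.trans ?_
    have h1 := mul_le_mul_of_nonneg_right (segmentProfile_end_le hx n hx4)
      (show 0 ≤ m ^ t by positivity)
    have h2 : D t ≤ (1 - q) * 1769472 :=
      mul_le_of_le_one_right (by nlinarith) (by linarith [hlt0 t])
    simp only [U]
    linarith
  · by_cases hy : y = centre n
    · subst hy
      rw [pos_centre, hz]
      exact return_le hn 0
    · rw [hX.density_zero hy]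
      rcases lt_or_gt_of_ne (pos_ne_zero hy) with h | h
      · simp only [F, if_pos h]; norm_num
      · rw [hpos 0 _ h]
        have h1 := hD 0
        have h3 := hprof 0 (pos y).natAbs
        simp only [U, pow_zero] at h3 ⊢
        linarith
  · have hy' : ¬ 0 < pos y := hy
    rcases lt_or_eq_of_le (not_lt.1 hy') with h | h
    · simp only [F, if_pos h]
      exact density_centre_le hn t y
    · have : y = centre n := pos_injective h
      subst this
      rw [pos_centre, hz]
      exact return_le hn t
  · rw [hX.density_succ]
    exact le_rfl
  · obtain ⟨G, hG, h⟩ := step_right hn hy (F t)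
    have hy' : 0 < pos y := hy
    change (chain n).step (fun w => F t (pos w)) y ≤ _
    rw [hG, hz, hpos t _ hy', hpos (t + 1) _ hy']
    have hGle : 36865 * m ^ t * (1 / 2 * segmentProfile n x (pos y).natAbs) +
        G ≤ 1 / 2 * (1 - q ^ t + D t) +
          36865 * m ^ t * (m * segmentProfile n x (pos y).natAbs) := by
      rcases h with ⟨k, hk1, hk, hk2, h⟩ | ⟨h1, h⟩
      · obtain ⟨i, rfl⟩ : ∃ i, k = i + 1 := ⟨k - 1, by omega⟩
        have a1 := hle t (pos y - 1) (by omega)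
        have a2 := hle t (pos y + 1) (by omega)
        rw [show (pos y - 1).natAbs = i by omega] at a1
        rw [show (pos y + 1).natAbs = i + 2 by omega] at a2
        have a3 := mul_le_mul_of_nonneg_left (segmentProfile_step hx n i)
          (show 0 ≤ 36865 * m ^ t by positivity)
        rw [← hmdef] at a3
        rw [h, show (pos y).natAbs = i + 1 by omega]
        simp only [U] at a1 a2
        linarith
      · have a1 := hle t (pos y - 1) (by omega)
        rw [show (pos y - 1).natAbs = n - 1 by omega] at a1
        have a3 := mul_le_mul_of_nonneg_left (segmentProfile_step_end hx (by omega : 1 ≤ n))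
          (show 0 ≤ 36865 * m ^ t by positivity)
        rw [← hmdef] at a3
        rw [h, show (pos y).natAbs = n by omega]
        simp only [U] at a1
        linarith
    have hfac : (2 * q - 1) * G ≤ (2 * q - 1) * (1 / 2 * (1 - q ^ t + D t)) +
        36865 * m ^ t * ((m - 1 / 2) * segmentProfile n x (pos y).natAbs) := by
      have b0 : 0 ≤ 36865 * m ^ t * ((m - 1 / 2) * segmentProfile n x (pos y).natAbs) :=
        mul_nonneg (by positivity)
          (mul_nonneg (by linarith) (segmentProfile_nonneg hx n _))
      have b1 : G - 1 / 2 * (1 - q ^ t + D t) ≤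
          36865 * m ^ t * ((m - 1 / 2) * segmentProfile n x (pos y).natAbs) := by linarith
      have b2 := mul_le_mul_of_nonneg_left b1 (show 0 ≤ 2 * q - 1 by linarith)
      have b3 : (2 * q - 1) * (36865 * m ^ t *
          ((m - 1 / 2) * segmentProfile n x (pos y).natAbs)) ≤
          36865 * m ^ t * ((m - 1 / 2) * segmentProfile n x (pos y).natAbs) :=
        mul_le_of_le_one_left b0 (by linarith)
      linarith
    have hDs : D (t + 1) = D t + (1 - q) * 36864 * (47 / 48) ^ t := by
      simp only [D, pow_succ]; ring
    have hDq : q * D t ≤ D t := mul_le_of_le_one_left (hD t) hq1.le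
    simp only [U, hDs, pow_succ]
    linarith

/-- Upper bound for the density between the two ends. -/
theorem density_ends_le {x : ℝ} (hx : 0 ≤ x) (hx4 : x ≤ 1 / 4) (t₁ t₂ : ℕ) :
    (chain n).density (t₂ + t₁) (mk n (-(n : ℤ)) (by omega)) (mk n n (by omega)) ≤
      1 - survival n ^ t₂ + (1 - survival n) * 1769472 +
        73730 * (((1 + x)⁻¹) ^ n * (1 + x * (1 + x) / 6) ^ t₂) +
        384 * (((1 + x)⁻¹) ^ n * (1 + x * (1 + x) / 6) ^ t₁) := by
  have hX := isLazyReversible hn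
  obtain ⟨hq0, hq1⟩ := survival_bounds hn
  have hm : 1 ≤ 1 + x * (1 + x) / 6 := by
    have : 0 ≤ x * (1 + x) / 6 := by positivity
    linarith
  set b := mk n n (by omega) with hb
  set q := survival n with hq
  set m := 1 + x * (1 + x) / 6 with hmdef
  let U : ℕ → ℝ := fun t => 1 - q ^ t + (1 - q) * 1769472 + 73730 * (((1 + x)⁻¹) ^ n * m ^ t)
  have hU : ∀ t, (chain n).density t (centre n) b ≤ U t := fun t => by
    rw [hX.density_symm]
    exact density_right_end_le hn hx hx4 t
  have hUmono : ∀ s t, s ≤ t → U s ≤ U t := fun s t hst => by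
    have h1 : q ^ t ≤ q ^ s := pow_le_pow_of_le_one (by linarith) hq1.le hst
    have h2 : m ^ s ≤ m ^ t := pow_le_pow_right₀ hm hst
    have h3 : ((1 + x)⁻¹) ^ n * m ^ s ≤ ((1 + x)⁻¹) ^ n * m ^ t :=
      mul_le_mul_of_nonneg_left h2 (by positivity)
    simp only [U]
    linarith
  have hU0 : ∀ t, 0 ≤ U t := fun t => (hX.density_nonneg t _ _).trans (hU t)
  have hinv : ∀ t y, (chain n).density t y b ≤ ((chain n).stat b)⁻¹ := fun t y =>
    hX.density_le_inv t y b
  -- The maximum principle on the left side: up to time t₂ the centre never exceeds U t₂, so neither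
  -- does any state to its left.
  have stage1 : ∀ y : (chain n).State, pos y ≤ 0 → (chain n).density t₂ y b ≤ U t₂ := by
    let F : ℤ → ℝ := fun j => if j ≤ 0 then U t₂ else ((chain n).stat b)⁻¹
    have hF : ∀ j ≤ 0, F j = U t₂ := fun j hj => if_pos hj
    have h := le_of_subsolution hX.P_nonneg (v := fun t y => (chain n).density t y b)
      (W := fun _ y => F (pos y)) {y | pos y < 0} t₂ (fun y => ?_) (fun t ht y hy => ?_)
      (fun t _ y _ => ?_) (fun t _ y hy => ?_) t₂ le_rfl
    · intro y hy
      have := h y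
      rwa [hF _ hy] at this
    · rcases le_or_gt (pos y) 0 with h | h
      · rw [hF _ h, hX.density_zero]
        · exact hU0 t₂
        · intro e
          rw [e, hb, pos_mk] at h
          omega
      · simp only [F, if_neg (not_le.2 h)]
        exact hinv 0 y
    · have hy' : ¬ pos y < 0 := hy
      rcases lt_or_eq_of_le (not_lt.1 hy') with h | h
      · simp only [F, if_neg (not_le.2 h)]
        exact hinv t y
      · have : y = centre n := pos_injective h.symm
        subst this
        rw [hF _ (by rw [pos_centre])]
        exact (hU t).trans (hUmono t t₂ ht)
    · rw [hX.density_succ]; exact le_rfl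
    · have hy' : pos y < 0 := hy
      change (chain n).step (fun w => F (pos w)) y ≤ _
      rcases step_cases hy'.ne with ⟨k, hk1, hk, h⟩ | h | ⟨k, hk1, hk, h⟩ | h
      · rw [step_neg hk1 hk h, hF _ (by omega), hF _ (by omega), hF _ (by omega)]; linarith
      · rw [step_neg_end hn h, hF _ (by omega), hF _ (by omega)]; linarith
      · omega
      · omega
  -- During the further t₁ steps a walk from the left either has not met the centre, and then sees
  -- at most U t₂, or it has, where the density is at most 192; the profile bounds the latter event.
  let F : ℕ → ℤ → ℝ := fun t j =>
    if j ≤ 0 then U t₂ + 192 * segmentProfile n x j.natAbs * m ^ t else ((chain n).stat b)⁻¹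
  have hF : ∀ t, ∀ j ≤ 0, F t j = U t₂ + 192 * segmentProfile n x j.natAbs * m ^ t :=
    fun t j hj => if_pos hj
  have hprof : ∀ t k, 0 ≤ 192 * segmentProfile n x k * m ^ t := fun t k =>
    mul_nonneg (mul_nonneg (by norm_num) (segmentProfile_nonneg hx n k)) (by positivity)
  have h := le_of_subsolution hX.P_nonneg (v := fun t y => (chain n).density (t₂ + t) y b)
    (W := fun t y => F t (pos y)) {y | pos y < 0} t₁ (fun y => ?_) (fun t ht y hy => ?_)
    (fun t _ y _ => ?_) (fun t _ y hy => ?_) t₁ le_rfl (mk n (-(n : ℤ)) (by omega))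
  · simp only [pos_mk] at h
    rw [hF t₁ _ (by omega), Int.natAbs_neg, Int.natAbs_natCast] at h
    have h1 := mul_le_mul_of_nonneg_right (segmentProfile_end_le hx n hx4)
      (show 0 ≤ m ^ t₁ by positivity)
    simp only [U] at h
    linarith
  · rcases le_or_gt (pos y) 0 with h | h
    · rw [hF 0 _ h, Nat.add_zero]
      linarith [stage1 y h, hprof 0 (pos y).natAbs]
    · simp only [F, if_neg (not_le.2 h)]
      exact hinv _ y
  · have hy' : ¬ pos y < 0 := hy
    rcases lt_or_eq_of_le (not_lt.1 hy') with h | h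
    · simp only [F, if_neg (not_le.2 h)]
      exact hinv _ y
    · have : y = centre n := pos_injective h.symm
      subst this
      rw [hF t _ (by rw [pos_centre]), hX.density_symm, pos_centre]
      have h1 : 1 ≤ segmentProfile n x 0 * m ^ t :=
        one_le_mul_of_one_le_of_one_le (one_le_segmentProfile_zero hx n) (one_le_pow₀ hm)
      have h2 := density_centre_le hn (t₂ + t) b
      have h3 := hU0 t₂
      simp only [Int.natAbs_zero]
      linarith
  · rw [← add_assoc, hX.density_succ]; exact le_rfl
  · have hy' : pos y < 0 := hy
    have h1 : (chain n).step (fun w => F t (pos w)) y =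
        U t₂ + (chain n).step (fun w => (192 * m ^ t) * segmentProfile n x (pos w).natAbs) y := by
      let G : ℤ → ℝ := fun j => (192 * m ^ t) * segmentProfile n x j.natAbs
      have hFG : ∀ j ≤ 0, F t j = U t₂ + G j := fun j hj => by
        rw [hF t j hj]; simp only [G]; ring
      change _ = U t₂ + (chain n).step (fun w => G (pos w)) y
      rcases step_cases hy'.ne with ⟨k, hk1, hk, h⟩ | h | ⟨k, hk1, hk, h⟩ | h
      · rw [step_neg hk1 hk h, step_neg hk1 hk h, hFG _ (by omega), hFG _ (by omega),
          hFG _ (by omega)]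
        ring
      · rw [step_neg_end hn h, step_neg_end hn h, hFG _ (by omega), hFG _ (by omega)]; ring
      · omega
      · omega
    have h2 := step_left_profile hn hx (c := 192 * m ^ t) (by positivity)
      (fun j => (192 * m ^ t) * segmentProfile n x j.natAbs) (fun j _ => rfl) hy'
    change (chain n).step (fun w => F t (pos w)) y ≤ _
    rw [← hmdef] at h2
    rw [h1, hF (t + 1) _ hy'.le, pow_succ]
    linarith

end Fixed

theorem tendsto_survival : Tendsto survival atTop (𝓝 1) := by
  have : Tendsto (fun n : ℕ => 1 - 1 / (2 * (n : ℝ))) atTop (𝓝 (1 - 0)) :=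
    (tendsto_const_nhds.div_atTop
      (tendsto_natCast_atTop_atTop.const_mul_atTop (by norm_num))).const_sub 1
  rw [sub_zero] at this
  exact this

theorem tendsto_survival_pow {s : ℝ} (hs : 0 ≤ s) :
    Tendsto (fun n : ℕ => survival n ^ ⌊s * n⌋₊) atTop (𝓝 (Real.exp (-s / 2))) := by
  have h1 : Tendsto (fun n : ℕ => survival n ^ n) atTop (𝓝 (Real.exp (-1 / 2))) := by
    refine (Real.tendsto_one_add_div_pow_exp (-1 / 2)).congr fun n => ?_
    congr 1
    rw [survival]
    rcases Nat.eq_zero_or_pos n with h | h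
    · subst h; simp
    · have : (n : ℝ) ≠ 0 := by positivity
      field_simp
      ring
  have h2 := tendsto_survival
  have h3 : Tendsto (fun n : ℕ => (survival n ^ n) ^ s) atTop (𝓝 (Real.exp (-s / 2))) := by
    have := h1.rpow_const (p := s) (Or.inl (Real.exp_pos _).ne')
    rwa [← Real.exp_mul, show -1 / 2 * s = -s / 2 by ring] at this
  have h4 : Tendsto (fun n : ℕ => (survival n ^ n) ^ s * (survival n)⁻¹) atTop
      (𝓝 (Real.exp (-s / 2))) := by
    simpa using h3.mul (h2.inv₀ one_ne_zero)
  refine tendsto_of_tendsto_of_tendsto_of_le_of_le' h3 h4 ?_ ?_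
  all_goals
    filter_upwards [eventually_ge_atTop 2] with n hn
    obtain ⟨hq0, hq1⟩ := survival_bounds hn
    have hq : 0 < survival n := by linarith
    rw [← Real.rpow_natCast (survival n) n, ← Real.rpow_mul hq.le,
      ← Real.rpow_natCast (survival n) ⌊s * n⌋₊]
  · refine Real.rpow_le_rpow_of_exponent_ge hq hq1.le ?_
    rw [mul_comm]
    exact Nat.floor_le (by positivity)
  · rw [← Real.rpow_neg_one, ← Real.rpow_add hq]
    refine Real.rpow_le_rpow_of_exponent_ge hq hq1.le ?_
    linarith [Nat.lt_floor_add_one (s * n)]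

/-- The exponential rate on the left side which matches the killing rate on the right side. -/
noncomputable def matchingRate (n : ℕ) : ℝ := 3 / (n : ℝ) + 36 / (n : ℝ) ^ 2

theorem tendsto_matchingRate_pow :
    Tendsto (fun n : ℕ => (1 + matchingRate n) ^ n) atTop (𝓝 (Real.exp 3)) := by
  refine Real.tendsto_one_add_pow_exp_of_tendsto ?_
  have h : Tendsto (fun n : ℕ => 3 + 36 / (n : ℝ)) atTop (𝓝 (3 + 0)) :=
    (tendsto_const_nhds.div_atTop tendsto_natCast_atTop_atTop).const_add 3
  rw [add_zero] at h
  refine h.congr' ?_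
  filter_upwards [eventually_gt_atTop 0] with n hn
  have : (n : ℝ) ≠ 0 := by positivity
  rw [matchingRate]
  field_simp

/-- To leading order r = 3/n gives r/6 = 1/(2n). The term 36/n² adds 6/n², which pays for the loss
r²/3, of order 3/n², once n is large. -/
theorem matchingRate_le {n : ℕ} (hn : 30 ≤ n) :
    1 - matchingRate n * (1 - 2 * matchingRate n) / 6 ≤ survival n := by
  have hn' : (30 : ℝ) ≤ n := by exact_mod_cast hn
  have hp : (0 : ℝ) < n := by linarith
  have e : matchingRate n * (1 - 2 * matchingRate n) / 6 - 1 / (2 * (n : ℝ)) =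
      (18 * (n : ℝ) ^ 2 - 432 * n - 2592) / (6 * (n : ℝ) ^ 4) := by
    rw [matchingRate]
    field_simp
    ring
  have h : 0 ≤ (18 * (n : ℝ) ^ 2 - 432 * n - 2592) / (6 * (n : ℝ) ^ 4) :=
    div_nonneg (by nlinarith) (by positivity)
  rw [survival]
  linarith

/-- The pairs with a state on the right give e^3 · e^(-s/2) in the limit; the pairs on the left
vanish at every speed above 6. -/
theorem eventually_sepDist_lt {s a : ℝ} (hs : 6 < s) (ha : Real.exp (-(s - 6) / 2) < a) :
    ∀ᶠ n : ℕ in atTop, (chain n).sepDist ⌊s * n⌋₊ < a := by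
  obtain ⟨x, hx0, hx4, hl0, hl1, hlim⟩ := exists_upper_rate (c := 6) (by norm_num) hs
  have h := (tendsto_matchingRate_pow.mul (tendsto_survival_pow (s := s) (by linarith))).add hlim
  rw [← Real.exp_add, add_zero, show 3 + -s / 2 = -(s - 6) / 2 by ring] at h
  filter_upwards [h.eventually (eventually_lt_nhds ha), eventually_ge_atTop 30] with n h1 hn
  have hr : 0 ≤ matchingRate n := by rw [matchingRate]; positivity
  exact (sepDist_le_add (by omega) hr (matchingRate_le hn) hx0.le hx4 _).trans_lt h1

theorem eventually_lt_sepDist {s a : ℝ} (hs : 6 ≤ s) (hs' : s < 12)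
    (ha : a < Real.exp (-(s - 6) / 2)) :
    ∀ᶠ n : ℕ in atTop, a < (chain n).sepDist ⌊s * n⌋₊ := by
  have hcont : Tendsto (fun δ : ℝ => Real.exp (-(s - 6 + 2 * δ) / 2)) (𝓝[>] 0)
      (𝓝 (Real.exp (-(s - 6 + 2 * 0) / 2))) :=
    tendsto_nhdsWithin_of_tendsto_nhds
      (Continuous.tendsto (by fun_prop) 0)
  rw [mul_zero, add_zero] at hcont
  -- The time is split as t₁ ≈ (6-δ)n for the left arm and t₂ ≈ (s-6+2δ)n for the killing. Both
  -- speeds must stay below 6, hence δ < (12-s)/2, and the spare δn ≥ 2 covers the two floors.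
  obtain ⟨δ, ⟨hδa, hδ1⟩, hδ0⟩ : ∃ δ : ℝ, (a < Real.exp (-(s - 6 + 2 * δ) / 2) ∧
      δ < (12 - s) / 2) ∧ 0 < δ :=
    (((hcont.eventually (eventually_gt_nhds ha)).and
      (nhdsWithin_le_nhds (eventually_lt_nhds (by linarith)))).and
        self_mem_nhdsWithin).exists
  set v := max (s - 6 + 2 * δ) (6 - δ) with hv
  have hv1 : s - 6 + 2 * δ ≤ v := le_max_left _ _
  have hv2 : 6 - δ ≤ v := le_max_right _ _
  obtain ⟨x, hx0, hx4, hlim⟩ := exists_lower_rate (c := 6) (s := v) (by norm_num)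
    (by linarith) (max_lt (by linarith) (by linarith))
  have h := ((tendsto_survival_pow (s := s - 6 + 2 * δ) (by linarith)).sub
    ((tendsto_survival.const_sub 1).mul_const 1769472)).sub (hlim.const_mul 74114)
  rw [sub_self, zero_mul, mul_zero, sub_zero, sub_zero] at h
  have hδn : ∀ᶠ n : ℕ in atTop, 2 ≤ δ * n :=
    (tendsto_natCast_atTop_atTop.const_mul_atTop hδ0).eventually_ge_atTop 2
  filter_upwards [h.eventually (eventually_gt_nhds hδa), eventually_ge_atTop 2, hδn] with n h1 hn h2
  have hX := isLazyReversible hn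
  have hm : 1 ≤ 1 + x * (1 + x) / 6 := by
    have : 0 ≤ x * (1 + x) / 6 := by positivity
    linarith
  set t₁ := ⌊(6 - δ) * n⌋₊ with ht1
  set t₂ := ⌊(s - 6 + 2 * δ) * n⌋₊ with ht2
  have hle : ⌊s * n⌋₊ ≤ t₂ + t₁ := by
    have a1 := Nat.lt_floor_add_one ((6 - δ) * (n : ℝ))
    have a2 := Nat.lt_floor_add_one ((s - 6 + 2 * δ) * (n : ℝ))
    rw [← ht1] at a1
    rw [← ht2] at a2
    refine Nat.floor_le_of_le ?_
    push_cast
    linarith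
  have hmono : ∀ c : ℝ, c ≤ v → ((1 + x)⁻¹) ^ n * (1 + x * (1 + x) / 6) ^ ⌊c * n⌋₊ ≤
      ((1 + x)⁻¹) ^ n * (1 + x * (1 + x) / 6) ^ ⌊v * n⌋₊ := fun c hc =>
    mul_le_mul_of_nonneg_left (pow_le_pow_right₀ hm
      (Nat.floor_le_floor (mul_le_mul_of_nonneg_right hc (by positivity)))) (by positivity)
  have e1 := hmono _ hv2
  have e2 := hmono _ hv1
  have e3 := density_ends_le hn hx0.le hx4 t₁ t₂
  have e4 := hX.one_sub_density_le_sepDist (t₂ + t₁) (mk n (-(n : ℤ)) (by omega))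
    (mk n n (by omega))
  have e5 := hX.sepDist_antitone hle
  linarith

theorem tendsto_sepDist_exp {s : ℝ} (hs : 6 ≤ s) (hs' : s < 12) :
    Tendsto (fun n : ℕ => (chain n).sepDist ⌊s * n⌋₊) atTop (𝓝 (Real.exp (-(s - 6) / 2))) := by
  refine tendsto_order.2 ⟨fun a ha => eventually_lt_sepDist hs hs' ha, fun a ha => ?_⟩
  rcases hs.lt_or_eq with h | h
  · exact eventually_sepDist_lt h ha
  · subst h
    norm_num at ha
    filter_upwards [eventually_ge_atTop 2] with n hn
    exact ((isLazyReversible hn).sepDist_le_one _).trans_lt ha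

theorem tendsto_sepDist_one {s : ℝ} (hs : s ≤ 6) :
    Tendsto (fun n : ℕ => (chain n).sepDist ⌊s * n⌋₊) atTop (𝓝 1) := by
  have h6 := tendsto_sepDist_exp (s := 6) le_rfl (by norm_num)
  norm_num at h6
  refine tendsto_of_tendsto_of_tendsto_of_le_of_le' h6 tendsto_const_nhds ?_ ?_
  · filter_upwards [eventually_ge_atTop 2] with n hn
    exact (isLazyReversible hn).sepDist_antitone (Nat.floor_le_floor (by gcongr))
  · filter_upwards [eventually_ge_atTop 2] with n hn
    exact (isLazyReversible hn).sepDist_le_one _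

theorem sepRatio_eq_two_and_not_sepCutoff : sepRatio chain = 2 ∧ ¬ SepCutoff chain :=
  precutoffRatioOf_eq_two (D := fun n => (chain n).sepDist) (by norm_num : (0 : ℝ) < 6)
    antitone_sepDist (fun s _ hs => tendsto_sepDist_one hs.le)
    (fun s hs => tendsto_sepDist_zero (by linarith))
    (fun s hs hs' => ⟨Real.exp (-(s - 6) / 2) / 2, by positivity,
      eventually_lt_sepDist hs.le (by linarith) (by linarith [Real.exp_pos (-(s - 6) / 2)])⟩)
    (fun s hs _ => by
      have h1 : Real.exp (-(s - 6) / 2) < 1 := Real.exp_lt_one_iff.2 (by linarith)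
      obtain ⟨b, hb, hb1⟩ := exists_between h1
      exact ⟨b, hb1, (eventually_sepDist_lt hs hb).mono fun n hn => hn.le⟩)

end KilledSegment

/-! A network with separation cutoff and no total-variation cutoff. The positions are the integers
in `[-N, 2N + 1]`. The arms `[0, N]` and `[-N, 0]` and the trunk `[N + 1, 2N + 1]` are segments with
a very strong drift towards `0` and `N + 1` respectively; from the bottom `N + 1` of the trunk the
walk goes to `0` or to one of the two ends `N` and `-N` of the arms, with equal probabilities. -/

/-! ### The second network: conductances and one-step formulas. -/

namespace TrunkNetwork

open FiniteChain

/-- The states of the network. -/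
abbrev Pos (N : ℕ) : Type := Finset.Icc (-(N : ℤ)) (2 * N + 1)

/-- The exponent which gives the size of the conductances at a position. -/
def rank (N : ℕ) (i : ℤ) : ℕ := if i.natAbs ≤ N then i.natAbs else i.natAbs + N

/-- The ratio of consecutive conductances. -/
noncomputable def scale (N : ℕ) : ℝ := (1 / 2) ^ (20 * (N + 1))

/-- The conductances. -/
noncomputable def weight (N : ℕ) (i j : ℤ) : ℝ :=
  if j = i + 1 ∨ i = j + 1 ∨ (i = N + 1 ∧ (j = 0 ∨ j = -N)) ∨ (j = N + 1 ∧ (i = 0 ∨ i = -N)) then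
    scale N ^ max (rank N i) (rank N j) else 0

/-- The lazy random walk on the network. -/
noncomputable def chain (N : ℕ) : FiniteChain := network (Pos N) (fun x y => weight N x y)

/-- The position of a state. -/
def pos {N : ℕ} (x : (chain N).State) : ℤ :=
  Subtype.val (p := fun i => i ∈ Finset.Icc (-(N : ℤ)) (2 * N + 1)) x

/-- The state at a given position. -/
def mk (N : ℕ) (i : ℤ) (h : -(N : ℤ) ≤ i ∧ i ≤ 2 * N + 1) : (chain N).State :=
  (⟨i, Finset.mem_Icc.2 h⟩ : Pos N)

theorem pos_mk (N : ℕ) (i : ℤ) (h : -(N : ℤ) ≤ i ∧ i ≤ 2 * N + 1) : pos (mk N i h) = i := rfl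

theorem pos_mem {N : ℕ} (x : (chain N).State) : -(N : ℤ) ≤ pos x ∧ pos x ≤ 2 * N + 1 :=
  Finset.mem_Icc.1 (Subtype.property (p := fun i => i ∈ Finset.Icc (-(N : ℤ)) (2 * N + 1)) x)

theorem pos_injective {N : ℕ} {x y : (chain N).State} (h : pos x = pos y) : x = y :=
  Subtype.ext h

/-- The common base of the two arms. -/
def centre (N : ℕ) : (chain N).State := mk N 0 (by omega)

theorem pos_centre (N : ℕ) : pos (centre N) = 0 := rfl

theorem pos_ne_zero {N : ℕ} {x : (chain N).State} (h : x ≠ centre N) : pos x ≠ 0 :=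
  fun h0 => h (pos_injective h0)

theorem scale_pos (N : ℕ) : 0 < scale N := by rw [scale]; positivity

theorem scale_le {N : ℕ} (hN : 1 ≤ N) : scale N ≤ 1 / 1000 := by
  rw [scale]
  calc (1 / 2 : ℝ) ^ (20 * (N + 1)) ≤ (1 / 2) ^ 10 :=
        pow_le_pow_of_le_one (by norm_num) (by norm_num) (by omega)
    _ ≤ _ := by norm_num

theorem weight_diag (N : ℕ) (i : ℤ) : weight N i i = 0 := by
  rw [weight, if_neg (by omega)]

theorem weight_symm (N : ℕ) (i j : ℤ) : weight N i j = weight N j i := by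
  rw [weight, weight, max_comm]
  exact if_congr (by omega) rfl rfl

theorem weight_nonneg (N : ℕ) (i j : ℤ) : 0 ≤ weight N i j := by
  have := scale_pos N
  rw [weight]; split_ifs <;> positivity

theorem weight_eq_zero {N : ℕ} {i j : ℤ} (h : ¬ (j = i + 1 ∨ i = j + 1 ∨
    (i = N + 1 ∧ (j = 0 ∨ j = -N)) ∨ (j = N + 1 ∧ (i = 0 ∨ i = -N)))) : weight N i j = 0 :=
  if_neg h

theorem weight_eq {N : ℕ} {i j : ℤ} (k : ℕ) (h : j = i + 1 ∨ i = j + 1 ∨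
    (i = N + 1 ∧ (j = 0 ∨ j = -N)) ∨ (j = N + 1 ∧ (i = 0 ∨ i = -N)))
    (hk : max (rank N i) (rank N j) = k) : weight N i j = scale N ^ k := by
  rw [weight, if_pos h, hk]

theorem isLazyReversible (N : ℕ) : (chain N).IsLazyReversible := by
  have hq := scale_pos N
  refine network_isLazyReversible (fun x y => weight_symm N x y) (fun x y => weight_nonneg N x y)
    (fun x => weight_diag N x) (⟨0, by simp; omega⟩ : Pos N) ⟨⟨1, by rw [Finset.mem_Icc]; omega⟩, ?_⟩
    (fun x => (x : ℤ).natAbs) (fun x hx => ?_)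
  · simp only
    rw [weight_eq _ (by omega) rfl]
    positivity
  · obtain ⟨i, hi⟩ := x
    have hi' := Finset.mem_Icc.1 hi
    have h0 : i ≠ 0 := fun h => hx (Subtype.ext h)
    rcases lt_or_gt_of_ne h0 with h | h
    · refine ⟨⟨i + 1, Finset.mem_Icc.2 (by omega)⟩, by simp only; omega, ?_⟩
      simp only
      rw [weight_eq _ (by omega) rfl]
      positivity
    · refine ⟨⟨i - 1, Finset.mem_Icc.2 (by omega)⟩, by simp only; omega, ?_⟩
      simp only
      rw [weight_eq _ (by omega) rfl]
      positivity

/-- The conductance-weighted sum of a function over the neighbours of a position. -/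
noncomputable def netSum (N : ℕ) (i : ℤ) (F : ℤ → ℝ) : ℝ := ∑ y : Pos N, weight N i y * F y

theorem sum_pos (N : ℕ) (f : ℤ → ℝ) :
    ∑ y : Pos N, f y = ∑ j ∈ Finset.Icc (-(N : ℤ)) (2 * N + 1), f j :=
  Finset.sum_coe_sort (Finset.Icc (-(N : ℤ)) (2 * N + 1)) f

theorem netSum_eq_sum (N : ℕ) (i : ℤ) (F : ℤ → ℝ) (S : Finset ℤ)
    (hS : ∀ j ∈ S, -(N : ℤ) ≤ j ∧ j ≤ 2 * N + 1)
    (h : ∀ j : ℤ, -(N : ℤ) ≤ j → j ≤ 2 * N + 1 → j ∉ S → weight N i j = 0) :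
    netSum N i F = ∑ j ∈ S, weight N i j * F j := by
  rw [netSum, sum_pos N (fun j => weight N i j * F j)]
  refine (Finset.sum_subset (fun j hj => Finset.mem_Icc.2 (hS j hj)) fun j hj hj' => ?_).symm
  have := Finset.mem_Icc.1 hj
  rw [h j this.1 this.2 hj', zero_mul]

theorem netSum_pair {N : ℕ} {i a b : ℤ} (F : ℤ → ℝ) (hab : a ≠ b)
    (ha : -(N : ℤ) ≤ a ∧ a ≤ 2 * N + 1) (hb : -(N : ℤ) ≤ b ∧ b ≤ 2 * N + 1)
    (h : ∀ j : ℤ, -(N : ℤ) ≤ j → j ≤ 2 * N + 1 → j ≠ a → j ≠ b → weight N i j = 0) :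
    netSum N i F = weight N i a * F a + weight N i b * F b := by
  rw [netSum_eq_sum N i F {a, b} (fun j hj => ?_) (fun j h1 h2 h3 => ?_), Finset.sum_pair hab]
  · rcases Finset.mem_insert.1 hj with rfl | hj
    · exact ha
    · rwa [Finset.mem_singleton.1 hj]
  · simp only [Finset.mem_insert, Finset.mem_singleton, not_or] at h3
    exact h j h1 h2 h3.1 h3.2

theorem step_eq {N : ℕ} (F : ℤ → ℝ) (x : (chain N).State) :
    (chain N).step (fun y => F (pos y)) x = 1 / 2 * F (pos x) +
      netSum N (pos x) F / (2 * netSum N (pos x) fun _ => 1) := by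
  simp only [netSum, mul_one]
  exact network_step (V := Pos N) (w := fun x y => weight N x y) (fun x => weight_diag N x)
    (fun y => F y) x

theorem stat_eq {N : ℕ} (x : (chain N).State) :
    (chain N).stat x = (netSum N (pos x) fun _ => 1) / ∑ y : Pos N, netSum N y fun _ => 1 := by
  simp only [netSum, mul_one]
  rfl

/-- At a state with two incident conductances the walk takes the weaker edge with relative
probability β at most the ratio of the two; only this bound on β is used later. -/
theorem sum_weights_eq {q : ℝ} (hq : 0 < q) {a b : ℕ} (hab : a < b) :
    ∃ β : ℝ, 0 ≤ β ∧ β ≤ q ^ (b - a) ∧ ∀ u v : ℝ,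
      (q ^ a * u + q ^ b * v) / (2 * (q ^ a * 1 + q ^ b * 1)) = 1 / 2 * ((1 - β) * u + β * v) := by
  have ha : 0 < q ^ a := by positivity
  have hb : q ^ b = q ^ a * q ^ (b - a) := by rw [← pow_add]; congr 1; omega
  have hc : 0 < q ^ (b - a) := by positivity
  refine ⟨q ^ (b - a) / (1 + q ^ (b - a)), by positivity, ?_, fun u v => ?_⟩
  · rw [div_le_iff₀ (by positivity)]
    nlinarith
  · rw [hb]
    field_simp
    ring

section Steps

variable {N : ℕ} (hN : 1 ≤ N)
include hN

theorem scale_pow_le {k : ℕ} (hk : 1 ≤ k) : scale N ^ k ≤ scale N :=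
  pow_le_of_le_one (scale_pos N).le ((scale_le hN).trans (by norm_num)) (by omega)

theorem step_pos {x : (chain N).State} (hx : 0 < pos x) (hx' : pos x ≠ N + 1) :
    ∃ β : ℝ, 0 ≤ β ∧ β ≤ scale N ∧ (pos x = N → β ≤ scale N ^ (N + 1)) ∧ ∀ F : ℤ → ℝ,
      (chain N).step (fun y => F (pos y)) x =
        1 / 2 * F (pos x) + 1 / 2 * ((1 - β) * F (pos x - 1) + β * F (pos x + 1)) := by
  have hq := scale_pos N
  have hq1 : scale N ≤ 1 := (scale_le hN).trans (by norm_num)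
  have hm := pos_mem x
  by_cases hend : pos x = 2 * N + 1
  · refine ⟨0, le_rfl, hq.le, fun h => by omega, fun F => ?_⟩
    have h : ∀ F : ℤ → ℝ, netSum N (pos x) F = weight N (pos x) (pos x - 1) * F (pos x - 1) :=
      fun F => by
        rw [netSum_eq_sum N _ F {pos x - 1} (fun j hj => ?_) (fun j h1 h2 h3 => ?_),
          Finset.sum_singleton]
        · rw [Finset.mem_singleton.1 hj]; omega
        · rw [Finset.mem_singleton] at h3
          exact weight_eq_zero (by omega)
    rw [step_eq, h, h, weight_eq _ (by omega) rfl]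
    have : scale N ^ max (rank N (pos x)) (rank N (pos x - 1)) ≠ 0 := by positivity
    field_simp
    ring
  · have h : ∀ F : ℤ → ℝ, netSum N (pos x) F = weight N (pos x) (pos x - 1) * F (pos x - 1) +
        weight N (pos x) (pos x + 1) * F (pos x + 1) := fun F =>
      netSum_pair F (by omega) (by omega) (by omega) fun j h1 h2 h3 h4 => weight_eq_zero (by omega)
    obtain ⟨β, h0, h1, h2⟩ := sum_weights_eq hq
      (show rank N (pos x) < rank N (pos x + 1) by simp only [rank]; split_ifs <;> omega)
    refine ⟨β, h0, h1.trans (scale_pow_le hN (by simp only [rank]; split_ifs <;> omega)),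
      fun he => h1.trans (le_of_eq ?_), fun F => ?_⟩
    · congr 1
      simp only [rank]; split_ifs <;> omega
    · rw [step_eq, h, h, weight_eq (rank N (pos x)) (by omega)
        (by simp only [rank]; split_ifs <;> omega), weight_eq (rank N (pos x + 1)) (by omega)
        (by simp only [rank]; split_ifs <;> omega), h2]

theorem step_neg {x : (chain N).State} (hx : pos x < 0) (hx' : -(N : ℤ) < pos x) :
    ∃ β : ℝ, 0 ≤ β ∧ β ≤ scale N ∧ ∀ F : ℤ → ℝ,
      (chain N).step (fun y => F (pos y)) x =
        1 / 2 * F (pos x) + 1 / 2 * ((1 - β) * F (pos x + 1) + β * F (pos x - 1)) := by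
  have hq := scale_pos N
  have hq1 : scale N ≤ 1 := (scale_le hN).trans (by norm_num)
  have h : ∀ F : ℤ → ℝ, netSum N (pos x) F = weight N (pos x) (pos x + 1) * F (pos x + 1) +
      weight N (pos x) (pos x - 1) * F (pos x - 1) := fun F =>
    netSum_pair F (by omega) (by omega) (by omega) fun j h1 h2 h3 h4 => weight_eq_zero (by omega)
  obtain ⟨β, h0, h1, h2⟩ := sum_weights_eq hq
    (show rank N (pos x) < rank N (pos x - 1) by simp only [rank]; split_ifs <;> omega)
  refine ⟨β, h0, h1.trans (scale_pow_le hN (by simp only [rank]; split_ifs <;> omega)), fun F => ?_⟩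
  rw [step_eq, h, h, weight_eq (rank N (pos x)) (by omega)
    (by simp only [rank]; split_ifs <;> omega), weight_eq (rank N (pos x - 1)) (by omega)
    (by simp only [rank]; split_ifs <;> omega), h2]

theorem step_neg_end {x : (chain N).State} (hx : pos x = -(N : ℤ)) :
    ∃ β : ℝ, 0 ≤ β ∧ β ≤ scale N ^ (N + 1) ∧ ∀ F : ℤ → ℝ,
      (chain N).step (fun y => F (pos y)) x =
        1 / 2 * F (pos x) + 1 / 2 * ((1 - β) * F (pos x + 1) + β * F (N + 1)) := by
  have hq := scale_pos N
  have hq1 : scale N ≤ 1 := (scale_le hN).trans (by norm_num)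
  have h : ∀ F : ℤ → ℝ, netSum N (pos x) F = weight N (pos x) (pos x + 1) * F (pos x + 1) +
      weight N (pos x) (N + 1) * F (N + 1) := fun F =>
    netSum_pair F (by omega) (by omega) (by omega) fun j h1 h2 h3 h4 => weight_eq_zero (by omega)
  obtain ⟨β, h0, h1, h2⟩ := sum_weights_eq hq (show N < 2 * N + 1 by omega)
  refine ⟨β, h0, h1.trans (le_of_eq (by congr 1; omega)), fun F => ?_⟩
  rw [step_eq, h, h, weight_eq N (by omega)
    (by simp only [rank]; split_ifs <;> omega), weight_eq (2 * N + 1) (by omega)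
    (by simp only [rank]; split_ifs <;> omega), h2]

theorem netSum_trunk (F : ℤ → ℝ) : netSum N (N + 1) F =
    scale N ^ (2 * N + 1) * (F 0 + F N + F (-N)) + scale N ^ (2 * N + 2) * F (N + 2) := by
  rw [netSum_eq_sum N _ F {0, (N : ℤ), -(N : ℤ), (N : ℤ) + 2} (fun j hj => ?_)
    (fun j h1 h2 h3 => ?_), Finset.sum_insert, Finset.sum_insert, Finset.sum_pair (by omega),
    weight_eq (2 * N + 1) (by omega) (by simp only [rank]; split_ifs <;> omega),
    weight_eq (2 * N + 1) (by omega) (by simp only [rank]; split_ifs <;> omega),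
    weight_eq (2 * N + 1) (by omega) (by simp only [rank]; split_ifs <;> omega),
    weight_eq (2 * N + 2) (by omega) (by simp only [rank]; split_ifs <;> omega)]
  · ring
  · simp only [Finset.mem_insert, Finset.mem_singleton]; omega
  · simp only [Finset.mem_insert, Finset.mem_singleton]; omega
  · simp only [Finset.mem_insert, Finset.mem_singleton] at hj; omega
  · simp only [Finset.mem_insert, Finset.mem_singleton] at h3
    exact weight_eq_zero (by omega)

theorem step_trunk {x : (chain N).State} (hx : pos x = N + 1) :
    ∃ β : ℝ, 0 ≤ β ∧ β ≤ scale N ∧ ∀ F : ℤ → ℝ,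
      (chain N).step (fun y => F (pos y)) x =
        1 / 2 * F (pos x) + 1 / 2 * ((1 - β) / 3 * (F 0 + F N + F (-N)) + β * F (N + 2)) := by
  have hq := scale_pos N
  refine ⟨scale N / (3 + scale N), by positivity, ?_, fun F => ?_⟩
  · rw [div_le_iff₀ (by positivity)]
    nlinarith
  · rw [step_eq, hx, netSum_trunk hN, netSum_trunk hN, pow_succ (scale N) (2 * N + 1)]
    have : scale N ^ (2 * N + 1) ≠ 0 := by positivity
    field_simp
    ring

theorem netSum_centre (F : ℤ → ℝ) : netSum N 0 F =
    scale N * F 1 + scale N * F (-1) + scale N ^ (2 * N + 1) * F (N + 1) := by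
  rw [netSum_eq_sum N _ F {1, -1, (N : ℤ) + 1} (fun j hj => ?_)
    (fun j h1 h2 h3 => ?_), Finset.sum_insert, Finset.sum_pair (by omega),
    weight_eq 1 (by omega) (by simp only [rank]; split_ifs <;> omega),
    weight_eq 1 (by omega) (by simp only [rank]; split_ifs <;> omega),
    weight_eq (2 * N + 1) (by omega) (by simp only [rank]; split_ifs <;> omega)]
  · ring
  · simp only [Finset.mem_insert, Finset.mem_singleton]; omega
  · simp only [Finset.mem_insert, Finset.mem_singleton] at hj; omega
  · simp only [Finset.mem_insert, Finset.mem_singleton] at h3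
    exact weight_eq_zero (by omega)

/-- Bounds on the total conductances. -/
theorem netSum_one_bounds {i : ℤ} (hi : -(N : ℤ) ≤ i ∧ i ≤ 2 * N + 1) (h0 : i ≠ 0) :
    scale N ^ rank N i ≤ netSum N i (fun _ => 1) ∧
      netSum N i (fun _ => 1) ≤ scale N ^ rank N i + 3 * scale N ^ 2 := by
  have hq := scale_pos N
  have hq1 : scale N ≤ 1 := (scale_le hN).trans (by norm_num)
  have hle : ∀ k : ℕ, 2 ≤ k → scale N ^ k ≤ scale N ^ 2 := fun k hk =>
    pow_le_pow_of_le_one hq.le hq1 hk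
  have hp : ∀ k : ℕ, 0 ≤ scale N ^ k := fun k => by positivity
  by_cases ht : i = N + 1
  · rw [ht, netSum_trunk hN, show rank N (N + 1) = 2 * N + 1 by simp only [rank]; split_ifs <;> omega]
    constructor
    · linarith [hp (2 * N + 1), hp (2 * N + 2)]
    · linarith [hle (2 * N + 1) (by omega), hle (2 * N + 2) (by omega)]
  by_cases hend : i = 2 * N + 1
  · rw [netSum_eq_sum N _ _ {i - 1} (fun j hj => ?_) (fun j h1 h2 h3 => ?_),
      Finset.sum_singleton, weight_eq (rank N i) (by omega)
      (by simp only [rank]; split_ifs <;> omega)]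
    · constructor <;> linarith [hp 2]
    · rw [Finset.mem_singleton.1 hj]; omega
    · rw [Finset.mem_singleton] at h3
      exact weight_eq_zero (by omega)
  obtain ⟨a, b, hab, ha, hb, hwa, hwb, h⟩ : ∃ a b : ℤ, a ≠ b ∧ (-(N : ℤ) ≤ a ∧ a ≤ 2 * N + 1) ∧
      (-(N : ℤ) ≤ b ∧ b ≤ 2 * N + 1) ∧ weight N i a = scale N ^ rank N i ∧
      weight N i b ≤ scale N ^ 2 ∧
      ∀ j : ℤ, -(N : ℤ) ≤ j → j ≤ 2 * N + 1 → j ≠ a → j ≠ b → weight N i j = 0 := by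
    have hwle : ∀ j, 2 ≤ max (rank N i) (rank N j) → weight N i j ≤ scale N ^ 2 := fun j hj => by
      rw [weight]; split_ifs
      · exact hle _ hj
      · positivity
    rcases lt_or_gt_of_ne h0 with h | h
    · by_cases he : i = -N
      · exact ⟨i + 1, N + 1, by omega, by omega, by omega,
          weight_eq _ (by omega) (by simp only [rank]; split_ifs <;> omega),
          hwle _ (by simp only [rank]; split_ifs <;> omega),
          fun j h1 h2 h3 h4 => weight_eq_zero (by omega)⟩
      · exact ⟨i + 1, i - 1, by omega, by omega, by omega,
          weight_eq _ (by omega) (by simp only [rank]; split_ifs <;> omega),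
          hwle _ (by simp only [rank]; split_ifs <;> omega),
          fun j h1 h2 h3 h4 => weight_eq_zero (by omega)⟩
    · exact ⟨i - 1, i + 1, by omega, by omega, by omega,
        weight_eq _ (by omega) (by simp only [rank]; split_ifs <;> omega),
        hwle _ (by simp only [rank]; split_ifs <;> omega),
        fun j h1 h2 h3 h4 => weight_eq_zero (by omega)⟩
  rw [netSum_pair _ hab ha hb h, hwa]
  have := weight_nonneg N i b
  constructor <;> linarith [hp 2]

end Steps

/-! ### The second network: Lyapunov function, stationary law and separation upper bound. -/

theorem lyapunov_le {x β : ℝ} (hx : 0 ≤ x) (hx4 : x ≤ 1 / 4) (hβ : β ≤ x ^ 2) :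
    1 / 2 * (1 + x) + 1 / 2 * ((1 - β) * 1 + β * ((1 + x) * (1 + x))) ≤
      (1 - x * (1 - 2 * x) / 2) * (1 + x) := by
  have h : β * (2 * x + x ^ 2) ≤ x ^ 2 * (2 * x + x ^ 2) :=
    mul_le_mul_of_nonneg_right hβ (by positivity)
  nlinarith [mul_nonneg hx hx, mul_nonneg (mul_nonneg hx hx) hx,
    mul_nonneg (mul_nonneg hx hx) (mul_nonneg hx hx), mul_nonneg hx (sub_nonneg.2 hx4)]

theorem mul_scale_le (N : ℕ) : (3 * N + 2) * scale N ≤ 1 / 16 * (1 / 2) ^ N := by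
  have h : (3 * N + 2 : ℝ) ≤ 3 * 2 ^ (N + 1) := by
    have h1 : N + 1 < 2 ^ (N + 1) := Nat.lt_two_pow_self
    have h2 : 3 * N + 2 ≤ 3 * 2 ^ (N + 1) := by omega
    exact_mod_cast h2
  have h2 : (2 : ℝ) ^ (N + 1) * scale N ≤ (1 / 2) ^ 6 * (1 / 2) ^ N := by
    rw [scale, show 20 * (N + 1) = (N + 1) + 19 * (N + 1) by ring,
      pow_add (1 / 2 : ℝ), ← mul_assoc,
      ← mul_pow, ← pow_add]
    norm_num only [one_pow, one_mul]
    exact pow_le_pow_of_le_one (by norm_num) (by norm_num) (by omega)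
  have h3 : (0 : ℝ) < (1 / 2) ^ N := by positivity
  nlinarith [mul_le_mul_of_nonneg_right h (scale_pos N).le]

theorem one_le_pow_pos {N : ℕ} {x : ℝ} (hx : 0 ≤ x) (y : (chain N).State) :
    1 ≤ (1 + x) ^ (pos y).natAbs := one_le_pow₀ (by linarith)

theorem stat_le_one {N : ℕ} (y : (chain N).State) : (chain N).stat y ≤ 1 := by
  rw [← (isLazyReversible N).stat_sum]
  exact Finset.single_le_sum (fun y _ => (isLazyReversible N).stat_nonneg y) (Finset.mem_univ y)

section Fixed

variable {N : ℕ} (hN : 1 ≤ N)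
include hN

theorem step_lyapunov {x : ℝ} (hx : 0 ≤ x) (hx4 : x ≤ 1 / 4) (hq : scale N ≤ x ^ 2)
    (y : (chain N).State) (hy : y ≠ centre N) :
    (chain N).step (fun y => (1 + x) ^ (pos y).natAbs) y ≤
      (1 - x * (1 - 2 * x) / 2) * (1 + x) ^ (pos y).natAbs := by
  have h0 := pos_ne_zero hy
  have hm := pos_mem y
  obtain ⟨k, hk⟩ : ∃ k, (pos y).natAbs = k + 1 := ⟨(pos y).natAbs - 1, by omega⟩
  have key : ∀ β : ℝ, β ≤ x ^ 2 → 1 / 2 * (1 + x) ^ (k + 1) +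
      1 / 2 * ((1 - β) * (1 + x) ^ k + β * (1 + x) ^ (k + 2)) ≤
      (1 - x * (1 - 2 * x) / 2) * (1 + x) ^ (k + 1) := fun β hβ => by
    have h := mul_le_mul_of_nonneg_right (lyapunov_le hx hx4 hβ)
      (show 0 ≤ (1 + x) ^ k by positivity)
    simp only [pow_succ]
    linarith
  by_cases ht : pos y = N + 1
  · obtain ⟨β, hβ0, hβ, h⟩ := step_trunk hN ht
    have hkN : k = N := by omega
    rw [h fun j => (1 + x) ^ j.natAbs, hk, Int.natAbs_zero, pow_zero, Int.natAbs_neg,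
      Int.natAbs_natCast, show ((N : ℤ) + 2).natAbs = k + 2 by omega, ← hkN]
    refine le_trans ?_ (key β (hβ.trans hq))
    have h1 : 1 ≤ (1 + x) ^ k := one_le_pow₀ (by linarith)
    have h2 : 0 ≤ 1 - β := by linarith [scale_le hN]
    nlinarith
  · rcases lt_or_gt_of_ne h0 with h | h
    · by_cases he : pos y = -N
      · obtain ⟨β, hβ0, hβ, h⟩ := step_neg_end hN he
        rw [h fun j => (1 + x) ^ j.natAbs, hk, show (pos y + 1).natAbs = k by omega,
          show ((N : ℤ) + 1).natAbs = k + 2 by omega]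
        exact key β ((hβ.trans (scale_pow_le hN (by omega))).trans hq)
      · obtain ⟨β, hβ0, hβ, h⟩ := step_neg hN h (by omega)
        rw [h fun j => (1 + x) ^ j.natAbs, hk, show (pos y + 1).natAbs = k by omega,
          show (pos y - 1).natAbs = k + 2 by omega]
        exact key β (hβ.trans hq)
    · obtain ⟨β, hβ0, hβ, -, h⟩ := step_pos hN h ht
      rw [h fun j => (1 + x) ^ j.natAbs, hk, show (pos y - 1).natAbs = k by omega,
        show (pos y + 1).natAbs = k + 2 by omega]
      exact key β (hβ.trans hq)

theorem step_centre_le {x : ℝ} (hx : 0 ≤ x) (hx4 : x ≤ 1 / 4) :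
    (chain N).step (fun y => (1 + x) ^ (pos y).natAbs) (centre N) ≤ 2 := by
  have hq := scale_pos N
  have hq1 := scale_le hN
  rw [step_eq fun j => (1 + x) ^ j.natAbs, pos_centre, netSum_centre hN, netSum_centre hN,
    Int.natAbs_zero, pow_zero, show ((N : ℤ) + 1).natAbs = N + 1 by omega]
  simp only [Int.natAbs_one, Int.natAbs_neg, pow_one]
  have h1 : scale N ^ (2 * N + 1) * (1 + x) ^ (N + 1) ≤ scale N := by
    have e : scale N ^ (2 * N + 1) * (1 + x) ^ (N + 1) =
        scale N ^ N * (scale N * (1 + x)) ^ (N + 1) := by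
      rw [mul_pow, ← mul_assoc, ← pow_add]; congr 2; omega
    have h2 : (scale N * (1 + x)) ^ (N + 1) ≤ 1 := pow_le_one₀ (by positivity) (by nlinarith)
    rw [e]
    calc _ ≤ scale N * 1 := mul_le_mul (scale_pow_le hN hN) h2 (by positivity) hq.le
      _ = _ := mul_one _
  have h3 : 0 < scale N ^ (2 * N + 1) := by positivity
  have h4 : (scale N * (1 + x) + scale N * (1 + x) + scale N ^ (2 * N + 1) * (1 + x) ^ (N + 1)) /
      (2 * (scale N * 1 + scale N * 1 + scale N ^ (2 * N + 1) * 1)) ≤ 1 := by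
    rw [div_le_one (by positivity)]
    nlinarith
  linarith

theorem sum_stat_pow_mul_le {x : ℝ} (hx : 0 ≤ x) (hx4 : x ≤ 1 / 4) (hq : scale N ≤ x ^ 2) :
    x * (1 - 2 * x) / 2 * ∑ y, (chain N).stat y * (1 + x) ^ (pos y).natAbs ≤ 2 := by
  have h := (isLazyReversible N).sum_stat_mul_le (step_lyapunov hN hx hx4 hq) (by nlinarith)
    (one_le_pow_pos hx) (step_centre_le hN hx hx4)
  rw [sub_sub_cancel] at h
  linarith [stat_le_one (centre N)]

/-- The total conductance is comparable to the conductance at the centre. -/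
theorem sum_netSum_bounds : 2 * scale N ≤ ∑ y : Pos N, netSum N y (fun _ => 1) ∧
    ∑ y : Pos N, netSum N y (fun _ => 1) ≤ 5 * scale N := by
  have hq := scale_pos N
  have hq1 := scale_le hN
  have hp : 0 ≤ scale N ^ (2 * N + 1) := by positivity
  have hp2 : scale N ^ (2 * N + 1) ≤ scale N ^ 2 :=
    pow_le_pow_of_le_one hq.le (by linarith) (by omega)
  have h0 := netSum_centre hN fun _ => 1
  rw [sum_pos N fun i => netSum N i fun _ => 1]
  constructor
  · refine le_trans ?_ (Finset.single_le_sum (f := fun i => netSum N i fun _ => 1) (fun i hi => ?_)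
      (show (0 : ℤ) ∈ _ from Finset.mem_Icc.2 (by omega)))
    · linarith
    · rcases eq_or_ne i 0 with rfl | h
      · linarith
      · have := (netSum_one_bounds hN (Finset.mem_Icc.1 hi) h).1
        have : 0 < scale N ^ rank N i := by positivity
        linarith
  · have hle : ∀ i ∈ Finset.Icc (-(N : ℤ)) (2 * N + 1), netSum N i (fun _ => 1) ≤
        4 * scale N ^ 2 + ((if i = 0 then 2 * scale N else 0) + ((if i = 1 then scale N else 0) +
          (if i = -1 then scale N else 0))) := fun i hi => by
      rcases eq_or_ne i 0 with rfl | h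
      · simp; nlinarith
      · have h1 := (netSum_one_bounds hN (Finset.mem_Icc.1 hi) h).2
        have h2 : scale N ^ rank N i ≤ scale N ^ 2 +
            ((if i = 1 then scale N else 0) + (if i = -1 then scale N else 0)) := by
          by_cases hi1 : i.natAbs = 1
          · rw [show rank N i = 1 by simp only [rank]; split_ifs <;> omega, pow_one]
            rcases Int.natAbs_eq_iff.1 hi1 with rfl | rfl <;> simp <;> positivity
          · rw [if_neg (by omega), if_neg (by omega), add_zero, add_zero]
            exact pow_le_pow_of_le_one hq.le (by linarith)
              (by simp only [rank]; split_ifs <;> omega)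
        rw [if_neg h]
        linarith
    refine (Finset.sum_le_sum hle).trans ?_
    rw [Finset.sum_add_distrib, Finset.sum_add_distrib, Finset.sum_add_distrib,
      Finset.sum_ite_eq', Finset.sum_ite_eq', Finset.sum_ite_eq',
      if_pos (Finset.mem_Icc.2 (by omega)), if_pos (Finset.mem_Icc.2 (by omega)),
      if_pos (Finset.mem_Icc.2 (by omega)), Finset.sum_const, Int.card_Icc, nsmul_eq_mul]
    have hcard : (((2 * (N : ℤ) + 1 + 1 - -N).toNat : ℕ) : ℝ) = 3 * N + 2 := by
      rw [show (2 * (N : ℤ) + 1 + 1 - -N).toNat = 3 * N + 2 by omega]; push_cast; ring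
    have h2 : (3 * N + 2) * scale N ≤ 1 / 16 := (mul_scale_le N).trans
      (mul_le_of_le_one_right (by norm_num) (pow_le_one₀ (by norm_num) (by norm_num)))
    rw [hcard]
    nlinarith [mul_le_mul_of_nonneg_right h2 hq.le]

theorem le_stat_centre : 2 / 5 ≤ (chain N).stat (centre N) := by
  have hq := scale_pos N
  obtain ⟨h1, h2⟩ := sum_netSum_bounds hN
  have hp : 0 ≤ scale N ^ (2 * N + 1) := by positivity
  rw [stat_eq, pos_centre, netSum_centre hN, le_div_iff₀ (by linarith)]
  linarith

theorem density_centre_le (t : ℕ) (y : (chain N).State) :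
    (chain N).density t y (centre N) ≤ 5 / 2 := by
  refine ((isLazyReversible N).density_le_inv t y _).trans ?_
  have := le_stat_centre hN
  rw [inv_le_comm₀ (by linarith) (by norm_num)]
  linarith

theorem stat_le_of_two_le {y : (chain N).State} (hy : 2 ≤ (pos y).natAbs) :
    (chain N).stat y ≤ 2 * scale N := by
  have hq := scale_pos N
  obtain ⟨h1, h2⟩ := sum_netSum_bounds hN
  have h3 := (netSum_one_bounds hN (pos_mem y) (by omega)).2
  have h4 : scale N ^ rank N (pos y) ≤ scale N ^ 2 :=
    pow_le_pow_of_le_one hq.le (by linarith [scale_le hN])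
      (by simp only [rank]; split_ifs <;> omega)
  rw [stat_eq, div_le_iff₀ (by linarith)]
  nlinarith

/-- This is why the rank jumps by N + 1 between the arms and the trunk: stepping from an arm end to
the trunk has relative probability at most `scale N ^ (N + 1)`, which beats even the trivial bound
1/π(y) on a density. -/
theorem inv_stat_end_le {y : (chain N).State} (hy : pos y = -N) :
    scale N ^ (N + 1) * ((chain N).stat y)⁻¹ ≤ 5 * scale N := by
  have hq := scale_pos N
  obtain ⟨h1, h2⟩ := sum_netSum_bounds hN
  have h3 := (netSum_one_bounds hN (pos_mem y) (by omega)).1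
  rw [show rank N (pos y) = N by simp only [rank]; split_ifs <;> omega] at h3
  have hp : 0 < scale N ^ N := by positivity
  rw [stat_eq, inv_div, pow_succ, ← mul_div_assoc, div_le_iff₀ (by linarith)]
  have h4 : scale N ^ N * scale N ≤ (netSum N (pos y) fun _ => 1) * 1 :=
    mul_le_mul h3 (by linarith [scale_le hN]) hq.le (hp.le.trans h3)
  nlinarith [mul_le_mul h4 h2 (by linarith) (by linarith)]

theorem one_sub_le_sum_stat : 1 - 2 * ((3 * N + 2) * scale N) ≤
    ∑ y ∈ Finset.univ.filter (fun y : (chain N).State => (pos y).natAbs ≤ 1), (chain N).stat y := by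
  have hX := isLazyReversible N
  have h := Finset.sum_filter_add_sum_filter_not Finset.univ
    (fun y : (chain N).State => (pos y).natAbs ≤ 1) (chain N).stat
  rw [hX.stat_sum] at h
  have h2 : ∑ y ∈ Finset.univ.filter (fun y : (chain N).State => ¬ (pos y).natAbs ≤ 1),
      (chain N).stat y ≤ (3 * N + 2) * (2 * scale N) := by
    refine (Finset.sum_le_card_nsmul _ _ (2 * scale N) fun y hy => ?_).trans ?_
    · have := (Finset.mem_filter.1 hy).2
      exact stat_le_of_two_le hN (by omega)
    · rw [nsmul_eq_mul]
      have hq := scale_pos N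
      refine mul_le_mul_of_nonneg_right ?_ (by positivity)
      have hc : (Finset.univ : Finset (chain N).State).card = 3 * N + 2 := by
        have : Fintype.card (Pos N) = 3 * N + 2 := by
          rw [Fintype.card_coe, Int.card_Icc]; omega
        exact this
      have h3 := (Finset.card_filter_le (Finset.univ : Finset (chain N).State)
        fun y => ¬ (pos y).natAbs ≤ 1).trans hc.le
      exact_mod_cast h3
  linarith

omit hN in
theorem step_indicator (x x' : (chain N).State) :
    (chain N).step (fun y => if pos y = pos x' then 1 else 0) x = (chain N).P x x' := by
  rw [step, Finset.sum_eq_single x' (fun y _ hy => ?_) (fun h => absurd (Finset.mem_univ _) h)]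
  · simp
  · rw [if_neg fun h => hy (pos_injective h), mul_zero]

/-- The transition probability to a neighbour towards the centre. -/
theorem le_P_of_parent {x x' : (chain N).State} (h : 0 < pos x ∧ pos x' = pos x - 1 ∨
    pos x < 0 ∧ pos x' = pos x + 1 ∨ pos x = N + 1 ∧ pos x' = -N) : 1 / 8 ≤ (chain N).P x x' := by
  have hq1 := scale_le hN
  have hm := pos_mem x
  rw [← step_indicator]
  by_cases ht : pos x = N + 1
  · obtain ⟨β, h0, h1, hs⟩ := step_trunk hN ht
    rw [hs fun j => if j = pos x' then 1 else 0]
    rcases h with h | h | h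
    · rw [if_neg (by omega), if_neg (by omega), if_pos (by omega), if_neg (by omega),
        if_neg (by omega)]
      linarith
    · omega
    · rw [if_neg (by omega), if_neg (by omega), if_neg (by omega), if_pos (by omega),
        if_neg (by omega)]
      linarith
  rcases h with h | h | h
  · obtain ⟨β, h0, h1, -, hs⟩ := step_pos hN h.1 ht
    rw [hs fun j => if j = pos x' then 1 else 0, if_neg (by omega), if_pos (by omega),
      if_neg (by omega)]
    linarith
  · by_cases he : pos x = -N
    · obtain ⟨β, h0, h1, hs⟩ := step_neg_end hN he
      have := scale_pow_le hN (show 1 ≤ N + 1 by omega)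
      rw [hs fun j => if j = pos x' then 1 else 0, if_neg (by omega), if_pos (by omega),
        if_neg (by omega)]
      linarith
    · obtain ⟨β, h0, h1, hs⟩ := step_neg hN h.1 (by omega)
      rw [hs fun j => if j = pos x' then 1 else 0, if_neg (by omega), if_pos (by omega),
        if_neg (by omega)]
      linarith
  · exact absurd h.1 ht

/-- A path of moves of probability at least 1/8 leads down the trunk to y, through the other arm end
-N if y is negative; laziness fills the remaining time. -/
theorem le_pow_apply {x y : (chain N).State} (hx : N + 1 ≤ pos x) (hyx : pos y ≤ pos x) {t : ℕ} (ht : 4 * N ≤ t) :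
    (1 / 8 : ℝ) ^ t ≤ ((chain N).P ^ t) x y := by
  have hX := isLazyReversible N
  have hmx := pos_mem x
  have hmy := pos_mem y
  rcases lt_or_ge (pos y) 0 with h | h
  · refine hX.pow_le_pow_apply (by norm_num) (by norm_num) y {v | N + 1 ≤ pos v ∨ pos v ≤ pos y}
      (fun v => if N + 1 ≤ pos v then (pos v + pos y).toNat else (pos y - pos v).toNat)
      (fun v hv hd => ?_) (fun v hv hd => ?_) t x (Or.inl hx) ?_
    · rcases hv with hv | hv
      · rw [if_pos hv] at hd; exact absurd hd (by omega)
      · rw [if_neg (by omega)] at hd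
        exact pos_injective (by omega)
    · have hmv := pos_mem v
      rcases hv with hv | hv
      · by_cases he : pos v = N + 1
        · have hp := pos_mk N (-(N : ℤ)) (by omega)
          refine ⟨mk N (-(N : ℤ)) (by omega), Or.inr (by rw [hp]; omega), ?_,
            le_P_of_parent hN (Or.inr (Or.inr ⟨he, hp⟩))⟩
          simp only [hp]
          rw [if_pos hv, if_neg (by omega)]
          omega
        · have hp := pos_mk N (pos v - 1) (by omega)
          refine ⟨mk N (pos v - 1) (by omega), Or.inl (by rw [hp]; omega), ?_,
            le_P_of_parent hN (Or.inl ⟨by omega, hp⟩)⟩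
          simp only [hp]
          rw [if_pos hv, if_pos (by omega)]
          omega
      · rw [if_neg (by omega)] at hd
        have hp := pos_mk N (pos v + 1) (by omega)
        refine ⟨mk N (pos v + 1) (by omega), Or.inr (by rw [hp]; omega), ?_,
          le_P_of_parent hN (Or.inr (Or.inl ⟨by omega, hp⟩))⟩
        simp only [hp]
        rw [if_neg (by omega), if_neg (by omega)]
        omega
    · rw [if_pos hx]
      omega
  · refine hX.pow_le_pow_apply (by norm_num) (by norm_num) y {v | pos y ≤ pos v}
      (fun v => (pos v - pos y).toNat)
      (fun v hv hd => pos_injective ?_) (fun v hv hd => ?_) t x hyx (by omega)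
    · have : pos y ≤ pos v := hv
      omega
    · have hmv := pos_mem v
      have hp := pos_mk N (pos v - 1) (by omega)
      exact ⟨mk N (pos v - 1) (by omega), show pos y ≤ pos _ by rw [hp]; omega, by rw [hp]; omega,
        le_P_of_parent hN (Or.inl ⟨by omega, hp⟩)⟩

theorem one_le_density {x y : (chain N).State} (hx : N + 1 ≤ pos x) (hy : 2 ≤ (pos y).natAbs)
    (hyx : pos y ≤ pos x) {t : ℕ} (ht : 4 * N ≤ t) (ht' : t ≤ 5 * N) :
    1 ≤ (chain N).density t x y := by
  have hX := isLazyReversible N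
  rw [density, one_le_div (hX.stat_pos y)]
  refine (stat_le_of_two_le hN hy).trans (le_trans ?_ (le_pow_apply hN hx hyx ht))
  -- The exponent 20(N+1) in `scale` is chosen for this: 8^(-5N) = 2^(-15N). It is also the reason
  -- for the restriction t ≤ 5N.
  calc 2 * scale N ≤ (1 / 8) ^ (5 * N) := by
        rw [scale, show (1 / 8 : ℝ) = (1 / 2) ^ 3 by norm_num, ← pow_mul]
        calc (2 : ℝ) * (1 / 2) ^ (20 * (N + 1)) = (1 / 2) ^ (20 * N + 19) := by
              rw [show 20 * (N + 1) = 20 * N + 19 + 1 by ring, pow_succ]; ring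
          _ ≤ _ := pow_le_pow_of_le_one (by norm_num) (by norm_num) (by omega)
    _ ≤ _ := pow_le_pow_of_le_one (by norm_num) (by norm_num) ht'

/-- If the two heights add up to at most 2N + 2, two hitting times cost about 4N. Otherwise the
higher state is in the trunk and the other is at height at least 2, and the density is already at
least 1. -/
theorem sepDist_le_pow {x : ℝ} (hx : 0 ≤ x) (hx4 : x ≤ 1 / 4) (hq : scale N ≤ x ^ 2) {t : ℕ}
    (ht : 4 * N ≤ t) (ht' : t ≤ 5 * N) :
    (chain N).sepDist t ≤ (1 + x) ^ (2 * N + 2) * (1 - x * (1 - 2 * x) / 2) ^ t := by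
  have hX := isLazyReversible N
  have hl : 0 ≤ 1 - x * (1 - 2 * x) / 2 := by nlinarith
  have h0 : 0 ≤ (1 + x) ^ (2 * N + 2) * (1 - x * (1 - 2 * x) / 2) ^ t := by positivity
  refine hX.sepDist_le fun y w => ?_
  wlog hwy : pos w ≤ pos y generalizing y w
  · rw [hX.density_symm]
    exact this w y (by omega)
  by_cases hyw : (pos y).natAbs + (pos w).natAbs ≤ 2 * N + 2
  · refine (hX.one_sub_density_pair_le hl (one_le_pow_pos hx) (step_lyapunov hN hx hx4 hq)
      t y w).trans ?_
    rw [← mul_assoc, ← pow_add]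
    exact mul_le_mul_of_nonneg_right (pow_le_pow_right₀ (by linarith) hyw) (by positivity)
  · have hmy := pos_mem y
    have hmw := pos_mem w
    have := one_le_density hN (x := y) (y := w) (by omega) (by omega) hwy ht ht'
    linarith

end Fixed

/-! ### The second network: lower bounds, and the plateau of the total-variation distance. -/

theorem half_add_half_le {x a b c e p r β κ : ℝ} (hx : 0 ≤ x) (ha : 0 ≤ a) (hβ0 : 0 ≤ β) (hβ1 : β ≤ 1)
    (hb : b ≤ a + e) (hp : p ≤ (1 + x) * a + e) (hc : c ≤ a + e + r) (hr : β * r ≤ 2 * κ) :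
    1 / 2 * b + 1 / 2 * ((1 - β) * p + β * c) ≤ (1 + x * (1 + x) / 2) * a + e + κ := by
  have h1 := mul_le_mul_of_nonneg_left hp (sub_nonneg.2 hβ1)
  have h2 := mul_le_mul_of_nonneg_left hc hβ0
  nlinarith [mul_nonneg hβ0 (mul_nonneg hx ha), mul_nonneg (mul_nonneg hx hx) ha]

theorem inv_pow_eq_mul {x : ℝ} (hx : 0 ≤ x) (k : ℕ) :
    ((1 + x)⁻¹) ^ k = (1 + x) * ((1 + x)⁻¹) ^ (k + 1) := by
  rw [pow_succ]; field_simp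

section Fixed

variable {N : ℕ} (hN : 1 ≤ N)
include hN

/-- One step of a function with an exponential profile on one of the arms. -/
theorem step_arm_le {x C e r κ : ℝ} (hx : 0 ≤ x) (hC : 0 ≤ C) (hr : 0 ≤ r)
    (hκ : scale N ^ (N + 1) * r ≤ 2 * κ) (F : ℤ → ℝ) {y : (chain N).State} (h0 : pos y ≠ 0)
    (hy : (pos y).natAbs ≤ N)
    (hF : ∀ j : ℤ, j.natAbs ≤ N → (0 < pos y → 0 ≤ j) → (pos y < 0 → j ≤ 0) →
      F j ≤ C * ((1 + x)⁻¹) ^ j.natAbs + e)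
    (hend : F (N + 1) ≤ C * ((1 + x)⁻¹) ^ N + e + r) :
    (chain N).step (fun w => F (pos w)) y ≤
      (1 + x * (1 + x) / 2) * (C * ((1 + x)⁻¹) ^ (pos y).natAbs) + e + κ := by
  have hq := scale_pos N
  have hq1 := scale_le hN
  have hq2 := scale_pow_le hN (show 1 ≤ N + 1 by omega)
  have hqp : 0 < scale N ^ (N + 1) := by positivity
  have hη : (0 : ℝ) ≤ (1 + x)⁻¹ := by positivity
  have hη1 : (1 + x)⁻¹ ≤ 1 := inv_le_one_of_one_le₀ (by linarith)
  have hκ0 : 0 ≤ κ := by nlinarith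
  have ha : 0 ≤ C * ((1 + x)⁻¹) ^ (pos y).natAbs := by positivity
  have hpar : ∀ j : ℤ, j.natAbs + 1 = (pos y).natAbs → (0 < pos y → 0 ≤ j) → (pos y < 0 → j ≤ 0) →
      F j ≤ (1 + x) * (C * ((1 + x)⁻¹) ^ (pos y).natAbs) + e := fun j h1 h2 h3 => by
    refine (hF j (by omega) h2 h3).trans (le_of_eq ?_)
    rw [inv_pow_eq_mul hx, h1]; ring
  have hchild : ∀ j : ℤ, j.natAbs = (pos y).natAbs + 1 → j.natAbs ≤ N → (0 < pos y → 0 ≤ j) →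
      (pos y < 0 → j ≤ 0) → F j ≤ C * ((1 + x)⁻¹) ^ (pos y).natAbs + e + 0 :=
    fun j h1 h2 h3 h4 => by
      refine (hF j h2 h3 h4).trans ?_
      have := mul_le_mul_of_nonneg_left
        (pow_le_pow_of_le_one hη hη1 (show (pos y).natAbs ≤ j.natAbs by omega)) hC
      linarith
  have hself := hF (pos y) hy (fun h => h.le) (fun h => h.le)
  rcases lt_or_gt_of_ne h0 with h | h
  · by_cases he : pos y = -N
    · obtain ⟨β, hβ0, hβ, hs⟩ := step_neg_end hN he
      rw [hs]
      refine half_add_half_le hx ha hβ0 (by linarith) hself (hpar _ (by omega) (by omega) (by omega))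
        (hend.trans (le_of_eq (by rw [show (pos y).natAbs = N by omega])))
        ((mul_le_mul_of_nonneg_right hβ hr).trans hκ)
    · obtain ⟨β, hβ0, hβ, hs⟩ := step_neg hN h (by omega)
      rw [hs]
      exact half_add_half_le hx ha hβ0 (by linarith) hself (hpar _ (by omega) (by omega) (by omega))
        (hchild _ (by omega) (by omega) (by omega) (by omega)) (by linarith)
  · obtain ⟨β, hβ0, hβ, hβ', hs⟩ := step_pos hN h (by omega)
    rw [hs]
    by_cases he : pos y = N
    · refine half_add_half_le hx ha hβ0 (by linarith) hself (hpar _ (by omega) (by omega) (by omega))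
        (le_trans (le_of_eq (by rw [he])) (hend.trans (le_of_eq (by
          rw [show (pos y).natAbs = N by omega]))))
        ((mul_le_mul_of_nonneg_right (hβ' he) hr).trans hκ)
    · exact half_add_half_le hx ha hβ0 (by linarith) hself (hpar _ (by omega) (by omega) (by omega))
        (hchild _ (by omega) (by omega) (by omega) (by omega)) (by linarith)

theorem density_end_centre_le {x : ℝ} (hx : 0 ≤ x) (t : ℕ) :
    (chain N).density t (mk N (-(N : ℤ)) (by omega)) (centre N) ≤
      5 / 2 * (1 + x * (1 + x) / 2) ^ t * ((1 + x)⁻¹) ^ N + t * (2 * scale N) := by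
  have hX := isLazyReversible N
  have hq := scale_pos N
  have hμ : 1 ≤ 1 + x * (1 + x) / 2 := by
    have : 0 ≤ x * (1 + x) / 2 := by positivity
    linarith
  let F : ℕ → ℤ → ℝ := fun t j => if j ≤ 0 then
    5 / 2 * (1 + x * (1 + x) / 2) ^ t * ((1 + x)⁻¹) ^ j.natAbs + t * (2 * scale N) else 5 / 2
  have h := le_of_subsolution hX.P_nonneg (v := fun t y => (chain N).density t y (centre N))
    (W := fun t y => F t (pos y)) {y | pos y < 0} t (fun y => ?_) (fun t _ y hy => ?_)
    (fun t _ y hy => (hX.density_succ t y _).le) (fun t _ y hy => ?_) t le_rfl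
    (mk N (-(N : ℤ)) (by omega))
  · simp only [F, pos_mk] at h
    rwa [if_pos (by omega), Int.natAbs_neg, Int.natAbs_natCast] at h
  · by_cases hy : pos y < 0
    · rw [hX.density_zero fun h => by rw [h, pos_centre] at hy; omega]
      simp only [F]
      rw [if_pos hy.le]
      positivity
    · refine (density_centre_le hN 0 y).trans ?_
      simp only [F]
      split_ifs with h
      · rw [show pos y = 0 by omega]; simp
      · exact le_rfl
  · have hy' : ¬ pos y < 0 := hy
    refine (density_centre_le hN t y).trans ?_
    simp only [F]
    split_ifs with h
    · rw [show pos y = 0 by omega, Int.natAbs_zero, pow_zero, mul_one]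
      have := one_le_pow₀ hμ (n := t)
      have : 0 ≤ (t : ℝ) * (2 * scale N) := by positivity
      linarith
    · exact le_rfl
  · have hy' : pos y < 0 := hy
    have hmy := pos_mem y
    change (chain N).step (fun w => F t (pos w)) y ≤ _
    have hq2 := scale_pow_le hN (show 1 ≤ N + 1 by omega)
    refine (step_arm_le hN hx (C := 5 / 2 * (1 + x * (1 + x) / 2) ^ t) (e := t * (2 * scale N))
      (r := 5 / 2) (κ := 2 * scale N) (by positivity) (by norm_num) (by linarith) (F t) hy'.ne
      (by omega) (fun j _ _ hj => ?_) ?_).trans (le_of_eq ?_)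
    · simp only [F]
      rw [if_pos (hj hy')]
    · simp only [F]
      rw [if_neg (by omega)]
      have : 0 ≤ 5 / 2 * (1 + x * (1 + x) / 2) ^ t * ((1 + x)⁻¹) ^ N + t * (2 * scale N) := by
        positivity
      linarith
    · simp only [F]
      rw [if_pos hy'.le]
      push_cast
      ring

/-- The first arm ends at the root, where symmetry and `density_end_centre_le` give the profile of
the second arm as boundary value. The two factors multiply, so the times of the arms add. -/
theorem density_ends_le {x : ℝ} (hx : 0 ≤ x) (t : ℕ) :
    (chain N).density t (mk N N (by omega)) (mk N (-(N : ℤ)) (by omega)) ≤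
      5 / 2 * (1 + x * (1 + x) / 2) ^ t * ((1 + x)⁻¹) ^ N * ((1 + x)⁻¹) ^ N +
        t * (5 * scale N) := by
  have hX := isLazyReversible N
  have hq := scale_pos N
  set y₀ := mk N (-(N : ℤ)) (by omega) with hy₀
  set R := ((chain N).stat y₀)⁻¹ with hR
  have hR0 : 0 ≤ R := inv_nonneg.2 (hX.stat_nonneg _)
  let F : ℕ → ℤ → ℝ := fun t j => if 0 ≤ j ∧ j ≤ N then
    5 / 2 * (1 + x * (1 + x) / 2) ^ t * ((1 + x)⁻¹) ^ N * ((1 + x)⁻¹) ^ j.natAbs +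
      t * (5 * scale N) else R
  have hout : ∀ t (y : (chain N).State), ¬ (0 < pos y ∧ pos y ≤ N) →
      (chain N).density t y y₀ ≤ F t (pos y) := fun t y hy => by
    simp only [F]
    split_ifs with h
    · rw [pos_injective (show pos y = pos (centre N) by rw [pos_centre]; omega), hX.density_symm,
        pos_centre, Int.natAbs_zero, pow_zero, mul_one]
      refine (density_end_centre_le hN hx t).trans ?_
      have : 0 ≤ (t : ℝ) * scale N := by positivity
      linarith
    · exact hX.density_le_inv _ _ _
  have h := le_of_subsolution hX.P_nonneg (v := fun t y => (chain N).density t y y₀)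
    (W := fun t y => F t (pos y)) {y | 0 < pos y ∧ pos y ≤ N} t (fun y => ?_)
    (fun t _ y hy => hout t y hy)
    (fun t _ y hy => (hX.density_succ t y _).le) (fun t _ y hy => ?_) t le_rfl
    (mk N N (by omega))
  · simp only [F, pos_mk] at h
    rwa [if_pos (by omega), Int.natAbs_natCast] at h
  · by_cases hy : 0 < pos y ∧ pos y ≤ N
    · rw [hX.density_zero fun h => by rw [h, hy₀, pos_mk] at hy; omega]
      simp only [F]
      rw [if_pos ⟨hy.1.le, hy.2⟩]
      positivity
    · exact hout 0 y hy
  · have hy' : 0 < pos y ∧ pos y ≤ N := hy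
    change (chain N).step (fun w => F t (pos w)) y ≤ _
    have hend := inv_stat_end_le hN (y := y₀) (by rw [hy₀, pos_mk])
    refine (step_arm_le hN hx (C := 5 / 2 * (1 + x * (1 + x) / 2) ^ t * ((1 + x)⁻¹) ^ N)
      (e := t * (5 * scale N)) (r := R) (κ := 5 * scale N) (by positivity) hR0 (by linarith) (F t)
      hy'.1.ne' (by omega) (fun j h1 h2 _ => ?_) ?_).trans (le_of_eq ?_)
    · simp only [F]
      rw [if_pos ⟨h2 hy'.1, by omega⟩]
    · simp only [F]
      rw [if_neg (by omega)]
      have : 0 ≤ 5 / 2 * (1 + x * (1 + x) / 2) ^ t * ((1 + x)⁻¹) ^ N * ((1 + x)⁻¹) ^ N +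
        t * (5 * scale N) := by positivity
      linarith
    · simp only [F]
      rw [if_pos ⟨hy'.1.le, hy'.2⟩]
      push_cast
      ring

theorem le_sepDist {x : ℝ} (hx : 0 ≤ x) (t : ℕ) :
    1 - (5 / 2 * (1 + x * (1 + x) / 2) ^ t * ((1 + x)⁻¹) ^ N * ((1 + x)⁻¹) ^ N +
      t * (5 * scale N)) ≤ (chain N).sepDist t := by
  have h1 := density_ends_le hN hx t
  have h2 := (isLazyReversible N).one_sub_density_le_sepDist t (mk N N (by omega))
    (mk N (-(N : ℤ)) (by omega))
  linarith

theorem le_tvDist {x : ℝ} (hx : 0 ≤ x) (t : ℕ) :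
    1 - 2 * ((3 * N + 2) * scale N) - ((1 + x) * (1 + x * (1 + x) / 2) ^ t * ((1 + x)⁻¹) ^ N +
      t * scale N) ≤ (chain N).tvDist t := by
  have hX := isLazyReversible N
  have hq := scale_pos N
  have hμ : 1 ≤ 1 + x * (1 + x) / 2 := by
    have : 0 ≤ x * (1 + x) / 2 := by positivity
    linarith
  let F : ℕ → ℤ → ℝ := fun t j => if j ≤ -2 then
    (1 + x) * (1 + x * (1 + x) / 2) ^ t * ((1 + x)⁻¹) ^ j.natAbs + t * scale N else 1
  have hF : ∀ t j, j ≤ 0 → F t j ≤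
      (1 + x) * (1 + x * (1 + x) / 2) ^ t * ((1 + x)⁻¹) ^ j.natAbs + t * scale N := by
    intro t j hj
    simp only [F]
    split_ifs with h
    · exact le_rfl
    · have h1 := one_le_pow₀ hμ (n := t)
      have h2 : 1 ≤ (1 + x) * ((1 + x)⁻¹) ^ j.natAbs := by
        have hη1 : (1 + x)⁻¹ ≤ 1 := inv_le_one_of_one_le₀ (by linarith)
        calc (1 : ℝ) = (1 + x) * ((1 + x)⁻¹) ^ 1 := by field_simp
          _ ≤ _ := mul_le_mul_of_nonneg_left
            (pow_le_pow_of_le_one (by positivity) hη1 (by omega)) (by linarith)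
      have h3 := one_le_mul_of_one_le_of_one_le h2 h1
      have : 0 ≤ (t : ℝ) * scale N := by positivity
      linarith
  have h2 := hX.sum_pow_le (Finset.univ.filter fun y : (chain N).State => (pos y).natAbs ≤ 1)
    (fun t y => F t (pos y)) {y | pos y ≤ -2} (fun y hy => ?_) (fun t y hy => ?_)
    (fun t y hy => ?_) t (mk N (-(N : ℤ)) (by omega))
  · have h3 := hX.le_tvDist t (mk N (-(N : ℤ)) (by omega))
      (Finset.univ.filter fun y : (chain N).State => (pos y).natAbs ≤ 1)
    have h4 := one_sub_le_sum_stat hN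
    have h5 := hF t (-(N : ℤ)) (by omega)
    rw [pos_mk] at h2
    rw [Int.natAbs_neg, Int.natAbs_natCast] at h5
    linarith
  · have hy' : pos y ≤ -2 := hy
    refine ⟨fun h => ?_, ?_⟩
    · have := (Finset.mem_filter.1 h).2
      omega
    · simp only [F]
      rw [if_pos hy']
      positivity
  · have hy' : ¬ pos y ≤ -2 := hy
    simp only [F]
    rw [if_neg hy']
  · have hy' : pos y ≤ -2 := hy
    have hmy := pos_mem y
    have hq2 := scale_pow_le hN (show 1 ≤ N + 1 by omega)
    refine (step_arm_le hN hx (C := (1 + x) * (1 + x * (1 + x) / 2) ^ t) (e := t * scale N)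
      (r := 1) (κ := scale N) (by positivity) (by norm_num) (by linarith) (F t) (by omega)
      (by omega) (fun j _ _ hj => hF t j (hj (by omega))) ?_).trans (le_of_eq ?_)
    · simp only [F]
      rw [if_neg (by omega)]
      have : 0 ≤ (1 + x) * (1 + x * (1 + x) / 2) ^ t * ((1 + x)⁻¹) ^ N + t * scale N := by
        positivity
      linarith
    · simp only [F]
      rw [if_pos hy']
      push_cast
      ring

/-- Well before time 4N a walk from the top of the trunk can be at the root essentially only by the
direct edge from the trunk's bottom, of probability at most 1/3, while π gives the root at least
2/5; the difference is 1/15. -/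
theorem le_tvDist_trunk {x : ℝ} (hx : 0 ≤ x) (t : ℕ) :
    1 / 15 - ((1 + x * (1 + x) / 2) ^ t * ((1 + x)⁻¹) ^ (2 * N) + t * scale N) ≤
      (chain N).tvDist t := by
  have hX := isLazyReversible N
  have hq := scale_pos N
  have hμ : 1 ≤ 1 + x * (1 + x) / 2 := by
    have : 0 ≤ x * (1 + x) / 2 := by positivity
    linarith
  -- The exponent is lowered by 1 on the trunk so that its bottom carries the same power as the arm
  -- ends it leads to; the top then carries the power 2N.
  let F : ℕ → ℤ → ℝ := fun t j => if j = 0 then 1 else if j.natAbs ≤ N then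
    (1 + x * (1 + x) / 2) ^ t * ((1 + x)⁻¹) ^ j.natAbs + t * scale N else
    1 / 3 + (1 + x * (1 + x) / 2) ^ t * ((1 + x)⁻¹) ^ (j.natAbs - 1) + t * scale N
  have hF1 : ∀ t (j : ℤ), j ≠ 0 → j.natAbs ≤ N → F t j =
      (1 + x * (1 + x) / 2) ^ t * ((1 + x)⁻¹) ^ j.natAbs + t * scale N := fun t j h1 h2 => by
    simp only [F]; rw [if_neg h1, if_pos h2]
  have hF2 : ∀ t (j : ℤ) (k : ℕ), N ≤ k → j.natAbs = k + 1 → F t j =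
      1 / 3 + (1 + x * (1 + x) / 2) ^ t * ((1 + x)⁻¹) ^ k + t * scale N := fun t j k h1 h2 => by
    simp only [F]; rw [if_neg (by omega), if_neg (by omega), h2, Nat.add_sub_cancel]
  have h2 := hX.sum_pow_le {centre N} (fun t y => F t (pos y)) {y | pos y ≠ 0} (fun y hy => ?_)
    (fun t y hy => ?_) (fun t y hy => ?_) t (mk N (2 * N + 1) (by omega))
  · have h3 := hX.le_tvDist t (mk N (2 * N + 1) (by omega)) {centre N}
    rw [Finset.sum_singleton] at h2 h3
    rw [Finset.sum_singleton] at h3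
    rw [pos_mk, hF2 t _ (2 * N) (by omega) (by omega)] at h2
    linarith [le_stat_centre hN]
  · have hy' : pos y ≠ 0 := hy
    refine ⟨fun h => hy' (by rw [Finset.mem_singleton.1 h, pos_centre]), ?_⟩
    simp only [F]
    split_ifs <;> positivity
  · have hy' : pos y = 0 := not_not.1 hy
    simp only [F]
    rw [if_pos hy']
  · have hy' : pos y ≠ 0 := hy
    have hmy := pos_mem y
    have hq1 := scale_le hN
    have hq2 := scale_pow_le hN (show 1 ≤ N + 1 by omega)
    by_cases harm : (pos y).natAbs ≤ N
    · refine (step_arm_le hN hx (C := (1 + x * (1 + x) / 2) ^ t) (e := t * scale N)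
        (r := 1 / 3) (κ := scale N) (by positivity) (by norm_num) (by linarith) (F t) hy'
        harm (fun j hj _ _ => ?_) ?_).trans (le_of_eq ?_)
      · by_cases h : j = 0
        · simp only [F]
          rw [if_pos h, h, Int.natAbs_zero, pow_zero, mul_one]
          have := one_le_pow₀ hμ (n := t)
          have : 0 ≤ (t : ℝ) * scale N := by positivity
          linarith
        · exact (hF1 t j h hj).le
      · rw [hF2 t _ N le_rfl (by omega)]
        linarith
      · rw [hF1 _ _ hy' harm]
        push_cast
        ring
    · by_cases ht : pos y = N + 1
      · obtain ⟨β, hβ0, hβ, hs⟩ := step_trunk hN ht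
        rw [hs, ht, hF2 t _ N le_rfl (by omega), hF2 (t + 1) _ N le_rfl (by omega),
          hF2 t (N + 2) (N + 1) (by omega) (by omega), hF1 t N (by omega) (by omega),
          hF1 t (-N) (by omega) (by omega), Int.natAbs_neg, Int.natAbs_natCast,
          show F t 0 = 1 from if_pos rfl, pow_succ (1 + x * (1 + x) / 2)]
        have hb : 0 ≤ (1 + x * (1 + x) / 2) ^ t * ((1 + x)⁻¹) ^ N := by positivity
        have hb' : (1 + x * (1 + x) / 2) ^ t * ((1 + x)⁻¹) ^ (N + 1) ≤
            (1 + x * (1 + x) / 2) ^ t * ((1 + x)⁻¹) ^ N :=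
          mul_le_mul_of_nonneg_left (pow_le_pow_of_le_one (by positivity)
            (inv_le_one_of_one_le₀ (by linarith)) (by omega)) (by positivity)
        have he : 0 ≤ (t : ℝ) * scale N := by positivity
        have hμb : (1 + x * (1 + x) / 2) ^ t * ((1 + x)⁻¹) ^ N ≤
            (1 + x * (1 + x) / 2) ^ t * (1 + x * (1 + x) / 2) * ((1 + x)⁻¹) ^ N := by
          rw [mul_right_comm]; exact le_mul_of_one_le_right hb hμ
        push_cast
        set b := (1 + x * (1 + x) / 2) ^ t * ((1 + x)⁻¹) ^ N
        have h1 := mul_nonneg (show 0 ≤ 1 - β by linarith) (add_nonneg hb he)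
        have h2 := mul_le_mul_of_nonneg_left hb' hβ0
        linarith
      · obtain ⟨β, hβ0, hβ, -, hs⟩ := step_pos hN (show 0 < pos y by omega) ht
        obtain ⟨k, hk⟩ : ∃ k, (pos y).natAbs = k + 1 + 1 := ⟨(pos y).natAbs - 2, by omega⟩
        rw [hs, hF2 t (pos y) (k + 1) (by omega) hk, hF2 (t + 1) (pos y) (k + 1) (by omega) hk,
          hF2 t (pos y - 1) k (by omega) (by omega),
          hF2 t (pos y + 1) (k + 2) (by omega) (by omega)]
        have hb' : (1 + x * (1 + x) / 2) ^ t * ((1 + x)⁻¹) ^ (k + 2) ≤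
            (1 + x * (1 + x) / 2) ^ t * ((1 + x)⁻¹) ^ (k + 1) :=
          mul_le_mul_of_nonneg_left (pow_le_pow_of_le_one (by positivity)
            (inv_le_one_of_one_le₀ (by linarith)) (by omega)) (by positivity)
        refine (half_add_half_le (x := x) (e := 1 / 3 + t * scale N) (r := 0) (κ := 0)
          (a := (1 + x * (1 + x) / 2) ^ t * ((1 + x)⁻¹) ^ (k + 1)) hx (by positivity) hβ0
          (by linarith) (by linarith) ?_ (by linarith) (by linarith)).trans ?_
        · rw [inv_pow_eq_mul hx k]
          linarith
        · rw [pow_succ (1 + x * (1 + x) / 2)]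
          push_cast
          linarith

/-- From the bottom of the trunk the defect is bounded by 1 at the two arm ends and by the Lyapunov
bound at the root, which makes 2/3 a fixed point. Measuring height from the bottom leaves a single
factor (1+x)^N for the start. -/
theorem one_sub_density_le {x : ℝ} (hx : 0 ≤ x) (hx4 : x ≤ 1 / 4) (hq : scale N ≤ x ^ 2) (t : ℕ)
    (y w : (chain N).State) : 1 - (chain N).density t y w ≤
      2 / 3 + (1 + x) ^ N * ((1 + x) ^ (pos w).natAbs * (1 - x * (1 - 2 * x) / 2) ^ t) := by
  have hX := isLazyReversible N
  have hl : 0 ≤ 1 - x * (1 - 2 * x) / 2 := by nlinarith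
  set a : ℕ → ℝ := fun t => (1 + x) ^ (pos w).natAbs * (1 - x * (1 - 2 * x) / 2) ^ t with ha
  have ha0 : ∀ t, 0 ≤ a t := fun t => by positivity
  have has : ∀ t, a (t + 1) = (1 - x * (1 - 2 * x) / 2) * a t := fun t => by
    simp only [ha, pow_succ]; ring
  have hpair := hX.one_sub_density_pair_le hl (one_le_pow_pos hx) (step_lyapunov hN hx hx4 hq)
  by_cases hy : (N : ℤ) + 1 ≤ pos y
  swap
  · refine (hpair t y w).trans ?_
    have hmy := pos_mem y
    have := mul_le_mul_of_nonneg_right (pow_le_pow_right₀ (show 1 ≤ 1 + x by linarith)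
      (show (pos y).natAbs ≤ N by omega)) (ha0 t)
    linarith
  let F : ℕ → ℤ → ℝ := fun t j => if (N : ℤ) + 1 ≤ j then
    2 / 3 + (1 + x) ^ (j - (N + 1)).toNat * a t else if j = 0 then a t else 1
  have hF : ∀ t (j : ℤ) (k : ℕ), j = N + 1 + k → F t j = 2 / 3 + (1 + x) ^ k * a t :=
    fun t j k h => by
      simp only [F]; rw [if_pos (by omega), show (j - (N + 1)).toNat = k by omega]
  have h := hX.one_sub_density_le w (fun t y => F t (pos y)) {y | (N : ℤ) + 1 ≤ pos y}
    (fun y hy => ?_) (fun t y hy => ?_) (fun t y hy => ?_) t y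
  · obtain ⟨k, hk⟩ : ∃ k : ℕ, pos y = N + 1 + k := ⟨(pos y - (N + 1)).toNat, by omega⟩
    have hmy := pos_mem y
    rw [hF t _ k hk] at h
    have := mul_le_mul_of_nonneg_right (pow_le_pow_right₀ (show 1 ≤ 1 + x by linarith)
      (show k ≤ N by omega)) (ha0 t)
    linarith
  · have hy' : (N : ℤ) + 1 ≤ pos y := hy
    obtain ⟨k, hk⟩ : ∃ k : ℕ, pos y = N + 1 + k := ⟨(pos y - (N + 1)).toNat, by omega⟩
    rw [hF 0 _ k hk]
    have h1 : 1 ≤ a 0 := by simp only [ha, pow_zero, mul_one]; exact one_le_pow_pos hx w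
    have h2 := one_le_mul_of_one_le_of_one_le
      (one_le_pow₀ (show 1 ≤ 1 + x by linarith) (n := k)) h1
    linarith
  · have hy' : ¬ (N : ℤ) + 1 ≤ pos y := hy
    simp only [F]
    rw [if_neg hy']
    split_ifs with h0
    · have h := hpair t y w
      rwa [h0, Int.natAbs_zero, pow_zero, one_mul] at h
    · exact hX.one_sub_density_le_one t y w
  · have hy' : (N : ℤ) + 1 ≤ pos y := hy
    have hq1 := scale_le hN
    have hmy := pos_mem y
    obtain ⟨k, hk⟩ : ∃ k : ℕ, pos y = N + 1 + k := ⟨(pos y - (N + 1)).toNat, by omega⟩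
    rw [hF _ _ k hk, has]
    rcases Nat.eq_zero_or_pos k with rfl | hk0
    · obtain ⟨β, hβ0, hβ, hs⟩ := step_trunk hN (show pos y = N + 1 by omega)
      rw [hs, hF t _ 0 hk, hF t (N + 2) 1 (by omega)]
      have e0 : F t 0 = a t := (if_neg (by omega)).trans (if_pos rfl)
      have e1 : F t N = 1 := by simp only [F]; rw [if_neg (by omega), if_neg (by omega)]
      have e2 : F t (-N) = 1 := by simp only [F]; rw [if_neg (by omega), if_neg (by omega)]
      rw [e0, e1, e2, pow_zero, pow_one]
      have hc : 1 / 2 + (1 - β) / 6 + β * (1 + x) / 2 ≤ 1 - x * (1 - 2 * x) / 2 := by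
        nlinarith [mul_le_mul hβ hx4 hx (scale_pos N).le]
      have := mul_le_mul_of_nonneg_right hc (ha0 t)
      linarith
    · obtain ⟨j, rfl⟩ : ∃ j, k = j + 1 := ⟨k - 1, by omega⟩
      obtain ⟨β, hβ0, hβ, -, hs⟩ := step_pos hN (show 0 < pos y by omega) (by omega)
      rw [hs, hF t _ (j + 1) hk, hF t _ j (by omega), hF t _ (j + 2) (by omega)]
      have h := mul_le_mul_of_nonneg_right (lyapunov_le hx hx4 (hβ.trans hq))
        (mul_nonneg (show 0 ≤ (1 + x) ^ j by positivity) (ha0 t))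
      simp only [pow_succ]
      linarith

theorem tvDist_le_two_thirds {x : ℝ} (hx : 0 < x) (hx4 : x ≤ 1 / 4) (hq : scale N ≤ x ^ 2)
    (t : ℕ) : (chain N).tvDist t ≤
      2 / 3 + 2 / (x * (1 - 2 * x) / 2) * ((1 + x) ^ N * (1 - x * (1 - 2 * x) / 2) ^ t) := by
  have hX := isLazyReversible N
  have hl : 0 ≤ 1 - x * (1 - 2 * x) / 2 := by nlinarith
  have hpos : 0 < x * (1 - 2 * x) / 2 := div_pos (mul_pos hx (by linarith)) (by norm_num)
  refine hX.tvDist_le _ (fun y w => by positivity) (one_sub_density_le hN hx.le hx4 hq t)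
    (fun y => ?_)
  have hs : ∑ w, (chain N).stat w * (1 + x) ^ (pos w).natAbs ≤ 2 / (x * (1 - 2 * x) / 2) := by
    rw [le_div_iff₀ hpos, mul_comm]
    exact sum_stat_pow_mul_le hN hx.le hx4 hq
  have e : ∑ w, (chain N).stat w * (2 / 3 + (1 + x) ^ N *
      ((1 + x) ^ (pos w).natAbs * (1 - x * (1 - 2 * x) / 2) ^ t)) =
      2 / 3 + (∑ w, (chain N).stat w * (1 + x) ^ (pos w).natAbs) *
        ((1 + x) ^ N * (1 - x * (1 - 2 * x) / 2) ^ t) := by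
    have e1 : ∑ w, (chain N).stat w * (2 / 3) = 2 / 3 := by
      rw [← Finset.sum_mul, hX.stat_sum, one_mul]
    simp only [mul_add, Finset.sum_add_distrib, e1]
    rw [Finset.sum_mul]
    exact congrArg _ (Finset.sum_congr rfl fun w _ => by ring)
  rw [e]
  have := mul_le_mul_of_nonneg_right hs
    (show 0 ≤ (1 + x) ^ N * (1 - x * (1 - 2 * x) / 2) ^ t by positivity)
  linarith

end Fixed

/-! ### The second network: limits at linear times. -/

theorem tendsto_mul_scale : Tendsto (fun N : ℕ => (3 * N + 2) * scale N) atTop (𝓝 0) := by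
  have h : Tendsto (fun N : ℕ => 1 / 16 * (1 / 2 : ℝ) ^ N) atTop (𝓝 (1 / 16 * 0)) :=
    (tendsto_pow_atTop_nhds_zero_of_lt_one (by norm_num) (by norm_num)).const_mul _
  rw [mul_zero] at h
  exact squeeze_zero (fun N => mul_nonneg (by positivity) (scale_pos N).le) mul_scale_le h

theorem eventually_scale_le {δ : ℝ} (hδ : 0 < δ) : ∀ᶠ N in atTop, scale N ≤ δ := by
  filter_upwards [tendsto_mul_scale.eventually (eventually_le_nhds hδ)] with N h
  have := scale_pos N
  have : 0 ≤ (N : ℝ) * scale N := by positivity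
  linarith

theorem tendsto_floor_mul_scale {s : ℝ} (hs : 0 ≤ s) :
    Tendsto (fun N : ℕ => (⌊s * N⌋₊ : ℝ) * scale N) atTop (𝓝 0) := by
  have h := tendsto_mul_scale.const_mul s
  rw [mul_zero] at h
  refine squeeze_zero (fun N => mul_nonneg (by positivity) (scale_pos N).le) (fun N => ?_) h
  have hq := scale_pos N
  have h1 := Nat.floor_le (show 0 ≤ s * N by positivity)
  have h2 := mul_le_mul_of_nonneg_right h1 hq.le
  have h3 : 0 ≤ s * ((2 * N + 2) * scale N) := by positivity
  linarith

theorem antitone_sepDist : ∀ᶠ N in atTop, Antitone (chain N).sepDist :=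
  Eventually.of_forall fun N => (isLazyReversible N).sepDist_antitone

theorem antitone_tvDist : ∀ᶠ N in atTop, Antitone (chain N).tvDist :=
  Eventually.of_forall fun N => (isLazyReversible N).tvDist_antitone

theorem tendsto_sepDist_zero {s : ℝ} (hs : 4 < s) :
    Tendsto (fun n : ℕ => (chain n).sepDist ⌊s * n⌋₊) atTop (𝓝 0) := by
  -- The separation bound holds only for times between 4n and 5n; larger speeds follow by
  -- monotonicity.
  have hr4 : 4 < min s 5 := lt_min hs (by norm_num)
  have hrs : min s 5 ≤ s := min_le_left _ _
  have hr5 : min s 5 ≤ 5 := min_le_right _ _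
  set r := min s 5
  obtain ⟨x, hx0, hx4, hl0, hl1, hlim⟩ := exists_upper_rate (c := 2) (s := r / 2) le_rfl
    (by linarith)
  have h2 := (hlim.mul hlim).const_mul ((1 + x) ^ 2)
  rw [mul_zero, mul_zero] at h2
  refine squeeze_zero' (Eventually.of_forall fun n => ?_) ?_ h2
  · exact (show (0 : ℝ) ≤ (chain n).tvDist ⌊s * n⌋₊ from
      Real.iSup_nonneg fun x => by positivity).trans ((isLazyReversible n).tvDist_le_sepDist _)
  · filter_upwards [eventually_ge_atTop 1, eventually_scale_le (show 0 < x ^ 2 by positivity)]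
      with n hn hq
    have hn0 : (0 : ℝ) ≤ n := by positivity
    have h3 : ⌊r * n⌋₊ ≤ ⌊s * n⌋₊ := Nat.floor_le_floor (mul_le_mul_of_nonneg_right hrs hn0)
    refine ((isLazyReversible n).sepDist_antitone h3).trans ?_
    refine (sepDist_le_pow hn hx0.le hx4 hq (Nat.le_floor ?_) (Nat.floor_le_of_le ?_)).trans ?_
    · push_cast; exact mul_le_mul_of_nonneg_right hr4.le hn0
    · push_cast; exact mul_le_mul_of_nonneg_right hr5 hn0
    have hfl : ⌊r / 2 * n⌋₊ + ⌊r / 2 * n⌋₊ ≤ ⌊r * n⌋₊ := by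
      apply Nat.le_floor
      have := Nat.floor_le (show 0 ≤ r / 2 * n by positivity)
      push_cast
      linarith
    have hp := pow_le_pow_of_le_one hl0.le hl1.le hfl
    calc _ ≤ (1 + x) ^ (2 * n + 2) *
          (1 - x * (1 - 2 * x) / 2) ^ (⌊r / 2 * n⌋₊ + ⌊r / 2 * n⌋₊) := by gcongr
      _ = _ := by ring

theorem exists_lower_rate_double {s : ℝ} (hs0 : 0 ≤ s) (hs : s < 4) : ∃ x : ℝ, 0 < x ∧
    Tendsto (fun n : ℕ => (1 + x * (1 + x) / 2) ^ ⌊s * n⌋₊ * ((1 + x)⁻¹) ^ (2 * n)) atTop (𝓝 0) := by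
  obtain ⟨x, hx0, hx4, hlim⟩ := exists_lower_rate (c := 2) (s := s / 2) le_rfl (by linarith)
    (by linarith)
  have h2 := (hlim.mul hlim).const_mul (1 + x * (1 + x) / 2)
  rw [mul_zero, mul_zero] at h2
  refine ⟨x, hx0, squeeze_zero (fun n => by positivity) (fun n => ?_) h2⟩
  have hfl : ⌊s * n⌋₊ ≤ ⌊s / 2 * n⌋₊ + ⌊s / 2 * n⌋₊ + 1 := by
    refine Nat.lt_succ_iff.1 ((Nat.floor_lt (by positivity)).2 ?_)
    have := Nat.lt_floor_add_one (s / 2 * n)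
    push_cast
    linarith
  have hμ : 1 ≤ 1 + x * (1 + x) / 2 := by
    have : 0 ≤ x * (1 + x) / 2 := by positivity
    linarith
  calc _ ≤ (1 + x * (1 + x) / 2) ^ (⌊s / 2 * n⌋₊ + ⌊s / 2 * n⌋₊ + 1) * ((1 + x)⁻¹) ^ (2 * n) := by
        gcongr
    _ = _ := by ring

theorem tendsto_sepDist_one {s : ℝ} (hs0 : 0 ≤ s) (hs : s < 4) :
    Tendsto (fun n : ℕ => (chain n).sepDist ⌊s * n⌋₊) atTop (𝓝 1) := by
  obtain ⟨x, hx0, hlim⟩ := exists_lower_rate_double hs0 hs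
  have h := ((hlim.const_mul (5 / 2)).add ((tendsto_floor_mul_scale hs0).const_mul 5)).const_sub 1
  rw [mul_zero, mul_zero, add_zero, sub_zero] at h
  refine tendsto_of_tendsto_of_tendsto_of_le_of_le' h tendsto_const_nhds ?_
    (Eventually.of_forall fun n => (isLazyReversible n).sepDist_le_one _)
  filter_upwards [eventually_ge_atTop 1] with n hn
  refine le_trans (le_of_eq ?_) (le_sepDist hn hx0.le _)
  ring

theorem tendsto_tvDist_one {s : ℝ} (hs0 : 0 ≤ s) (hs : s < 2) :
    Tendsto (fun n : ℕ => (chain n).tvDist ⌊s * n⌋₊) atTop (𝓝 1) := by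
  obtain ⟨x, hx0, hx4, hlim⟩ := exists_lower_rate (c := 2) le_rfl hs0 hs
  have h := ((tendsto_mul_scale.const_mul 2).const_sub 1).sub
    ((hlim.const_mul (1 + x)).add (tendsto_floor_mul_scale hs0))
  rw [mul_zero, mul_zero, add_zero, sub_zero, sub_zero] at h
  refine tendsto_of_tendsto_of_tendsto_of_le_of_le' h tendsto_const_nhds ?_
    (Eventually.of_forall fun n => (isLazyReversible n).tvDist_le_one _)
  filter_upwards [eventually_ge_atTop 1] with n hn
  refine le_trans (le_of_eq ?_) (le_tvDist hn hx0.le _)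
  ring

theorem tendsto_tvDist_zero {s : ℝ} (hs : 4 < s) :
    Tendsto (fun n : ℕ => (chain n).tvDist ⌊s * n⌋₊) atTop (𝓝 0) :=
  squeeze_zero (fun n => Real.iSup_nonneg fun x => by positivity)
    (fun n => (isLazyReversible n).tvDist_le_sepDist _) (tendsto_sepDist_zero hs)

theorem sepCutoff : SepCutoff chain :=
  cutoffOf_of_tendsto (D := fun n => (chain n).sepDist) (by norm_num : (0 : ℝ) < 4)
    antitone_sepDist (fun _ => tendsto_sepDist_one) (fun _ => tendsto_sepDist_zero)

theorem tMixTendsToInfinity : TMixTendsToInfinity chain :=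
  tendsto_sInf_atTop (D := fun n => (chain n).tvDist) (by norm_num : (0 : ℝ) < 2) antitone_tvDist
    (fun _ => tendsto_tvDist_one) (tendsto_tvDist_zero (s := 5) (by norm_num)) (by norm_num)
    (by norm_num)

theorem tvRatio_eq_two_and_not_tvCutoff : tvRatio chain = 2 ∧ ¬ TVCutoff chain := by
  refine precutoffRatioOf_eq_two (D := fun n => (chain n).tvDist) (by norm_num : (0 : ℝ) < 2)
    antitone_tvDist (fun _ => tendsto_tvDist_one)
    (fun s hs => tendsto_tvDist_zero (by linarith)) (fun s h1 h2 => ?_) (fun s h1 h2 => ?_)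
  · have hs0 : 0 ≤ s := by linarith
    obtain ⟨x, hx0, hlim⟩ := exists_lower_rate_double hs0 (by linarith)
    have h := (hlim.add (tendsto_floor_mul_scale hs0)).const_sub (1 / 15)
    rw [add_zero, sub_zero] at h
    -- Any level below 1/15 would do here, as would any level in (2/3, 1) for the upper bound below.
    refine ⟨1 / 30, by norm_num, ?_⟩
    filter_upwards [eventually_ge_atTop 1,
      h.eventually (eventually_gt_nhds (show (1 / 30 : ℝ) < 1 / 15 by norm_num))] with n hn h3
    exact h3.trans_le (le_tvDist_trunk hn hx0.le _)
  · obtain ⟨x, hx0, hx4, hl0, hl1, hlim⟩ := exists_upper_rate (c := 2) le_rfl h1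
    have h := (hlim.const_mul (2 / (x * (1 - 2 * x) / 2))).const_add (2 / 3)
    rw [mul_zero, add_zero] at h
    refine ⟨5 / 6, by norm_num, ?_⟩
    filter_upwards [eventually_ge_atTop 1, eventually_scale_le (show 0 < x ^ 2 by positivity),
      h.eventually (eventually_le_nhds (show (2 / 3 : ℝ) < 5 / 6 by norm_num))] with n hn hq h3
    exact (tvDist_le_two_thirds hn hx0 hx4 hq _).trans h3

end TrunkNetwork

/-! ### The main theorem. -/

theorem mainTheorem3 :
    -- total-variation cutoff, but only pre-cutoff with ratio `2` in separation
    ((∀ n : ℕ, 2 ≤ n → (KilledSegment.chain n).IsLazyReversible) ∧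
      TMixTendsToInfinity KilledSegment.chain ∧
      TVCutoff KilledSegment.chain ∧
      (∀ s : ℝ, 0 ≤ s → s ≤ 6 →
        Tendsto (fun n : ℕ => (KilledSegment.chain n).sepDist ⌊s * n⌋₊) atTop (𝓝 1)) ∧
      (∀ s : ℝ, 6 ≤ s → s < 12 →
        Tendsto (fun n : ℕ => (KilledSegment.chain n).sepDist ⌊s * n⌋₊) atTop
          (𝓝 (Real.exp (-(s - 6) / 2)))) ∧
      (∀ s : ℝ, 12 < s →
        Tendsto (fun n : ℕ => (KilledSegment.chain n).sepDist ⌊s * n⌋₊) atTop (𝓝 0)) ∧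
      ¬ SepCutoff KilledSegment.chain ∧
      SepPrecutoff KilledSegment.chain ∧
      sepRatio KilledSegment.chain = 2) ∧
    -- separation cutoff, but only pre-cutoff with ratio `2` in total variation
    (∃ X : ℕ → FiniteChain,
      (∀ n, (X n).IsLazyReversible) ∧
      TMixTendsToInfinity X ∧
      SepCutoff X ∧
      ¬ TVCutoff X ∧
      TVPrecutoff X ∧
      tvRatio X = 2) ∧
    -- the constant `2` cannot be improved in either comparison of the pre-cutoff ratios
    (∀ c : ℝ≥0∞,
      (∀ X : ℕ → FiniteChain, (∀ n, (X n).IsLazyReversible) → TMixTendsToInfinity X →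
        sepRatio X ≤ c * tvRatio X) → 2 ≤ c) ∧
    (∀ c : ℝ≥0∞,
      (∀ X : ℕ → FiniteChain, (∀ n, (X n).IsLazyReversible) → TMixTendsToInfinity X →
        tvRatio X ≤ c * sepRatio X) → 2 ≤ c) := by
  have hsep := KilledSegment.sepRatio_eq_two_and_not_sepCutoff
  have htv := TrunkNetwork.tvRatio_eq_two_and_not_tvCutoff
  refine ⟨⟨fun _ hn => KilledSegment.isLazyReversible hn, KilledSegment.tMixTendsToInfinity,
    KilledSegment.tvCutoff, fun s _ hs => KilledSegment.tendsto_sepDist_one hs,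
    fun s h1 h2 => KilledSegment.tendsto_sepDist_exp h1 h2,
    fun s hs => KilledSegment.tendsto_sepDist_zero hs, hsep.2, ?_, hsep.1⟩,
    ⟨TrunkNetwork.chain, TrunkNetwork.isLazyReversible, TrunkNetwork.tMixTendsToInfinity,
      TrunkNetwork.sepCutoff, htv.2, ?_, htv.1⟩, fun c hc => ?_, fun c hc => ?_⟩
  · rw [SepPrecutoff, hsep.1]
    exact ENNReal.ofNat_lt_top
  · rw [TVPrecutoff, htv.1]
    exact ENNReal.ofNat_lt_top
  -- The hypothesis on c asks for lazy reversible chains at every index, while the first network is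
  -- one only from n = 2 on.
  · have h := hc (fun n => KilledSegment.chain (n + 2))
      (fun n => KilledSegment.isLazyReversible (by omega))
      (KilledSegment.tMixTendsToInfinity.comp (tendsto_add_atTop_nat 2))
    have h1 : sepRatio (fun n => KilledSegment.chain (n + 2)) = 2 :=
      (precutoffRatioOf_shift (fun n => (KilledSegment.chain n).tSep) 2).trans hsep.1
    have h2 : tvRatio (fun n => KilledSegment.chain (n + 2)) = 1 :=
      (precutoffRatioOf_shift (fun n => (KilledSegment.chain n).tMix) 2).trans
        (precutoffRatioOf_eq_one KilledSegment.tvCutoff)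
    rwa [h1, h2, mul_one] at h
  · have h := hc TrunkNetwork.chain TrunkNetwork.isLazyReversible TrunkNetwork.tMixTendsToInfinity
    have h1 : sepRatio TrunkNetwork.chain = 1 := precutoffRatioOf_eq_one TrunkNetwork.sepCutoff
    rwa [htv.1, h1, mul_one] at h
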